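/- Let $\ell_1,\ell_2\in\mathbb Z_{\ge 0}$ with $\ell:=\ell_1+\ell_2>0$, let $G^2=\mathrm U(1)^{\ell_1}\times\mathbb R^{\ell_2}$, and write $e$ for its identity element. Let $T_1,\dots,T_\ell$ be the natural basis of its Lie algebra, so that $\exp(\sum_i t_iT_i)=(e^{\mathrm i t_1},\dots,e^{\mathrm i t_{\ell_1}},t_{\ell_1+1},\dots,t_\ell)$. Let $(\mathcal M,P_{\mathcal M})$ be a connected smooth ($C^\infty$, Hausdorff, second countable) Poisson manifold of dimension $d$. Its bivector defines the bracket $\{F,H\}=(dF\otimes dH)(P_{\mathcal M})$ and the Hamiltonian vector fields $V_H$ by $dF(V_H)=\{F,H\}$; for vector fields, $v\wedge w=v\otimes w-w\otimes v$. Suppose that $G^2$ acts on $\mathcal M$ by a smooth, proper, effective Hamiltonian action with momentum map $(P_1,\dots,P_\ell):\mathcal M\to\mathbb R^\ell$. This means that the $P_i$ are smooth $G^2$-invariant functions and that, for every $i$, $V_{P_i}$ is the vector field on $\mathcal M$ associated with $T_i$, i.e. $V_{P_i}(y)=\frac{d}{dt}\big|_{t=0}\exp(tT_i)\,y$. Let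 $y_0\in\mathcal M$ have trivial isotropy group and put $p_i:=P_i-P_i(y_0)$. Then $2\ell\le d$, and there exist a $G^2$-invariant open neighbourhood $\mathcal U\subset\mathcal M$ of $y_0$, a number $\epsilon>0$ and functions $\theta_1,\dots,\theta_\ell,z_1,\dots,z_{d-2\ell}:\mathcal U\to\mathbb R$ (where $\theta_1,\dots,\theta_{\ell_1}$ are angles, which matter only modulo $2\pi$ and need not be continuous) such that: 1. the functions $(e^{\mathrm i\theta_1},\dots,e^{\mathrm i\theta_{\ell_1}},\theta_{\ell_1+1},\dots,\theta_\ell,p_1,\dots,p_\ell,z_1,\dots,z_{d-2\ell})$ define a diffeomorphism $\mathcal U\to G^2\times(-\epsilon,\epsilon)^{d-\ell}$ under which $y_0$ corresponds to $(e,0)$; 2. in terms of these coordinates the Poisson structure is $$P_{\mathcal M}\big|_{\mathcal U}=\sum_{i=1}^{\ell}\frac{\partial}{\partial\theta_i}\wedge\frac{\partial}{\partial p_i}+\sum_{1\le a<b\le d-2\ell}f_{ab}(z)\,\frac{\partial}{\partial z_a}\wedge\frac{\partial}{\partial z_b}$$ for some smooth functions $f_{ab}$ on $(-\epsilon,\epsilon)^{d-2\ell}$,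 depending only on $z_1,\dots,z_{d-2\ell}$. -/

import Mathlib

open scoped Manifold ContDiff

noncomputable section

/-! ### The Lie group `U(1)^ℓ₁ × ℝ^ℓ₂`

The group is the product of `ℓ₁` copies of the unit circle and the additive group `ℝ^ℓ₂`, the latter
written multiplicatively. It carries the product topology and the product manifold structure. -/

section PiManifold

variable {ι : Type*} [Fintype ι] {E : ι → Type*} [∀ i, NormedAddCommGroup (E i)]
  [∀ i, NormedSpace ℝ (E i)] {H : ι → Type*} [∀ i, TopologicalSpace (H i)]
  {I : ∀ i, ModelWithCorners ℝ (E i) (H i)}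
  {N : ι → Type*} [∀ i, TopologicalSpace (N i)] [∀ i, ChartedSpace (H i) (N i)] {n : ℕ∞ω}
  {E' : Type*} [NormedAddCommGroup E'] [NormedSpace ℝ E'] {H' : Type*} [TopologicalSpace H']
  {I' : ModelWithCorners ℝ E' H'} {X : Type*} [TopologicalSpace X] [ChartedSpace H' X]

/-- A map into a finite product of manifolds is `C^n` iff its components are. -/
theorem contMDiff_piManifold_iff {f : X → ∀ i, N i} :
    ContMDiff I' (ModelWithCorners.pi I) n f ↔ ∀ i, ContMDiff I' (I i) n fun x => f x i := by
  have key : ∀ x, ContMDiffAt I' (ModelWithCorners.pi I) n f x ↔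
      ∀ i, ContMDiffAt I' (I i) n (fun x => f x i) x := by
    intro x
    simp only [contMDiffAt_iff, continuousAt_pi, forall_and]
    refine and_congr_right fun _ => ?_
    rw [contDiffWithinAt_pi]
    rfl
  exact ⟨fun h i x => (key x).1 (h x) i, fun h x => (key x).2 fun i => h i x⟩

/-- The projections of a finite product of manifolds are `C^n`. -/
theorem contMDiff_piManifold_apply (i : ι) :
    ContMDiff (ModelWithCorners.pi I) (I i) n fun x : ∀ i, N i => x i :=
  contMDiff_piManifold_iff.1 (contMDiff_id (I := ModelWithCorners.pi I)) i

instance piManifold_isManifold [∀ i, IsManifold (I i) n (N i)] :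
    IsManifold (ModelWithCorners.pi I) n (∀ i, N i) := by
  refine isManifold_of_contDiffOn _ _ _ ?_
  rintro _ _ ⟨e, he, rfl⟩ ⟨e', he', rfl⟩
  rw [contDiffOn_pi]
  intro i
  have h := (contDiffGroupoid n (I i)).compatible (he i trivial) (he' i trivial)
  rw [contDiffGroupoid, mem_groupoid_of_pregroupoid] at h
  have h1 := h.1
  simp only [contDiffPregroupoid] at h1
  refine ContDiffOn.comp (t := (I i).symm ⁻¹' ((e i).symm ≫ₕ e' i).source ∩ Set.range (I i))
    (f := fun x : (∀ i, E i) => x i) h1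
    (ContinuousLinearMap.proj (R := ℝ) (φ := E) i).contDiff.contDiffOn ?_
  rintro x ⟨hx, ⟨y, rfl⟩⟩
  refine ⟨?_, ⟨y i, rfl⟩⟩
  have h2 := hx
  simp only [Set.mem_preimage, OpenPartialHomeomorph.trans_source, Set.mem_inter_iff] at h2 ⊢
  exact ⟨h2.1 i trivial, h2.2 i trivial⟩

instance piManifold_lieGroup [∀ i, Group (N i)] [∀ i, LieGroup (I i) n (N i)] :
    LieGroup (ModelWithCorners.pi I) n (∀ i, N i) where
  contMDiff_mul := contMDiff_piManifold_iff.2 fun i =>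
    ((contMDiff_piManifold_apply i).comp contMDiff_fst).mul
      ((contMDiff_piManifold_apply i).comp contMDiff_snd)
  contMDiff_inv := contMDiff_piManifold_iff.2 fun i => (contMDiff_piManifold_apply i).inv

end PiManifold

section MultiplicativeVectorSpace

variable {V : Type*} [NormedAddCommGroup V] [NormedSpace ℝ V]

instance multiplicative_chartedSpace : ChartedSpace V (Multiplicative V) :=
  inferInstanceAs (ChartedSpace V V)

instance multiplicative_lieGroup : LieGroup 𝓘(ℝ, V) ∞ (Multiplicative V) where
  toIsManifold := inferInstanceAs (IsManifold 𝓘(ℝ, V) ∞ V)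
  contMDiff_mul := contMDiff_add 𝓘(ℝ, V) ∞ (G := V)
  contMDiff_inv := contMDiff_neg 𝓘(ℝ, V) ∞ (G := V)

end MultiplicativeVectorSpace

/-- The generalized torus `U(1)^ℓ₁ × ℝ^ℓ₂`. -/
abbrev GenTorus (ℓ₁ ℓ₂ : ℕ) : Type :=
  (Fin ℓ₁ → Circle) × Multiplicative (Fin ℓ₂ → ℝ)

namespace GenTorus

/-- The index set of the natural basis of the Lie algebra `ℝ^(ℓ₁ + ℓ₂)` of `U(1)^ℓ₁ × ℝ^ℓ₂`. -/
abbrev Idx (ℓ₁ ℓ₂ : ℕ) : Type := Fin ℓ₁ ⊕ Fin ℓ₂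

/-- The model with corners of the Lie group `U(1)^ℓ₁ × ℝ^ℓ₂`. -/
abbrev model (ℓ₁ ℓ₂ : ℕ) :=
  (ModelWithCorners.pi fun _ : Fin ℓ₁ => 𝓡 1).prod 𝓘(ℝ, Fin ℓ₂ → ℝ)

instance lieGroup (ℓ₁ ℓ₂ : ℕ) : LieGroup (model ℓ₁ ℓ₂) ∞ (GenTorus ℓ₁ ℓ₂) := by
  have : ∀ _ : Fin ℓ₁, LieGroup (𝓡 1) ∞ Circle := fun _ => LieGroup.of_le le_top
  infer_instance

/-- The exponential map
`(t₁, …, t_ℓ) ↦ (exp (i t₁), …, exp (i t_ℓ₁), t_(ℓ₁+1), …, t_ℓ)` of `U(1)^ℓ₁ × ℝ^ℓ₂`. -/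
def exp {ℓ₁ ℓ₂ : ℕ} (t : Idx ℓ₁ ℓ₂ → ℝ) : GenTorus ℓ₁ ℓ₂ :=
  (fun i => Circle.exp (t (Sum.inl i)), Multiplicative.ofAdd fun j => t (Sum.inr j))

theorem contMDiff_exp {ℓ₁ ℓ₂ : ℕ} :
    ContMDiff 𝓘(ℝ, Idx ℓ₁ ℓ₂ → ℝ) (model ℓ₁ ℓ₂) ∞
      (exp : (Idx ℓ₁ ℓ₂ → ℝ) → GenTorus ℓ₁ ℓ₂) := by
  refine ContMDiff.prodMk (contMDiff_piManifold_iff.2 fun i => ?_) ?_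
  · exact contMDiff_circleExp.comp
      (contDiff_apply ℝ ℝ (Sum.inl i : Idx ℓ₁ ℓ₂)).contMDiff
  · have h : ContDiff ℝ ∞ fun (t : Idx ℓ₁ ℓ₂ → ℝ) (j : Fin ℓ₂) => t (Sum.inr j) :=
      contDiff_pi.2 fun j => contDiff_apply ℝ ℝ (Sum.inr j : Idx ℓ₁ ℓ₂)
    exact h.contMDiff

end GenTorus

/-! ### Poisson manifolds and Hamiltonian actions -/

section Poisson

variable {d : ℕ} {M : Type*} [TopologicalSpace M] [ChartedSpace (EuclideanSpace ℝ (Fin d)) M]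

/-- The cotangent space of the `d`-dimensional manifold `M` at `y`. -/
abbrev Cotangent (d : ℕ) {M : Type*} [TopologicalSpace M]
    [ChartedSpace (EuclideanSpace ℝ (Fin d)) M] (y : M) : Type :=
  TangentSpace (𝓡 d) y →L[ℝ] ℝ

/-- A (not necessarily smooth) field of bilinear forms on the cotangent spaces. -/
abbrev CotangentBilin (d : ℕ) (M : Type*) [TopologicalSpace M]
    [ChartedSpace (EuclideanSpace ℝ (Fin d)) M] : Type _ :=
  ∀ y : M, Cotangent d y →ₗ[ℝ] Cotangent d y →ₗ[ℝ] ℝ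

/-- The bracket `{F, H} = (dF ⊗ dH)(P)`. -/
def CotangentBilin.bracket (P : CotangentBilin d M) (F H : M → ℝ) : M → ℝ :=
  fun y => P y (mvfderiv (𝓡 d) F y) (mvfderiv (𝓡 d) H y)

/-- A smooth Poisson structure: a smooth bivector field (an alternating bilinear form on every
cotangent space, such that the bracket of smooth functions is smooth) whose bracket satisfies the
Jacobi identity. Functions are allowed to be defined on open subsets only. -/
structure PoissonStructure (d : ℕ) (M : Type*) [TopologicalSpace M]
    [ChartedSpace (EuclideanSpace ℝ (Fin d)) M] where
  /-- The Poisson bivector. -/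
  bivector : CotangentBilin d M
  alternating : ∀ (y : M) (α : Cotangent d y), bivector y α α = 0
  smooth : ∀ (W : Set M) (F H : M → ℝ), IsOpen W →
    ContMDiffOn (𝓡 d) 𝓘(ℝ) ∞ F W → ContMDiffOn (𝓡 d) 𝓘(ℝ) ∞ H W →
    ContMDiffOn (𝓡 d) 𝓘(ℝ) ∞ (bivector.bracket F H) W
  jacobi : ∀ (W : Set M) (F H K : M → ℝ), IsOpen W →
    ContMDiffOn (𝓡 d) 𝓘(ℝ) ∞ F W → ContMDiffOn (𝓡 d) 𝓘(ℝ) ∞ H W →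
    ContMDiffOn (𝓡 d) 𝓘(ℝ) ∞ K W → ∀ y ∈ W,
      bivector.bracket F (bivector.bracket H K) y + bivector.bracket H (bivector.bracket K F) y +
        bivector.bracket K (bivector.bracket F H) y = 0

variable {ℓ₁ ℓ₂ : ℕ}

/-- The vector field `T_i` on `M` associated with the `i`-th element of the natural basis of the
Lie algebra of `U(1)^ℓ₁ × ℝ^ℓ₂`: the velocity at `t = 0` of `t ↦ exp (t e_i) • y`. -/
def fundamentalField (d : ℕ) {M : Type*} [TopologicalSpace M]
    [ChartedSpace (EuclideanSpace ℝ (Fin d)) M] [MulAction (GenTorus ℓ₁ ℓ₂) M]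
    (i : GenTorus.Idx ℓ₁ ℓ₂) (y : M) : TangentSpace (𝓡 d) y :=
  mfderiv 𝓘(ℝ) (𝓡 d) (fun t : ℝ => (GenTorus.exp (Pi.single i t) : GenTorus ℓ₁ ℓ₂) • y) 0
    (1 : ℝ)

/-- `p = (p_1, …, p_ℓ)` is an (equivariant) momentum map for the action of the Abelian group
`U(1)^ℓ₁ × ℝ^ℓ₂` on the Poisson manifold `M`. An action having a momentum map is a
Hamiltonian action. -/
structure IsMomentumMap [MulAction (GenTorus ℓ₁ ℓ₂) M] (P : PoissonStructure d M)
    (p : GenTorus.Idx ℓ₁ ℓ₂ → M → ℝ) : Prop where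
  smooth : ∀ i, ContMDiff (𝓡 d) 𝓘(ℝ) ∞ (p i)
  /-- `T_i` is the Hamiltonian vector field of `p_i`, where `dF(V_H) = {F, H}`. -/
  hamiltonian : ∀ (i : GenTorus.Idx ℓ₁ ℓ₂) (y : M) (α : Cotangent d y),
    α (fundamentalField d i y) = P.bivector y α (mvfderiv (𝓡 d) (p i) y)
  /-- The momentum map is equivariant; the coadjoint action is trivial. -/
  equivariant : ∀ (i : GenTorus.Idx ℓ₁ ℓ₂) (g : GenTorus ℓ₁ ℓ₂) (y : M), p i (g • y) = p i y

end Poisson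

/-! ### Cubes and coordinates -/

/-- The open cube `(-ε, ε)^ι`, as an open submanifold of `ℝ^ι`. -/
def Cube (ι : Type*) [Fintype ι] (ε : ℝ) : TopologicalSpace.Opens (ι → ℝ) where
  carrier := Set.univ.pi fun _ => Set.Ioo (-ε) ε
  is_open' := isOpen_set_pi Set.finite_univ fun _ _ => isOpen_Ioo

section Coordinates

variable {d : ℕ} {M : Type*} [TopologicalSpace M] [ChartedSpace (EuclideanSpace ℝ (Fin d)) M]
  {ℓ₁ ℓ₂ : ℕ} {ι : Type*} [Fintype ι] {ε : ℝ} {U : TopologicalSpace.Opens M}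

/-- The type of diffeomorphisms from an open subset `U` of `M` to
`(U(1)^ℓ₁ × ℝ^ℓ₂) × (-ε, ε)^ι`. -/
abbrev TubeDiffeo (d ℓ₁ ℓ₂ : ℕ) {M : Type*} [TopologicalSpace M]
    [ChartedSpace (EuclideanSpace ℝ (Fin d)) M] (U : TopologicalSpace.Opens M)
    (ι : Type*) [Fintype ι] (ε : ℝ) : Type _ :=
  Diffeomorph (𝓡 d) ((GenTorus.model ℓ₁ ℓ₂).prod 𝓘(ℝ, ι → ℝ)) U
    (GenTorus ℓ₁ ℓ₂ × Cube ι ε) ∞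

/-- The point of `M` with coordinates `θ = (θ_1, …, θ_ℓ)` and `x ∈ (-ε, ε)^ι`. The first `ℓ₁`
coordinates `θ_i` are angles, which matter modulo `2π` only. -/
def TubeDiffeo.point (Φ : TubeDiffeo d ℓ₁ ℓ₂ U ι ε)
    (q : (GenTorus.Idx ℓ₁ ℓ₂ → ℝ) × Cube ι ε) : M :=
  (Φ.symm (GenTorus.exp q.1, q.2) : U)

/-- The coordinate vector field `∂/∂θ_i` at the point with coordinates `q = (θ, x)`. -/
def TubeDiffeo.dTheta (Φ : TubeDiffeo d ℓ₁ ℓ₂ U ι ε)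
    (q : (GenTorus.Idx ℓ₁ ℓ₂ → ℝ) × Cube ι ε) (i : GenTorus.Idx ℓ₁ ℓ₂) :
    TangentSpace (𝓡 d) (Φ.point q) :=
  mfderiv (𝓘(ℝ, GenTorus.Idx ℓ₁ ℓ₂ → ℝ).prod 𝓘(ℝ, ι → ℝ)) (𝓡 d) Φ.point q
    ((Pi.single i 1 : GenTorus.Idx ℓ₁ ℓ₂ → ℝ), (0 : ι → ℝ))

/-- The coordinate vector field `∂/∂x_c` at the point with coordinates `q = (θ, x)`. -/
def TubeDiffeo.dX [DecidableEq ι] (Φ : TubeDiffeo d ℓ₁ ℓ₂ U ι ε)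
    (q : (GenTorus.Idx ℓ₁ ℓ₂ → ℝ) × Cube ι ε) (c : ι) :
    TangentSpace (𝓡 d) (Φ.point q) :=
  mfderiv (𝓘(ℝ, GenTorus.Idx ℓ₁ ℓ₂ → ℝ).prod 𝓘(ℝ, ι → ℝ)) (𝓡 d) Φ.point q
    ((0 : GenTorus.Idx ℓ₁ ℓ₂ → ℝ), (Pi.single c 1 : ι → ℝ))

/-- The bivector `v ∧ w = v ⊗ w - w ⊗ v`, evaluated on the covectors `α` and `β`. -/
def wedge {y : M} (v w : TangentSpace (𝓡 d) y) (α β : Cotangent d y) : ℝ :=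
  α v * β w - α w * β v

end Coordinates

end

/-! The local part is the theorem of Carathéodory, Jacobi and Lie. In a chart, the Hamiltonian
fields of the momenta are the fundamental fields. They are independent at `y₀` because the isotropy
group is trivial, and the momenta are in involution because `{p_i, p_j}` is the derivative of the
invariant function `p_i` along an orbit. By the Jacobi identity, functions with locally constant
brackets have commuting Hamiltonian fields. If these are also independent, they can be straightened
(`exists_straightening`), which yields functions conjugate to the given ones together with joint
first integrals (`IsPoissonOn.exists_conjugate`). Adding one conjugate function at a time gives the
`θ_i`; the joint first integrals of the fields of all `p_i` and `θ_i` are the `z_a`.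

Straightening needs a joint flow that is smooth in times and initial point. It comes from the
implicit function theorem on `C([0, 1], E)`, applied to the integral equation of the flow; hence the
smoothness of composition operators and the Volterra operator.

For the global part only the slice `θ = 0` of the local coordinates is kept, and the group moves it
around (`tubeMap`). Since the local `θ`-directions are the fundamental fields, the tube map and the
local parametrization have the same derivative along the slice. So the tube map is a local
diffeomorphism there, and by equivariance everywhere. Properness and trivial isotropy make each
orbit meet a small slice at most once, with trivial group element (`eventually_injective_tube`).

It remains to compute the bivector on the tube (`IsPoissonOn.exists_normal_form`). Along the slice
the brackets `{θ_i, θ_j}` and `{z_a, θ_j}` vanish by the first-order agreement. On the whole tube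
the field of `p_i` is `∂/∂θ_i`, so the Jacobi identity makes the bivector invariant under
translations in `θ`, and these brackets vanish everywhere. Then the field of `θ_i` is `-∂/∂p_i`, the
same argument gives invariance under translations in `p`, and the brackets `{z_a, z_b}` depend on
`z` alone. -/

open Topology Filter

/-! ### Composition operators on spaces of continuous functions -/

section Nemytskii

universe u

/-- Pointwise application `C(K, E →L F) → C(K, E) → C(K, F)`, as a continuous bilinear map. -/
noncomputable def ContinuousMap.applyCLM (K : Type*) [TopologicalSpace K] [CompactSpace K]
    (E F : Type*) [NormedAddCommGroup E] [NormedSpace ℝ E]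
    [NormedAddCommGroup F] [NormedSpace ℝ F] :
    C(K, E →L[ℝ] F) →L[ℝ] C(K, E) →L[ℝ] C(K, F) :=
  LinearMap.mkContinuous₂
    (LinearMap.mk₂ ℝ
      (fun (A : C(K, E →L[ℝ] F)) (v : C(K, E)) => (⟨fun t => A t (v t), by fun_prop⟩ : C(K, F)))
      (by intros; ext; simp) (by intros; ext; simp) (by intros; ext; simp)
      (by intros; ext; simp)) 1 (by
        intro A v
        rw [one_mul, ContinuousMap.norm_le _ (by positivity)]
        intro t
        refine ((A t).le_opNorm _).trans ?_
        gcongr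
        · exact A.norm_coe_le_norm t
        · exact v.norm_coe_le_norm t)

variable {K : Type*} [TopologicalSpace K] [CompactSpace K]

@[simp]
theorem ContinuousMap.applyCLM_apply {E F : Type*} [NormedAddCommGroup E] [NormedSpace ℝ E]
    [NormedAddCommGroup F] [NormedSpace ℝ F] (A : C(K, E →L[ℝ] F)) (v : C(K, E)) (t : K) :
    ContinuousMap.applyCLM K E F A v t = A t (v t) := rfl

variable {E F : Type u} [NormedAddCommGroup E] [NormedSpace ℝ E]
    [NormedAddCommGroup F] [NormedSpace ℝ F]

/-- The pointwise mean value inequality is uniform in `t`, because `v ↦ f' ∘ v` is continuous for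
the sup norm. -/
theorem ContinuousMap.hasFDerivAt_comp {f : C(E, F)} {f' : C(E, E →L[ℝ] F)}
    (h : ∀ x, HasFDerivAt f (f' x) x) (u : C(K, E)) :
    HasFDerivAt (fun v : C(K, E) => f.comp v)
      (ContinuousMap.applyCLM K E F (f'.comp u)) u := by
  rw [hasFDerivAt_iff_isLittleO, Asymptotics.isLittleO_iff]
  intro c hc
  have hcont : Continuous fun v : C(K, E) => f'.comp v := f'.continuous_postcomp
  have hev : ∀ᶠ v in 𝓝 u, dist (f'.comp v) (f'.comp u) < c :=
    (hcont.tendsto u) (Metric.ball_mem_nhds (f'.comp u) hc)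
  obtain ⟨δ, hδ, hball⟩ := Metric.eventually_nhds_iff.1 hev
  filter_upwards [Metric.ball_mem_nhds u hδ] with v hv
  rw [ContinuousMap.norm_le _ (by positivity)]
  intro t
  have hseg : ∀ x ∈ segment ℝ (u t) (v t), ‖f' x - f' (u t)‖ ≤ c := by
    rintro x ⟨a, b, ha, hb, hab, rfl⟩
    -- A point of the segment from `u t` to `v t` is the value at `t` of the function `a • u + b •
    -- v`, which lies in the same ball around `u`; so the closeness of `f' ∘ v` to `f' ∘ u` applies
    -- to it.
    have hw : dist (a • u + b • v) u < δ := by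
      have h1 : a • u + b • v - u = b • (v - u) := by
        have : a = 1 - b := by linarith
        subst this; module
      rw [dist_eq_norm, h1, norm_smul, Real.norm_eq_abs, abs_of_nonneg hb]
      have h2 : ‖v - u‖ < δ := by rwa [← dist_eq_norm]
      have h3 : b ≤ 1 := by linarith
      nlinarith [norm_nonneg (v - u)]
    have h4 := (ContinuousMap.dist_apply_le_dist t).trans (hball hw).le
    rw [dist_eq_norm] at h4
    simpa using h4
  have := (convex_segment (𝕜 := ℝ) (u t) (v t)).norm_image_sub_le_of_norm_hasFDerivWithin_le'
    (fun x _ => (h x).hasFDerivWithinAt) hseg (left_mem_segment ℝ _ _) (right_mem_segment ℝ _ _)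
  refine this.trans ?_
  gcongr
  exact (v - u).norm_coe_le_norm t

/-- Induction on `n` for all targets at once: the derivative of composition with `f` is built from
composition with `f'`, whose values lie in `E →L[ℝ] F`. This is why `E` and `F` share a universe. -/
theorem ContinuousMap.contDiff_comp_nat (n : ℕ) :
    ∀ {F : Type u} [NormedAddCommGroup F] [NormedSpace ℝ F] {f : C(E, F)},
      ContDiff ℝ n f → ContDiff ℝ n fun v : C(K, E) => f.comp v := by
  induction n with
  | zero =>
    intro F _ _ f _
    exact contDiff_zero.2 f.continuous_postcomp
  | succ n ih =>
    intro F _ _ f hf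
    push_cast at hf ⊢
    obtain ⟨f', hf', h⟩ := contDiff_succ_iff_hasFDerivAt.1 hf
    refine contDiff_succ_iff_hasFDerivAt.2
      ⟨fun u => ContinuousMap.applyCLM K E F ((⟨f', hf'.continuous⟩ : C(E, E →L[ℝ] F)).comp u),
        ?_, fun u => ContinuousMap.hasFDerivAt_comp (f' := ⟨f', hf'.continuous⟩) h u⟩
    exact (ContinuousMap.applyCLM K E F).contDiff.comp (ih (f := ⟨f', hf'.continuous⟩) hf')

/-- Composition with a smooth map is a smooth map between spaces of continuous functions. -/
theorem ContinuousMap.contDiff_comp {f : C(E, F)} (hf : ContDiff ℝ ∞ f) :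
    ContDiff ℝ ∞ fun v : C(K, E) => f.comp v :=
  contDiff_infty.2 fun n => ContinuousMap.contDiff_comp_nat n (contDiff_infty.1 hf n)

end Nemytskii

/-! ### The Volterra operator -/

section Volterra

variable {E : Type*} [NormedAddCommGroup E] [NormedSpace ℝ E]

/-- Indefinite integration `u ↦ (t ↦ ∫₀ᵗ u)` on `C([0, 1], E)`. -/
noncomputable def volterra (E : Type*) [NormedAddCommGroup E] [NormedSpace ℝ E] :
    C(unitInterval, E) →L[ℝ] C(unitInterval, E) :=
  LinearMap.mkContinuous
    { toFun := fun u => ⟨fun t => ∫ s in (0 : ℝ)..t, Set.IccExtend zero_le_one u s, by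
        have : Continuous (Set.IccExtend (zero_le_one (α := ℝ)) u) := u.continuous.Icc_extend'
        exact (intervalIntegral.continuous_primitive (fun a b => this.intervalIntegrable a b)
          0).comp continuous_subtype_val⟩
      map_add' := by
        intro u v
        ext t
        have hu : Continuous (Set.IccExtend (zero_le_one (α := ℝ)) u) := u.continuous.Icc_extend'
        have hv : Continuous (Set.IccExtend (zero_le_one (α := ℝ)) v) := v.continuous.Icc_extend'
        exact intervalIntegral.integral_add (hu.intervalIntegrable _ _) (hv.intervalIntegrable _ _)
      map_smul' := by
        intro c u
        ext t
        exact intervalIntegral.integral_smul c _ } 1 (by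
      intro u
      rw [one_mul, ContinuousMap.norm_le _ (by positivity)]
      intro t
      have := intervalIntegral.norm_integral_le_of_norm_le_const (a := (0 : ℝ)) (b := t)
        (f := Set.IccExtend zero_le_one u) (C := ‖u‖) fun x _ => u.norm_coe_le_norm _
      refine this.trans ?_
      rw [sub_zero, abs_of_nonneg t.2.1]
      exact mul_le_of_le_one_right (norm_nonneg _) t.2.2)

theorem volterra_apply (u : C(unitInterval, E)) (t : unitInterval) :
    volterra E u t = ∫ s in (0 : ℝ)..t, Set.IccExtend zero_le_one u s := rfl

/-- A continuous function on `[0, 1]` is the integral of its derivative. -/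
theorem eq_volterra_of_hasDerivAt [CompleteSpace E] {u w : C(unitInterval, E)} (h0 : u 0 = 0)
    (h : ∀ t : unitInterval, HasDerivWithinAt (Set.IccExtend zero_le_one u) (w t)
      (Set.Icc 0 1) t) : u = volterra E w := by
  ext t
  rw [volterra_apply]
  have hu : Continuous (Set.IccExtend (zero_le_one (α := ℝ)) u) := u.continuous.Icc_extend'
  have hw : Continuous (Set.IccExtend (zero_le_one (α := ℝ)) w) := w.continuous.Icc_extend'
  rw [intervalIntegral.integral_eq_sub_of_hasDerivAt_of_le t.2.1 hu.continuousOn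
    (fun x hx => ?_) (hw.intervalIntegrable _ _)]
  · have h1 : Set.IccExtend (zero_le_one (α := ℝ)) u t = u t := Set.IccExtend_val _ _ _
    have h2 : Set.IccExtend (zero_le_one (α := ℝ)) u 0 = u 0 := by
      rw [Set.IccExtend_left]; rfl
    rw [h1, h2, h0, sub_zero]
  · have hx' : x ∈ Set.Icc (0 : ℝ) 1 := ⟨hx.1.le, hx.2.le.trans t.2.2⟩
    rw [Set.IccExtend_of_mem _ _ hx']
    exact (h ⟨x, hx'⟩).hasDerivAt (Icc_mem_nhds hx.1 (hx.2.trans_le t.2.2))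

theorem hasDerivWithinAt_volterra [CompleteSpace E] (w : C(unitInterval, E)) (t : unitInterval) :
    HasDerivWithinAt (Set.IccExtend zero_le_one (volterra E w)) (w t) (Set.Icc 0 1) t := by
  have hw : Continuous (Set.IccExtend (zero_le_one (α := ℝ)) w) := w.continuous.Icc_extend'
  have h := (hw.integral_hasStrictDerivAt 0 t).hasDerivAt.hasDerivWithinAt (s := Set.Icc 0 1)
  rw [Set.IccExtend_val] at h
  refine h.congr (fun x hx => ?_) ?_
  · rw [Set.IccExtend_of_mem _ _ hx]; rfl
  · rw [Set.IccExtend_val]; rfl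

end Volterra

/-! ### Smoothness near a point -/

section SmoothNear

variable {E F G : Type*} [NormedAddCommGroup E] [NormedSpace ℝ E]
  [NormedAddCommGroup F] [NormedSpace ℝ F] [NormedAddCommGroup G] [NormedSpace ℝ G]

/-- `f` is smooth on a neighbourhood of `x`. -/
def SmoothNear (f : E → F) (x : E) : Prop := ∀ᶠ y in 𝓝 x, ContDiffAt ℝ ∞ f y

theorem SmoothNear.contDiffAt {f : E → F} {x : E} (h : SmoothNear f x) : ContDiffAt ℝ ∞ f x :=
  h.self_of_nhds

theorem SmoothNear.continuousAt {f : E → F} {x : E} (h : SmoothNear f x) : ContinuousAt f x :=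
  h.contDiffAt.continuousAt

theorem SmoothNear.differentiableAt {f : E → F} {x : E} (h : SmoothNear f x) :
    DifferentiableAt ℝ f x := h.contDiffAt.differentiableAt (by simp)

theorem SmoothNear.eventually {f : E → F} {x : E} (h : SmoothNear f x) :
    ∀ᶠ y in 𝓝 x, SmoothNear f y := eventually_eventually_nhds.2 h

theorem SmoothNear.congr {f g : E → F} {x : E} (h : SmoothNear f x) (hg : g =ᶠ[𝓝 x] f) :
    SmoothNear g x := by
  filter_upwards [h, hg.eventually_nhds] with y h1 h2 using h1.congr_of_eventuallyEq h2

theorem ContDiff.smoothNear {f : E → F} (h : ContDiff ℝ ∞ f) (x : E) : SmoothNear f x :=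
  Eventually.of_forall fun _ => h.contDiffAt

theorem SmoothNear.comp {f : E → F} {g : F → G} {x : E} (hg : SmoothNear g (f x))
    (hf : SmoothNear f x) : SmoothNear (fun y => g (f y)) x := by
  filter_upwards [hf, hf.continuousAt.eventually hg] with y h1 h2 using h2.comp y h1

theorem SmoothNear.fderiv {f : E → F} {x : E} (h : SmoothNear f x) :
    SmoothNear (fderiv ℝ f) x :=
  h.mono fun _ hy => hy.fderiv_right (m := ∞) (by simp)

theorem SmoothNear.add {f g : E → F} {x : E} (hf : SmoothNear f x) (hg : SmoothNear g x) :
    SmoothNear (fun y => f y + g y) x := by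
  filter_upwards [hf, hg] with y h1 h2 using h1.add h2

theorem SmoothNear.smul {f : E → ℝ} {g : E → F} {x : E} (hf : SmoothNear f x)
    (hg : SmoothNear g x) : SmoothNear (fun y => f y • g y) x := by
  filter_upwards [hf, hg] with y h1 h2 using h1.fun_smul h2

theorem SmoothNear.sum {ι : Type*} {s : Finset ι} {f : ι → E → F} {x : E}
    (h : ∀ i, SmoothNear (f i) x) : SmoothNear (fun y => ∑ i ∈ s, f i y) x := by
  have h' := (s.eventually_all (l := 𝓝 x) (p := fun i y => ContDiffAt ℝ ∞ (f i) y)).2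
    fun i _ => h i
  filter_upwards [h'] with y hy using ContDiffAt.sum hy

theorem smoothNear_pi {ι : Type*} [Fintype ι] {f : E → ι → F} {x : E} :
    SmoothNear f x ↔ ∀ i, SmoothNear (fun y => f y i) x := by
  simp only [SmoothNear, contDiffAt_pi, eventually_all]

theorem SmoothNear.prodMk {f : E → F} {g : E → G} {x : E} (hf : SmoothNear f x)
    (hg : SmoothNear g x) : SmoothNear (fun y => (f y, g y)) x := by
  filter_upwards [hf, hg] with y h1 h2 using h1.prodMk h2

/-- A map which is smooth near a point agrees there with a globally smooth map. -/
theorem SmoothNear.exists_contDiff [FiniteDimensional ℝ E] {f : E → F} {x : E}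
    (h : SmoothNear f x) : ∃ g : E → F, ContDiff ℝ ∞ g ∧ g =ᶠ[𝓝 x] f := by
  obtain ⟨r, hr, hball⟩ := Metric.eventually_nhds_iff_ball.1 h
  let χ : ContDiffBump x := ⟨r / 4, r / 2, by positivity, by linarith⟩
  refine ⟨fun y => χ y • f y, ?_, ?_⟩
  · rw [contDiff_iff_contDiffAt]
    intro y
    by_cases hy : y ∈ Metric.ball x r
    · exact χ.contDiffAt.fun_smul (hball y hy)
    · have : (fun y => χ y • f y) =ᶠ[𝓝 y] fun _ => 0 := by
        have hmem : y ∈ (tsupport χ)ᶜ := by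
          rw [χ.tsupport_eq]
          intro h1
          refine hy (Metric.closedBall_subset_ball ?_ h1)
          change r / 2 < r
          linarith
        filter_upwards [(isClosed_tsupport χ).isOpen_compl.mem_nhds hmem] with z hz
        rw [image_eq_zero_of_notMem_tsupport hz, zero_smul]
      exact contDiffAt_const.congr_of_eventuallyEq this
  · filter_upwards [χ.eventuallyEq_one] with y hy
    rw [hy]
    simp

/-- The inverse function theorem. -/
theorem SmoothNear.exists_inverse [CompleteSpace E] {f : E → F} {x : E} (hf : SmoothNear f x)
    (hinv : (_root_.fderiv ℝ f x).IsInvertible) :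
    ∃ g : F → E, SmoothNear g (f x) ∧ g (f x) = x ∧ (∀ᶠ y in 𝓝 x, g (f y) = y) ∧
      ∀ᶠ z in 𝓝 (f x), f (g z) = z := by
  obtain ⟨e, he⟩ := hinv
  have hd : HasFDerivAt f (e : E →L[ℝ] F) x := he ▸ hf.differentiableAt.hasFDerivAt
  have hne : (∞ : ℕ∞ω) ≠ 0 := by simp
  let Φ := hf.contDiffAt.toOpenPartialHomeomorph f hd hne
  have hΦ : (Φ : E → F) = f := hf.contDiffAt.toOpenPartialHomeomorph_coe hd hne
  have hx : x ∈ Φ.source := hf.contDiffAt.mem_toOpenPartialHomeomorph_source hd hne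
  have hx' : f x ∈ Φ.target := hf.contDiffAt.image_mem_toOpenPartialHomeomorph_target hd hne
  have hgx : Φ.symm (f x) = x := by
    have := Φ.left_inv hx
    rwa [hΦ] at this
  refine ⟨Φ.symm, ?_, hgx, ?_, ?_⟩
  -- `ContDiffAt ℝ ∞` at a single point only gives `C^n` on neighbourhoods that may shrink with `n`.
  -- So the inverse function theorem is applied at every nearby point, where the derivative is still
  -- invertible.
  · have hc : ContinuousAt Φ.symm (f x) := Φ.symm.continuousAt hx'
    have h1 : ∀ᶠ y in 𝓝 x, (_root_.fderiv ℝ f y).IsInvertible := by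
      refine hf.fderiv.continuousAt.eventually (p := fun T => T.IsInvertible) ?_
      rw [← he]
      exact e.nhds
    have h2 : ∀ᶠ y in 𝓝 (Φ.symm (f x)),
        (_root_.fderiv ℝ f y).IsInvertible ∧ ContDiffAt ℝ ∞ f y := by
      rw [hgx]
      exact h1.and hf
    filter_upwards [hc.eventually h2, Φ.open_target.mem_nhds hx'] with z hz hzt
    obtain ⟨⟨e', he'⟩, hz2⟩ := hz
    refine Φ.contDiffAt_symm hzt (f₀' := e') ?_ (by rwa [hΦ])
    rw [hΦ, he']
    exact (hz2.differentiableAt (by simp)).hasFDerivAt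
  · filter_upwards [Φ.open_source.mem_nhds hx] with y hy
    have := Φ.left_inv hy
    rwa [hΦ] at this
  · filter_upwards [Φ.open_target.mem_nhds hx'] with y hy
    have := Φ.right_inv hy
    rwa [hΦ] at this

/-- The implicit function is smooth near the base point, not only at it. -/
theorem ContDiff.smoothNear_implicitFunction {E₁ E₂ F : Type*}
    [NormedAddCommGroup E₁] [NormedSpace ℝ E₁] [CompleteSpace E₁]
    [NormedAddCommGroup E₂] [NormedSpace ℝ E₂] [CompleteSpace E₂]
    [NormedAddCommGroup F] [NormedSpace ℝ F] [CompleteSpace F]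
    {f : E₁ × E₂ → F} (hf : ContDiff ℝ ∞ f) {u : E₁ × E₂} (hn : (∞ : ℕ∞ω) ≠ 0)
    (hinv : (_root_.fderiv ℝ f u ∘L .inr ℝ E₁ E₂).IsInvertible) :
    SmoothNear ((hf.contDiffAt (x := u)).implicitFunction hn hinv) u.1 := by
  set ψ := (hf.contDiffAt (x := u)).implicitFunction hn hinv with hψ
  have hs : ContDiffAt ℝ ∞ ψ u.1 := hf.contDiffAt.contDiffAt_implicitFunction hn hinv
  have h0 : ψ u.1 = u.2 := hf.contDiffAt.implicitFunction_apply_self hn hinv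
  have h1 : ∀ᶠ a in 𝓝 u.1, f (a, ψ a) = f u :=
    hf.contDiffAt.eventually_apply_implicitFunction hn hinv
  have hcont : ∀ᶠ a in 𝓝 u.1, ContinuousAt ψ a :=
    ((hs.of_le (m := 1) (by simp)).eventually (by simp)).mono fun a h => h.continuousAt
  have h2 : ∀ᶠ a in 𝓝 u.1, (_root_.fderiv ℝ f (a, ψ a) ∘L .inr ℝ E₁ E₂).IsInvertible := by
    have hc : ContinuousAt (fun a => _root_.fderiv ℝ f (a, ψ a) ∘L .inr ℝ E₁ E₂) u.1 := by
      refine ContinuousAt.clm_comp ?_ continuousAt_const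
      exact (hf.continuous_fderiv (by simp)).continuousAt.comp
        (continuousAt_id.prodMk hs.continuousAt)
    refine hc.eventually (p := fun T => T.IsInvertible) ?_
    beta_reduce
    rw [h0]
    obtain ⟨e, he⟩ := hinv
    have h := e.nhds
    rw [he] at h
    exact h
  filter_upwards [h1.eventually_nhds, hcont, h2] with a ha hca hia
  -- The implicit function based at `(a, ψ a)` is smooth at `a`; local uniqueness identifies it with
  -- `ψ` near `a`.
  have h3 := (hf.contDiffAt (x := (a, ψ a))).contDiffAt_implicitFunction hn hia
  have h4 := (hf.contDiffAt (x := (a, ψ a))).eventually_apply_eq_iff_implicitFunction hn hia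
  refine h3.congr_of_eventuallyEq ?_
  have ht : Tendsto (fun b => (b, ψ b)) (𝓝 a) (𝓝 (a, ψ a)) := continuousAt_id.prodMk hca
  filter_upwards [ht.eventually h4, ha] with b hb hb'
  exact (hb.1 (hb'.trans ha.self_of_nhds.symm)).symm

end SmoothNear

/-! ### The joint flow of commuting vector fields -/

section Flow

variable {ι : Type} [Fintype ι] {E : Type} [NormedAddCommGroup E] [NormedSpace ℝ E]

/-- The map whose zeros `((s, x), u)` are the solutions of `u' = ∑ sᵢ Yᵢ(u)`, `u(0) = x`. -/
noncomputable def flowDefect (Y : ι → C(E, E)) (a : ((ι → ℝ) × E) × C(unitInterval, E)) :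
    C(unitInterval, E) :=
  a.2 - ContinuousLinearMap.const ℝ unitInterval a.1.2 -
    volterra E (∑ i, a.1.1 i • (Y i).comp a.2)

theorem contDiff_flowDefect {Y : ι → C(E, E)} (hY : ∀ i, ContDiff ℝ ∞ (Y i)) :
    ContDiff ℝ ∞ (flowDefect Y) := by
  unfold flowDefect
  refine (contDiff_snd.sub ((ContinuousLinearMap.contDiff _).comp
    (contDiff_snd.comp contDiff_fst))).sub ((volterra E).contDiff.comp
      (ContDiff.sum fun i _ => ContDiff.fun_smul ?_ ?_))
  · exact (contDiff_apply ℝ ℝ i).comp (contDiff_fst.comp contDiff_fst)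
  · exact (ContinuousMap.contDiff_comp (hY i)).comp contDiff_snd

/-- At `s = 0` the integral term disappears and the defect is `u` minus a constant. The partial
derivative in `u` is therefore the identity, as the implicit function theorem requires. -/
theorem fderiv_flowDefect_comp_inr {Y : ι → C(E, E)} (hY : ∀ i, ContDiff ℝ ∞ (Y i)) (x₀ : E) :
    fderiv ℝ (flowDefect Y) ((0, x₀), ContinuousMap.const _ x₀) ∘L
      .inr ℝ ((ι → ℝ) × E) C(unitInterval, E) = .id ℝ _ := by
  have h1 : HasFDerivAt (flowDefect Y) _ ((0, x₀), ContinuousMap.const _ x₀) :=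
    ((contDiff_flowDefect hY).differentiable (by simp) _).hasFDerivAt
  have h2 := h1.comp (ContinuousMap.const unitInterval x₀)
    (hasFDerivAt_prodMk_right ((0, x₀) : (ι → ℝ) × E) (ContinuousMap.const unitInterval x₀))
  refine h2.unique ?_
  have : flowDefect Y ∘ (fun v => (((0 : ι → ℝ), x₀), v)) =
      fun v => v - ContinuousMap.const unitInterval x₀ := by
    ext v t
    simp [flowDefect]
  rw [this]
  exact (hasFDerivAt_id _).sub_const _

/-- `t ↦ t • Y(u(t))` solves the variational equation along an integral curve `u` of
`∑ sⱼ Zⱼ` if `Y` commutes with the `Zⱼ`. -/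
theorem smul_comp_eq_volterra [CompleteSpace E] {Y : C(E, E)} {Z : ι → C(E, E)}
    {DY : C(E, E →L[ℝ] E)} {DZ : ι → C(E, E →L[ℝ] E)} (hY : ∀ x, HasFDerivAt Y (DY x) x)
    {s : ι → ℝ} {x : E} {u : C(unitInterval, E)} (hu : flowDefect Z ((s, x), u) = 0)
    (hc : ∀ t j, DY (u t) (Z j (u t)) = DZ j (u t) (Y (u t))) {v : C(unitInterval, E)}
    (hv : ∀ t : unitInterval, v t = (t : ℝ) • Y (u t)) :
    v = volterra E (Y.comp u +
      ∑ j, s j • ContinuousMap.applyCLM unitInterval E E ((DZ j).comp u) v) := by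
  refine eq_volterra_of_hasDerivAt (by rw [hv]; simp) fun t => ?_
  have hu' : u = ContinuousMap.const unitInterval x + volterra E (∑ j, s j • (Z j).comp u) := by
    have h := hu
    simp only [flowDefect] at h
    rw [sub_sub, sub_eq_zero] at h
    exact h
  have h1 : HasDerivWithinAt (Set.IccExtend zero_le_one u) (∑ j, s j • Z j (u t))
      (Set.Icc 0 1) t := by
    have h := (hasDerivWithinAt_volterra (∑ j, s j • (Z j).comp u) t).const_add x
    have e : (∑ j, s j • (Z j).comp u) t = ∑ j, s j • Z j (u t) := by
      simp [ContinuousMap.sum_apply]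
    rw [e] at h
    have e2 : ∀ y ∈ Set.Icc (0 : ℝ) 1, Set.IccExtend zero_le_one u y =
        x + Set.IccExtend zero_le_one (volterra E (∑ j, s j • (Z j).comp u)) y := by
      intro y hy
      rw [Set.IccExtend_of_mem _ _ hy, Set.IccExtend_of_mem _ _ hy]
      exact DFunLike.congr_fun hu' ⟨y, hy⟩
    exact h.congr e2 (e2 _ t.2)
  -- Along the curve, `Y ∘ u` has derivative `∑ s_j DY(Z_j)`, which commutation turns into `∑ s_j
  -- DZ_j(Y)`: thus `Y ∘ u` solves the linearised equation, and the factor `t` adds the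
  -- inhomogeneity `Y ∘ u`.
  have h2 : HasDerivWithinAt (fun y => Y (Set.IccExtend zero_le_one u y))
      (DY (u t) (∑ j, s j • Z j (u t))) (Set.Icc 0 1) t := by
    have h := hY (Set.IccExtend zero_le_one u t)
    rw [Set.IccExtend_val] at h
    exact HasFDerivAt.comp_hasDerivWithinAt_of_eq _ h h1 (by rw [Set.IccExtend_val])
  have h3 := (hasDerivWithinAt_id (t : ℝ) (Set.Icc 0 1)).smul h2
  have e3 : ∀ y ∈ Set.Icc (0 : ℝ) 1, Set.IccExtend zero_le_one v y =
      (id y : ℝ) • Y (Set.IccExtend zero_le_one u y) := by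
    intro y hy
    rw [Set.IccExtend_of_mem _ _ hy, Set.IccExtend_of_mem _ _ hy, hv]
    rfl
  refine (h3.congr e3 (e3 _ t.2)).congr_deriv ?_
  simp only [ContinuousMap.add_apply, ContinuousMap.comp_apply, ContinuousMap.sum_apply,
    ContinuousMap.smul_apply, ContinuousMap.applyCLM_apply, hv, map_sum, map_smul, hc,
    Set.IccExtend_val, id, one_smul, Finset.smul_sum]
  rw [add_comm]
  congr 1
  exact Finset.sum_congr rfl fun j _ => smul_comm _ _ _

/-- The value `φ(s, x)` is the endpoint at time `1` of the curve with `u' = ∑ s_i Y_i(u)`, `u(0) =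
x`. Varying `s_i` moves the curve at time `t` by `t • Y_i(u(t))` when the fields commute, so at time
`1` by `Y_i`. -/
theorem exists_joint_flow [DecidableEq ι] [CompleteSpace E] {Y : ι → E → E}
    (hY : ∀ i, ContDiff ℝ ∞ (Y i)) (x₀ : E)
    (hc : ∀ᶠ x in 𝓝 x₀, ∀ i j, fderiv ℝ (Y i) x (Y j x) = fderiv ℝ (Y j) x (Y i x)) :
    ∃ φ : (ι → ℝ) × E → E, SmoothNear φ (0, x₀) ∧ (∀ᶠ x in 𝓝 x₀, φ (0, x) = x) ∧
      ∀ᶠ a in 𝓝 ((0 : ι → ℝ), x₀), ∀ i, fderiv ℝ φ a (Pi.single i 1, 0) = Y i (φ a) := by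
  let Z : ι → C(E, E) := fun i => ⟨Y i, (hY i).continuous⟩
  have hZ : ∀ i, ContDiff ℝ ∞ (Z i) := hY
  let DZ : ι → C(E, E →L[ℝ] E) := fun i => ⟨fderiv ℝ (Y i), (hY i).continuous_fderiv (by simp)⟩
  have hDZ : ∀ i x, HasFDerivAt (Z i) (DZ i x) x := fun i x =>
    ((hY i).differentiable (by simp) x).hasFDerivAt
  have hG := contDiff_flowDefect hZ
  let a₀ : ((ι → ℝ) × E) × C(unitInterval, E) := ((0, x₀), ContinuousMap.const _ x₀)
  have hG0 : ∀ x : E, flowDefect Z ((0, x), ContinuousMap.const _ x) = 0 := by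
    intro x; ext t; simp [flowDefect]
  have hinv : (fderiv ℝ (flowDefect Z) a₀ ∘L
      .inr ℝ ((ι → ℝ) × E) C(unitInterval, E)).IsInvertible := by
    rw [fderiv_flowDefect_comp_inr hZ]
    exact ⟨.refl ℝ _, rfl⟩
  have hne : (∞ : ℕ∞ω) ≠ 0 := by simp
  have hGa : ContDiffAt ℝ ∞ (flowDefect Z) a₀ := hG.contDiffAt
  -- `ψ (s, x)` is the whole solution curve; `hψu` is its local uniqueness.
  set ψ := hGa.implicitFunction hne hinv with hψ
  have hψs : ContDiffAt ℝ ∞ ψ (0, x₀) := hGa.contDiffAt_implicitFunction hne hinv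
  have hψ0 : ψ (0, x₀) = ContinuousMap.const _ x₀ := hGa.implicitFunction_apply_self hne hinv
  have hψe : ∀ᶠ a in 𝓝 ((0 : ι → ℝ), x₀), flowDefect Z (a, ψ a) = 0 := by
    have := hGa.eventually_apply_implicitFunction hne hinv
    rwa [hG0] at this
  have hψu : ∀ᶠ v in 𝓝 a₀, flowDefect Z v = 0 → ψ v.1 = v.2 := by
    have := hGa.eventually_apply_eq_iff_implicitFunction hne hinv
    rw [hG0] at this
    exact this.mono fun v h => h.1
  let ev : C(unitInterval, E) →L[ℝ] E := ContinuousMap.evalCLM ℝ (1 : unitInterval)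
  have hψn : SmoothNear ψ (0, x₀) := hG.smoothNear_implicitFunction (u := a₀) hne hinv
  refine ⟨fun a => ev (ψ a), (ev.contDiff.smoothNear _).comp hψn, ?_, ?_⟩
  · have ht : Tendsto (fun x : E => (((0 : ι → ℝ), x), ContinuousLinearMap.const ℝ unitInterval x))
        (𝓝 x₀) (𝓝 a₀) := by
      apply Continuous.tendsto
      fun_prop
    filter_upwards [ht.eventually hψu] with x hx
    have := hx (hG0 x)
    change ev (ψ (0, x)) = x
    rw [this]
    rfl
  -- `L a` is the linearised integral operator along the curve `ψ a`. It vanishes at `s = 0`, hence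
  -- is a strict contraction nearby, which makes the solution of the variational equation unique.
  · let L : (ι → ℝ) × E → C(unitInterval, E) →L[ℝ] C(unitInterval, E) := fun a =>
      volterra E ∘L ∑ j, a.1 j • ContinuousMap.applyCLM unitInterval E E ((DZ j).comp (ψ a))
    have hψc : ContinuousAt ψ (0, x₀) := hψs.continuousAt
    have hL : ContinuousAt L (0, x₀) := by
      refine continuousAt_const.clm_comp (tendsto_finsetSum _ fun j _ => ?_)
      refine Tendsto.smul ?_ ?_
      · exact ((continuous_apply j).comp continuous_fst).continuousAt
      · exact (ContinuousLinearMap.continuous _).continuousAt.comp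
          (((DZ j).continuous_postcomp).continuousAt.comp hψc)
    have hL0 : L (0, x₀) = 0 := by
      ext v t
      simp [L]
    have hL1 : ∀ᶠ a in 𝓝 ((0 : ι → ℝ), x₀), ‖L a‖ < 1 := by
      have hnorm : Continuous fun T : C(unitInterval, E) →L[ℝ] C(unitInterval, E) => ‖T‖ :=
        continuous_norm (E := C(unitInterval, E) →L[ℝ] C(unitInterval, E))
      have h : Tendsto (fun a => ‖L a‖) (𝓝 (0, x₀)) (𝓝 ‖L (0, x₀)‖) :=
        (hnorm.tendsto _).comp hL
      refine h.eventually (gt_mem_nhds ?_)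
      rw [hL0]
      exact (norm_zero (E := C(unitInterval, E) →L[ℝ] C(unitInterval, E))).trans_lt one_pos
    obtain ⟨r, hr, hball⟩ := Metric.eventually_nhds_iff.1 hc
    have hrange : ∀ᶠ a in 𝓝 ((0 : ι → ℝ), x₀), dist (ψ a) (ContinuousMap.const _ x₀) < r := by
      have := hψc.tendsto
      rw [hψ0] at this
      exact this (Metric.ball_mem_nhds _ hr)
    have hψd : ∀ᶠ a in 𝓝 ((0 : ι → ℝ), x₀), DifferentiableAt ℝ ψ a :=
      hψn.mono fun a h => h.differentiableAt (by simp)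
    filter_upwards [hL1, hrange, hψd, hψe.eventually_nhds] with a h1 h2 h3 h4 i
    set w := fderiv ℝ ψ a (Pi.single i 1, 0) with hw
    have hfd : fderiv ℝ (fun a => ev (ψ a)) a (Pi.single i 1, 0) = w 1 := by
      have := ev.hasFDerivAt.comp a h3.hasFDerivAt
      have e := this.fderiv
      change fderiv ℝ (ev ∘ ψ) a _ = _
      rw [e]
      rfl
    rw [hfd]
    -- The variational equation, obtained by differentiating the integral equation for `ψ` in `s_i`.
    have hweq : w = volterra E ((Z i).comp (ψ a)) + L a w := by
      have hs : ∀ j, HasFDerivAt (fun b : (ι → ℝ) × E => b.1 j • (Z j).comp (ψ b)) _ a := fun j =>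
        (((ContinuousLinearMap.proj (R := ℝ) (φ := fun _ : ι => ℝ) j).comp
          (ContinuousLinearMap.fst ℝ (ι → ℝ) E)).hasFDerivAt (x := a)).smul
          ((ContinuousMap.hasFDerivAt_comp (hDZ j) (ψ a)).comp a h3.hasFDerivAt)
      have hR := ((ContinuousLinearMap.const ℝ unitInterval).hasFDerivAt.comp a
        (hasFDerivAt_snd (𝕜 := ℝ) (E := ι → ℝ) (F := E) (p := a))).add
          ((volterra E).hasFDerivAt.comp a (HasFDerivAt.fun_sum fun j (_ : j ∈ Finset.univ) => hs j))
      have hee : ψ =ᶠ[𝓝 a] fun b => ContinuousLinearMap.const ℝ unitInterval b.2 +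
          volterra E (∑ j, b.1 j • (Z j).comp (ψ b)) := h4.mono fun b hb => by
        have h := hb
        simp only [flowDefect] at h
        rwa [sub_sub, sub_eq_zero] at h
      have e := (hR.congr_of_eventuallyEq hee).fderiv
      have e2 := congrArg (fun T => T ((Pi.single i 1 : ι → ℝ), (0 : E))) e
      simp only [← hw] at e2
      refine e2.trans ?_
      simp only [add_apply, ContinuousLinearMap.comp_apply, sum_apply, smul_apply,
        ContinuousLinearMap.smulRight_apply, L, ← hw, Finset.sum_add_distrib, map_add]
      have e3 : (∑ j, (ContinuousLinearMap.proj (R := ℝ) (φ := fun _ : ι => ℝ) j)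
          ((ContinuousLinearMap.fst ℝ (ι → ℝ) E) (Pi.single i 1, 0)) •
            ((fun v => (Z j).comp v) ∘ ψ) a) = (Z i).comp (ψ a) := by
        rw [Finset.sum_eq_single i]
        · simp
        · intro j _ hj
          simp [hj]
        · simp
      rw [e3, add_comm (volterra E _) (volterra E ((Z i).comp (ψ a)))]
      simp
    -- The candidate for `w`. It solves the same equation because the curve stays in the ball where
    -- the fields commute, so `v - w` is a fixed point of the contraction `L a`.
    let v : C(unitInterval, E) := ⟨fun t => (t : ℝ) • Z i (ψ a t), by fun_prop⟩
    have hveq := smul_comp_eq_volterra (v := v) (DY := DZ i) (DZ := DZ) (hDZ i) (s := a.1) (x := a.2)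
      h4.self_of_nhds
      (fun t j => hball (by
        have h := (ContinuousMap.dist_apply_le_dist (f := ψ a) t).trans_lt h2
        simpa using h) i j) (fun t => rfl)
    have hδ : v - w = L a (v - w) := by
      rw [map_add] at hveq
      conv_lhs => rw [hveq, hweq]
      rw [map_sub]
      simp [L]
    have : ‖v - w‖ ≤ ‖L a‖ * ‖v - w‖ := by
      conv_lhs => rw [hδ]
      exact (L a).le_opNorm _
    have h0 : ‖v - w‖ = 0 := by nlinarith [norm_nonneg (v - w)]
    rw [← sub_eq_zero.1 (norm_eq_zero.1 h0)]
    simp [v, Z, ev]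

/-! ### Straightening commuting vector fields. -/

theorem LinearMap.exists_linearEquiv_prod {ι κ E : Type*} [Fintype ι] [Fintype κ] [AddCommGroup E]
    [Module ℝ E] [FiniteDimensional ℝ E]
    (hk : Module.finrank ℝ E = Fintype.card ι + Fintype.card κ) {v : ι → E}
    (hv : LinearIndependent ℝ v) :
    ∃ B : (κ → ℝ) →ₗ[ℝ] E, ∃ e : ((ι → ℝ) × (κ → ℝ)) ≃ₗ[ℝ] E,
      ∀ t x, e (t, x) = ∑ i, t i • v i + B x := by
  let S := Submodule.span ℝ (Set.range v)
  obtain ⟨C, hC⟩ := S.exists_isCompl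
  have hS : Module.finrank ℝ S = Fintype.card ι := finrank_span_eq_card hv
  have hCk : Module.finrank ℝ (κ → ℝ) = Module.finrank ℝ C := by
    have := Submodule.finrank_add_eq_of_isCompl hC
    rw [Module.finrank_fintype_fun_eq_card]
    omega
  let eC : (κ → ℝ) ≃ₗ[ℝ] C := LinearEquiv.ofFinrankEq _ _ hCk
  let b := Module.Basis.span hv
  let eS : (ι → ℝ) ≃ₗ[ℝ] S := b.equivFun.symm
  refine ⟨C.subtype ∘ₗ eC.toLinearMap,
    (eS.prodCongr eC).trans (Submodule.prodEquivOfIsCompl S C hC), fun t x => ?_⟩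
  have h1 : ((eS t : S) : E) = ∑ i, t i • v i := by
    simp [eS, b, Module.Basis.equivFun_symm_apply, Module.Basis.span_apply]
  simp [Submodule.coe_prodEquivOfIsCompl', h1]

/-- Commuting vector fields which are independent at a point are coordinate vector fields near
this point. -/
theorem exists_straightening {κ : Type} [Fintype κ] [DecidableEq ι] [FiniteDimensional ℝ E]
    (hk : Module.finrank ℝ E = Fintype.card ι + Fintype.card κ) {Y : ι → E → E} {x₀ : E}
    (hY : ∀ i, SmoothNear (Y i) x₀)
    (hc : ∀ᶠ x in 𝓝 x₀, ∀ i j, fderiv ℝ (Y i) x (Y j x) = fderiv ℝ (Y j) x (Y i x))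
    (hli : LinearIndependent ℝ fun i => Y i x₀) :
    ∃ u : E → (ι → ℝ) × (κ → ℝ), SmoothNear u x₀ ∧ u x₀ = 0 ∧
      Function.Injective (fderiv ℝ u x₀) ∧
      ∀ᶠ x in 𝓝 x₀, ∀ i, fderiv ℝ u x (Y i x) = (Pi.single i 1, 0) := by
  have : CompleteSpace E := FiniteDimensional.complete ℝ E
  -- The joint flow is built from globally smooth fields; only germs at `x₀` matter, so cut-off
  -- extensions serve.
  choose Z hZ hZY using fun i => (hY i).exists_contDiff
  have hZY' : ∀ᶠ x in 𝓝 x₀, ∀ i, Z i =ᶠ[𝓝 x] Y i :=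
    eventually_all.2 fun i => (hZY i).eventually_nhds
  have hcZ : ∀ᶠ x in 𝓝 x₀, ∀ i j, fderiv ℝ (Z i) x (Z j x) = fderiv ℝ (Z j) x (Z i x) := by
    filter_upwards [hc, hZY'] with x h1 h2 i j
    rw [(h2 i).fderiv_eq, (h2 j).fderiv_eq, (h2 i).eq_of_nhds, (h2 j).eq_of_nhds, h1]
  obtain ⟨φ, hφ, hφ0, hφd⟩ := exists_joint_flow hZ x₀ hcZ
  have hφ00 : φ (0, x₀) = x₀ := hφ0.self_of_nhds
  obtain ⟨B, e, he⟩ := LinearMap.exists_linearEquiv_prod (κ := κ) hk hli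
  let Bc : (κ → ℝ) →L[ℝ] E := LinearMap.toContinuousLinearMap B
  -- The flow is started on an affine complement to the span of the `Y i x₀`. Its derivative at `0`
  -- is the isomorphism `e`, and the required coordinates are the inverse of `Φ`.
  let Φ : (ι → ℝ) × (κ → ℝ) → E := fun p => φ (p.1, x₀ + Bc p.2)
  let A : (ι → ℝ) × (κ → ℝ) →L[ℝ] (ι → ℝ) × E :=
    (ContinuousLinearMap.fst ℝ _ _).prod (Bc ∘L ContinuousLinearMap.snd ℝ _ _)
  have hin : ∀ p, HasFDerivAt (fun p : (ι → ℝ) × (κ → ℝ) => (p.1, x₀ + Bc p.2)) A p := fun p =>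
    hasFDerivAt_fst.prodMk ((Bc.hasFDerivAt.comp p hasFDerivAt_snd).const_add x₀)
  have hinS : ContDiff ℝ ∞ fun p : (ι → ℝ) × (κ → ℝ) => (p.1, x₀ + Bc p.2) :=
    contDiff_fst.prodMk (contDiff_const.add (Bc.contDiff.comp contDiff_snd))
  have hin0 : (fun p : (ι → ℝ) × (κ → ℝ) => (p.1, x₀ + Bc p.2)) 0 = (0, x₀) := by simp
  have hΦ0 : Φ 0 = x₀ := by
    change φ ((fun p : (ι → ℝ) × (κ → ℝ) => (p.1, x₀ + Bc p.2)) 0) = x₀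
    rw [hin0, hφ00]
  beta_reduce at hin0
  have hΦs : SmoothNear Φ 0 := by
    refine SmoothNear.comp (g := φ) ?_ (hinS.smoothNear 0)
    rw [hin0]
    exact hφ
  have hΦd : ∀ᶠ p in 𝓝 (0 : (ι → ℝ) × (κ → ℝ)),
      ∀ i, fderiv ℝ Φ p (Pi.single i 1, 0) = Y i (Φ p) := by
    have ht : Tendsto (fun p : (ι → ℝ) × (κ → ℝ) => (p.1, x₀ + Bc p.2)) (𝓝 0) (𝓝 (0, x₀)) := by
      have := hinS.continuous.tendsto 0
      rwa [hin0] at this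
    have hΦt : Tendsto Φ (𝓝 0) (𝓝 x₀) := by
      have := hΦs.continuousAt.tendsto
      rwa [hΦ0] at this
    filter_upwards [ht.eventually hφd, ht.eventually hφ, hΦt.eventually hZY'] with p h1 h2 h3 i
    have h4 := (h2.differentiableAt (by simp)).hasFDerivAt.comp p (hin p)
    have h5 : fderiv ℝ Φ p = _ := h4.fderiv
    rw [h5]
    have h6 : A ((Pi.single i 1 : ι → ℝ), (0 : κ → ℝ)) = (Pi.single i 1, 0) := by simp [A]
    rw [ContinuousLinearMap.comp_apply, h6, h1 i]
    exact (h3 i).eq_of_nhds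
  have hfd : fderiv ℝ Φ 0 = (e.toContinuousLinearEquiv : (ι → ℝ) × (κ → ℝ) →L[ℝ] E) := by
    have h3 : HasFDerivAt φ (fderiv ℝ φ (0, x₀)) ((0 : (ι → ℝ) × (κ → ℝ)).1,
        x₀ + Bc (0 : (ι → ℝ) × (κ → ℝ)).2) := by
      rw [hin0]
      exact hφ.differentiableAt.hasFDerivAt
    have h5 : fderiv ℝ Φ 0 = _ := (h3.comp 0 (hin 0)).fderiv
    have h7 : ∀ v : E, fderiv ℝ φ (0, x₀) (0, v) = v := by
      intro v
      have h8 := hφ.differentiableAt.hasFDerivAt.comp x₀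
        (hasFDerivAt_prodMk_right (0 : ι → ℝ) x₀)
      have h9 : φ ∘ (fun x => ((0 : ι → ℝ), x)) =ᶠ[𝓝 x₀] id := hφ0
      exact DFunLike.congr_fun (h8.unique ((hasFDerivAt_id x₀).congr_of_eventuallyEq h9)) v
    have h10 : ∀ i, fderiv ℝ φ (0, x₀) (Pi.single i 1, 0) = Y i x₀ := by
      intro i
      rw [hφd.self_of_nhds i, hφ00]
      exact (hZY i).eq_of_nhds
    rw [h5]
    refine ContinuousLinearMap.ext fun p => ?_
    have h11 : A p = ∑ i, p.1 i • ((Pi.single i 1 : ι → ℝ), (0 : E)) + (0, Bc p.2) := by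
      refine Prod.ext ?_ ?_
      · simp only [A, ContinuousLinearMap.prod_apply, ContinuousLinearMap.coe_fst', Prod.fst_add,
          Prod.fst_sum, Prod.smul_fst, add_zero]
        exact pi_eq_sum_univ' p.1
      · simp [A, Prod.snd_sum]
    rw [ContinuousLinearMap.comp_apply, h11, map_add, map_sum, h7]
    simp only [map_smul, h10]
    exact (he p.1 p.2).symm
  obtain ⟨u, hu, hu0, hul, hur⟩ := hΦs.exists_inverse ⟨_, hfd.symm⟩
  rw [hΦ0] at hu hu0 hur
  refine ⟨u, hu, hu0, ?_, ?_⟩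
  · have h1 : HasFDerivAt Φ (fderiv ℝ Φ 0) (u x₀) := by
      rw [hu0]
      exact hΦs.differentiableAt.hasFDerivAt
    have h2 := (h1.comp x₀ hu.differentiableAt.hasFDerivAt).unique
      ((hasFDerivAt_id x₀).congr_of_eventuallyEq hur)
    exact Function.LeftInverse.injective (g := fderiv ℝ Φ 0) fun v => DFunLike.congr_fun h2 v
  · have hut : Tendsto u (𝓝 x₀) (𝓝 0) := by
      have := hu.continuousAt.tendsto
      rwa [hu0] at this
    filter_upwards [hu, hur, hut.eventually hΦs, hut.eventually hΦd,
      hut.eventually hul.eventually_nhds] with x h1 h2 h3 h4 h5 i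
    have h6 : HasFDerivAt u (fderiv ℝ u x) (Φ (u x)) := by
      rw [h2]
      exact (h1.differentiableAt (by simp)).hasFDerivAt
    have h7 := (h6.comp (u x) (h3.differentiableAt (by simp)).hasFDerivAt).unique
      ((hasFDerivAt_id (u x)).congr_of_eventuallyEq h5)
    have h8 := DFunLike.congr_fun h7 (Pi.single i 1, 0)
    rw [ContinuousLinearMap.comp_apply, h4 i, h2] at h8
    exact h8

end Flow

/-! ### Poisson structures on open subsets of vector spaces -/

section LocalPoisson

variable {E : Type} [NormedAddCommGroup E] [NormedSpace ℝ E]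

/-- The bracket of two functions with respect to a field of bilinear forms on covectors. -/
noncomputable def bracketOf (π : E → (E →L[ℝ] ℝ) →ₗ[ℝ] (E →L[ℝ] ℝ) →ₗ[ℝ] ℝ) (F H : E → ℝ) :
    E → ℝ := fun x => π x (fderiv ℝ F x) (fderiv ℝ H x)

/-- `π` is a smooth Poisson structure on the subset `W` of a vector space. -/
structure IsPoissonOn (π : E → (E →L[ℝ] ℝ) →ₗ[ℝ] (E →L[ℝ] ℝ) →ₗ[ℝ] ℝ) (W : Set E) : Prop where
  alternating : ∀ x ∈ W, ∀ α, π x α α = 0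
  smooth : ∀ x ∈ W, ∀ F H, SmoothNear F x → SmoothNear H x → SmoothNear (bracketOf π F H) x
  jacobi : ∀ x ∈ W, ∀ F H K, SmoothNear F x → SmoothNear H x → SmoothNear K x →
    bracketOf π F (bracketOf π H K) x + bracketOf π H (bracketOf π K F) x +
      bracketOf π K (bracketOf π F H) x = 0

variable {π : E → (E →L[ℝ] ℝ) →ₗ[ℝ] (E →L[ℝ] ℝ) →ₗ[ℝ] ℝ} {W : Set E}

theorem bracketOf_congr {F F' H H' : E → ℝ} {x : E} (hF : F =ᶠ[𝓝 x] F') (hH : H =ᶠ[𝓝 x] H') :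
    bracketOf π F H x = bracketOf π F' H' x := by
  rw [bracketOf, bracketOf, hF.fderiv_eq, hH.fderiv_eq]

theorem bracketOf_eventually_const_right {F H : E → ℝ} {x : E} {c : ℝ}
    (hH : ∀ᶠ y in 𝓝 x, H y = c) : bracketOf π F H x = 0 := by
  have : H =ᶠ[𝓝 x] fun _ => c := hH
  rw [bracketOf, this.fderiv_eq, fderiv_fun_const]
  simp

theorem IsPoissonOn.skew (hπ : IsPoissonOn π W) {x : E} (hx : x ∈ W) (α β : E →L[ℝ] ℝ) :
    π x α β = -π x β α := by
  have h := hπ.alternating x hx (α + β)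
  simp only [map_add, LinearMap.add_apply, hπ.alternating x hx α, hπ.alternating x hx β] at h
  linarith

theorem IsPoissonOn.bracketOf_skew (hπ : IsPoissonOn π W) {x : E} (hx : x ∈ W) (F H : E → ℝ) :
    bracketOf π F H x = -bracketOf π H F x := hπ.skew hx _ _

/-- If `{F, H}` is locally constant, then `{{K, H}, F} = {{K, F}, H}`. -/
theorem IsPoissonOn.bracketOf_bracketOf_comm (hπ : IsPoissonOn π W) (hW : IsOpen W) {x : E}
    (hx : x ∈ W) {F H K : E → ℝ} (hF : SmoothNear F x) (hH : SmoothNear H x) (hK : SmoothNear K x)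
    {c : ℝ} (hc : ∀ᶠ y in 𝓝 x, bracketOf π F H y = c) :
    bracketOf π (bracketOf π K H) F x = bracketOf π (bracketOf π K F) H x := by
  have hj := hπ.jacobi x hx K H F hK hH hF
  have h1 : bracketOf π K (bracketOf π H F) x = 0 := by
    refine bracketOf_eventually_const_right (c := -c) ?_
    filter_upwards [hc, hW.mem_nhds hx] with y hy hyW
    rw [hπ.bracketOf_skew hyW, hy]
  have h2 : bracketOf π H (bracketOf π F K) x = bracketOf π (bracketOf π K F) H x := by
    rw [hπ.bracketOf_skew hx]
    have h3 : bracketOf π F K =ᶠ[𝓝 x] fun y => -bracketOf π K F y := by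
      filter_upwards [hW.mem_nhds hx] with y hy using hπ.bracketOf_skew hy F K
    have h4 : fderiv ℝ (fun y => -bracketOf π K F y) x = -fderiv ℝ (bracketOf π K F) x :=
      fderiv_fun_neg
    rw [bracketOf_congr h3 EventuallyEq.rfl]
    change -(π x (fderiv ℝ (fun y => -bracketOf π K F y) x) (fderiv ℝ H x)) =
      π x (fderiv ℝ (bracketOf π K F) x) (fderiv ℝ H x)
    rw [h4]
    simp
  rw [h1, h2, hπ.bracketOf_skew hx F] at hj
  linarith

/-! ### Hamiltonian vector fields. -/

variable [FiniteDimensional ℝ E]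

/-- The Hamiltonian vector field of `H`, with the sign convention `dF(V_H) = {F, H}`. -/
noncomputable def hamField (π : E → (E →L[ℝ] ℝ) →ₗ[ℝ] (E →L[ℝ] ℝ) →ₗ[ℝ] ℝ) (H : E → ℝ) (x : E) :
    E :=
  ∑ i, π x (LinearMap.toContinuousLinearMap ((Module.finBasis ℝ E).coord i)) (fderiv ℝ H x) •
    Module.finBasis ℝ E i

theorem apply_hamField (H : E → ℝ) (x : E) (α : E →L[ℝ] ℝ) :
    α (hamField π H x) = π x α (fderiv ℝ H x) := by
  have h : α = ∑ i, α (Module.finBasis ℝ E i) •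
      LinearMap.toContinuousLinearMap ((Module.finBasis ℝ E).coord i) := by
    refine ContinuousLinearMap.ext fun v => ?_
    have h1 := congrArg α ((Module.finBasis ℝ E).sum_repr v)
    rw [map_sum] at h1
    rw [← h1]
    simp [mul_comm]
  conv_rhs => rw [h]
  simp [hamField, mul_comm]

theorem fderiv_hamField (F H : E → ℝ) (x : E) :
    fderiv ℝ F x (hamField π H x) = bracketOf π F H x := apply_hamField H x _

theorem IsPoissonOn.smoothNear_hamField (hπ : IsPoissonOn π W) {H : E → ℝ} {x : E} (hx : x ∈ W)
    (hH : SmoothNear H x) : SmoothNear (hamField π H) x := by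
  refine SmoothNear.sum fun i => ?_
  let l := LinearMap.toContinuousLinearMap ((Module.finBasis ℝ E).coord i)
  have h := hπ.smooth x hx l H (l.contDiff.smoothNear x) hH
  refine SmoothNear.smul (h.congr (Eventually.of_forall fun y => ?_))
    (contDiff_const.smoothNear x)
  rw [bracketOf, l.fderiv]

/-- Tested against a linear functional `l`, the derivative of `V_H` along `V_F` is `{{l, H}, F}`. By
the Jacobi identity this is symmetric in `F` and `H` when `{F, H}` is locally constant. -/
theorem IsPoissonOn.hamField_commute (hπ : IsPoissonOn π W) (hW : IsOpen W) {x : E} (hx : x ∈ W)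
    {F H : E → ℝ} (hF : SmoothNear F x) (hH : SmoothNear H x)
    {c : ℝ} (hc : ∀ᶠ y in 𝓝 x, bracketOf π F H y = c) :
    fderiv ℝ (hamField π H) x (hamField π F x) = fderiv ℝ (hamField π F) x (hamField π H x) := by
  have key : ∀ (l : E →L[ℝ] ℝ) (K L : E → ℝ), SmoothNear K x →
      l (fderiv ℝ (hamField π K) x (hamField π L x)) = bracketOf π (bracketOf π l K) L x := by
    intro l K L hK
    have h1 : bracketOf π l K = l ∘ hamField π K := by
      funext y
      rw [Function.comp_apply, apply_hamField, bracketOf, l.fderiv]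
    have h2 := (l.hasFDerivAt.comp x
      (hπ.smoothNear_hamField hx hK).differentiableAt.hasFDerivAt).fderiv
    rw [← fderiv_hamField, h1, h2]
    rfl
  refine (SeparatingDual.eq_iff_forall_dual_eq (R := ℝ)).2 fun l => ?_
  rw [key l H F hH, key l F H hF]
  exact hπ.bracketOf_bracketOf_comm hW hx hF hH (l.contDiff.smoothNear x) hc

/-- Functions with constant brackets and independent Hamiltonian vector fields have conjugate
functions, which can be completed to local coordinates by joint first integrals. -/
theorem IsPoissonOn.exists_conjugate (hπ : IsPoissonOn π W) (hW : IsOpen W) {x₀ : E} (hx : x₀ ∈ W)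
    {ι : Type} [Fintype ι] [DecidableEq ι] {f : ι → E → ℝ} (hf : ∀ i, SmoothNear (f i) x₀)
    (hc : ∀ i j, ∃ c, ∀ᶠ x in 𝓝 x₀, bracketOf π (f i) (f j) x = c)
    (hli : LinearIndependent ℝ fun i => hamField π (f i) x₀) :
    ∃ k, Module.finrank ℝ E = Fintype.card ι + k ∧
      ∃ (t : ι → E → ℝ) (z : Fin k → E → ℝ),
        (∀ i, SmoothNear (t i) x₀) ∧ (∀ a, SmoothNear (z a) x₀) ∧
        (∀ i, t i x₀ = 0) ∧ (∀ a, z a x₀ = 0) ∧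
        (∀ᶠ x in 𝓝 x₀, ∀ i j, bracketOf π (t i) (f j) x = (Pi.single j 1 : ι → ℝ) i) ∧
        (∀ᶠ x in 𝓝 x₀, ∀ a j, bracketOf π (z a) (f j) x = 0) ∧
        ∀ v, (∀ i, fderiv ℝ (t i) x₀ v = 0) → (∀ a, fderiv ℝ (z a) x₀ v = 0) → v = 0 := by
  obtain ⟨k, hk⟩ := Nat.exists_eq_add_of_le hli.fintype_card_le_finrank
  have hcomm : ∀ᶠ x in 𝓝 x₀, ∀ i j, fderiv ℝ (hamField π (f i)) x (hamField π (f j) x) =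
      fderiv ℝ (hamField π (f j)) x (hamField π (f i) x) := by
    refine eventually_all.2 fun i => eventually_all.2 fun j => ?_
    obtain ⟨c, hc⟩ := hc j i
    filter_upwards [hc.eventually_nhds, (hf i).eventually, (hf j).eventually, hW.mem_nhds hx]
      with x h1 h2 h3 h4
    exact hπ.hamField_commute hW h4 h3 h2 h1
  obtain ⟨u, hu, hu0, hinj, hud⟩ := exists_straightening (κ := Fin k) (by simpa using hk)
    (fun i => hπ.smoothNear_hamField hx (hf i)) hcomm hli
  let P1 : ι → (ι → ℝ) × (Fin k → ℝ) →L[ℝ] ℝ := fun i =>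
    ContinuousLinearMap.proj i ∘L ContinuousLinearMap.fst ℝ _ _
  let P2 : Fin k → (ι → ℝ) × (Fin k → ℝ) →L[ℝ] ℝ := fun a =>
    ContinuousLinearMap.proj a ∘L ContinuousLinearMap.snd ℝ _ _
  have hfd : ∀ (T : (ι → ℝ) × (Fin k → ℝ) →L[ℝ] ℝ) x, ContDiffAt ℝ ∞ u x → ∀ v,
      fderiv ℝ (fun y => T (u y)) x v = T (fderiv ℝ u x v) := by
    intro T x hx v
    have h : fderiv ℝ (fun y => T (u y)) x = _ :=
      (T.hasFDerivAt.comp x (hx.differentiableAt (by simp)).hasFDerivAt).fderiv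
    rw [h]
    rfl
  have hT : ∀ T : (ι → ℝ) × (Fin k → ℝ) →L[ℝ] ℝ, SmoothNear (fun y => T (u y)) x₀ := fun T =>
    (T.contDiff.smoothNear _).comp hu
  refine ⟨k, hk, fun i x => P1 i (u x), fun a x => P2 a (u x), fun i => hT _, fun a => hT _,
    fun i => by change P1 i (u x₀) = 0; rw [hu0, map_zero],
    fun a => by change P2 a (u x₀) = 0; rw [hu0, map_zero], ?_, ?_, fun v h1 h2 => ?_⟩
  · filter_upwards [hud, hu] with x h1 h2 i j
    rw [← fderiv_hamField, hfd _ _ h2, h1]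
    rfl
  · filter_upwards [hud, hu] with x h1 h2 i j
    rw [← fderiv_hamField, hfd _ _ h2, h1]
    rfl
  · refine hinj ?_
    rw [map_zero]
    refine Prod.ext (funext fun i => ?_) (funext fun a => ?_)
    · have := h1 i
      rwa [hfd _ _ hu.contDiffAt] at this
    · have := h2 a
      rwa [hfd _ _ hu.contDiffAt] at this

/-! ### Canonical coordinates by successive conjugate functions. -/

variable {ι : Type} [Fintype ι] [DecidableEq ι] {p : ι → E → ℝ}

/-- Applying `dp_{c a}` to a linear relation kills the fields of the momenta and isolates the
coefficient of the field of `θ_a`; what remains is a relation among the fields of the momenta. The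
map `c` records which momentum each `θ_a` is conjugate to, so that a partial family of angles is
allowed. -/
theorem IsPoissonOn.linearIndependent_hamField_sum (hπ : IsPoissonOn π W) {x : E} (hx : x ∈ W)
    (hpp : ∀ i j, bracketOf π (p i) (p j) x = 0)
    (hli : LinearIndependent ℝ fun i => hamField π (p i) x) {κ : Type} [Fintype κ]
    {c : κ → ι} (hcinj : Function.Injective c) {θ : κ → E → ℝ}
    (hθ : ∀ a j, bracketOf π (θ a) (p j) x = (Pi.single j 1 : ι → ℝ) (c a)) :
    LinearIndependent ℝ fun s : ι ⊕ κ => hamField π (Sum.elim p θ s) x := by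
  rw [Fintype.linearIndependent_iff]
  intro g hg
  rw [Fintype.sum_sum_type] at hg
  simp only [Sum.elim_inl, Sum.elim_inr] at hg
  have h1 : ∀ a, g (Sum.inr a) = 0 := by
    intro a
    have h := congrArg (fderiv ℝ (p (c a)) x) hg
    simp only [map_add, map_sum, map_smul, fderiv_hamField, hpp, smul_zero, Finset.sum_const_zero,
      zero_add, map_zero] at h
    rw [Finset.sum_eq_single a] at h
    · rw [hπ.bracketOf_skew hx, hθ] at h
      simpa using h
    · intro b _ hb
      rw [hπ.bracketOf_skew hx, hθ, Pi.single_eq_of_ne (fun h => hb (hcinj h))]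
      simp
    · simp
  simp only [h1, zero_smul, Finset.sum_const_zero, add_zero] at hg
  have h2 := Fintype.linearIndependent_iff.1 hli _ hg
  rintro (i | a)
  · exact h2 i
  · exact h1 a

/-- Induction on `s`. The momenta and the angles found so far have constant brackets `0`, `±1` and
independent Hamiltonian fields, so `exists_conjugate` applies to all of them together. -/
theorem IsPoissonOn.exists_angles (hπ : IsPoissonOn π W) (hW : IsOpen W) {x₀ : E} (hx : x₀ ∈ W)
    (hp : ∀ i, SmoothNear (p i) x₀)
    (hpp : ∀ᶠ x in 𝓝 x₀, ∀ i j, bracketOf π (p i) (p j) x = 0)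
    (hli : LinearIndependent ℝ fun i => hamField π (p i) x₀) (s : Finset ι) :
    ∃ θ : s → E → ℝ, (∀ i, SmoothNear (θ i) x₀) ∧ (∀ i, θ i x₀ = 0) ∧
      (∀ᶠ x in 𝓝 x₀, ∀ i j, bracketOf π (θ i) (p j) x = (Pi.single j 1 : ι → ℝ) i) ∧
      ∀ᶠ x in 𝓝 x₀, ∀ i j, bracketOf π (θ i) (θ j) x = 0 := by
  induction s using Finset.induction_on with
  | empty => exact ⟨fun _ _ => 0, by simp, by simp, by simp, by simp⟩
  | insert k s hk ih =>
    obtain ⟨θ, hθs, hθ0, hθp, hθθ⟩ := ih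
    have hli' := hπ.linearIndependent_hamField_sum hx hpp.self_of_nhds hli
      Subtype.val_injective hθp.self_of_nhds
    obtain ⟨_, _, t, _, hts, _, ht0, _, htf, _⟩ := hπ.exists_conjugate hW hx
      (f := Sum.elim p θ) (by rintro (i | i); exacts [hp i, hθs i])
      (by
        rintro (i | i) (j | j)
        · exact ⟨0, hpp.mono fun x h => h i j⟩
        · refine ⟨-(Pi.single i 1 : ι → ℝ) j, ?_⟩
          filter_upwards [hθp, hW.mem_nhds hx] with x h hxW
          rw [hπ.bracketOf_skew hxW]
          exact congrArg _ (h j i)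
        · exact ⟨_, hθp.mono fun x h => h i j⟩
        · exact ⟨0, hθθ.mono fun x h => h i j⟩) hli'
    -- The new angle is the function conjugate to `p_k` within the enlarged family; it therefore has
    -- vanishing bracket with the other momenta and with all earlier angles.
    let Θ : ↥(insert k s) → E → ℝ := fun i =>
      if h : (i : ι) ∈ s then θ ⟨i, h⟩ else t (Sum.inl k)
    have hΘ : ∀ i : ↥(insert k s), (∃ h : (i : ι) ∈ s, Θ i = θ ⟨i, h⟩) ∨
        ((i : ι) = k ∧ Θ i = t (Sum.inl k)) := by
      intro i
      by_cases h : (i : ι) ∈ s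
      · exact Or.inl ⟨h, by simp [Θ, h]⟩
      · exact Or.inr ⟨(Finset.mem_insert.1 i.2).resolve_right h, by simp [Θ, h]⟩
    refine ⟨Θ, fun i => ?_, fun i => ?_, ?_, ?_⟩
    · obtain ⟨h, e⟩ | ⟨h, e⟩ := hΘ i <;> rw [e]
      exacts [hθs _, hts _]
    · obtain ⟨h, e⟩ | ⟨h, e⟩ := hΘ i <;> rw [e]
      exacts [hθ0 _, ht0 _]
    · filter_upwards [hθp, htf] with x h1 h2 i j
      obtain ⟨h, e⟩ | ⟨h, e⟩ := hΘ i <;> rw [e]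
      · exact h1 _ _
      · rw [h]
        have h3 := h2 (Sum.inl k) (Sum.inl j)
        rw [Sum.elim_inl] at h3
        rw [h3]
        simp [Pi.single_apply]
    · have hs : ∀ {x : E}, x ∈ W → (∀ i j, bracketOf π (t i) (Sum.elim p θ j) x =
          (Pi.single j 1 : ι ⊕ s → ℝ) i) → ∀ j, bracketOf π (t (Sum.inl k)) (θ j) x = 0 := by
        intro x _ h2 j
        have h3 := h2 (Sum.inl k) (Sum.inr j)
        rw [Sum.elim_inr] at h3
        rw [h3]
        simp
      filter_upwards [hθθ, htf, hW.mem_nhds hx] with x h1 h2 h3 i j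
      obtain ⟨h, e⟩ | ⟨h, e⟩ := hΘ i <;> obtain ⟨h', e'⟩ | ⟨h', e'⟩ := hΘ j <;> rw [e, e']
      · exact h1 _ _
      · rw [hπ.bracketOf_skew h3, hs h3 h2, neg_zero]
      · exact hs h3 h2 _
      · exact hπ.alternating x h3 _

/-- The theorem of Carathéodory, Jacobi and Lie: functions in involution with independent
Hamiltonian vector fields are part of a system of local coordinates with canonical brackets. -/
theorem IsPoissonOn.exists_canonical_coordinates (hπ : IsPoissonOn π W) (hW : IsOpen W) {x₀ : E}
    (hx : x₀ ∈ W) (hp : ∀ i, SmoothNear (p i) x₀)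
    (hpp : ∀ᶠ x in 𝓝 x₀, ∀ i j, bracketOf π (p i) (p j) x = 0)
    (hli : LinearIndependent ℝ fun i => hamField π (p i) x₀) :
    ∃ k, Module.finrank ℝ E = 2 * Fintype.card ι + k ∧
      ∃ (θ : ι → E → ℝ) (z : Fin k → E → ℝ),
        (∀ i, SmoothNear (θ i) x₀) ∧ (∀ a, SmoothNear (z a) x₀) ∧
        (∀ i, θ i x₀ = 0) ∧ (∀ a, z a x₀ = 0) ∧
        (∀ᶠ x in 𝓝 x₀, ∀ i j, bracketOf π (θ i) (p j) x = (Pi.single j 1 : ι → ℝ) i) ∧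
        (∀ᶠ x in 𝓝 x₀, ∀ i j, bracketOf π (θ i) (θ j) x = 0) ∧
        (∀ᶠ x in 𝓝 x₀, ∀ a j, bracketOf π (z a) (p j) x = 0) ∧
        (∀ᶠ x in 𝓝 x₀, ∀ a j, bracketOf π (z a) (θ j) x = 0) ∧
        ∀ v, (∀ i, fderiv ℝ (θ i) x₀ v = 0) → (∀ i, fderiv ℝ (p i) x₀ v = 0) →
          (∀ a, fderiv ℝ (z a) x₀ v = 0) → v = 0 := by
  obtain ⟨θ', hθs', hθ0', hθp', hθθ'⟩ := hπ.exists_angles hW hx hp hpp hli Finset.univ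
  obtain ⟨θ, rfl⟩ : ∃ θ : ι → E → ℝ, θ' = fun i => θ i.1 :=
    ⟨fun i => θ' ⟨i, Finset.mem_univ i⟩, rfl⟩
  have hθs : ∀ i, SmoothNear (θ i) x₀ := fun i => hθs' ⟨i, Finset.mem_univ i⟩
  have hθ0 : ∀ i, θ i x₀ = 0 := fun i => hθ0' ⟨i, Finset.mem_univ i⟩
  have hθp : ∀ᶠ x in 𝓝 x₀, ∀ i j, bracketOf π (θ i) (p j) x = (Pi.single j 1 : ι → ℝ) i :=
    hθp'.mono fun x h i j => h ⟨i, Finset.mem_univ i⟩ j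
  have hθθ : ∀ᶠ x in 𝓝 x₀, ∀ i j, bracketOf π (θ i) (θ j) x = 0 :=
    hθθ'.mono fun x h i j => h ⟨i, Finset.mem_univ i⟩ ⟨j, Finset.mem_univ j⟩
  have hli' := hπ.linearIndependent_hamField_sum hx hpp.self_of_nhds hli (c := id)
    Function.injective_id hθp.self_of_nhds
  have hpθ : ∀ᶠ x in 𝓝 x₀, ∀ i j, bracketOf π (p i) (θ j) x = -(Pi.single i 1 : ι → ℝ) j := by
    filter_upwards [hθp, hW.mem_nhds hx] with x h hxW i j
    rw [hπ.bracketOf_skew hxW, h]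
  obtain ⟨k, hk, t, z, hts, hzs, ht0, hz0, htf, hzf, hnd⟩ := hπ.exists_conjugate hW hx
    (f := Sum.elim p θ) (by rintro (i | i); exacts [hp i, hθs i])
    (by
      rintro (i | i) (j | j)
      · exact ⟨0, hpp.mono fun x h => h i j⟩
      · exact ⟨_, hpθ.mono fun x h => h i j⟩
      · exact ⟨_, hθp.mono fun x h => h i j⟩
      · exact ⟨0, hθθ.mono fun x h => h i j⟩) hli'
  refine ⟨k, by rw [hk, Fintype.card_sum]; ring, θ, z, hθs, hzs, hθ0, hz0, hθp, hθθ,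
    hzf.mono fun x h a j => h a (Sum.inl j), hzf.mono fun x h a j => h a (Sum.inr j),
    fun v h1 h2 h3 => ?_⟩
  -- The functions `t`, `z` separate tangent vectors, and `t` is dual to the Hamiltonian fields of
  -- `p`, `θ`. So a vector killed by every `dz_a` lies in their span; the canonical brackets of `p`
  -- and `θ` then recover its coefficients from `dθ_i(v)` and `dp_i(v)`.
  have hv : v = ∑ s, fderiv ℝ (t s) x₀ v • hamField π (Sum.elim p θ s) x₀ := by
    rw [← sub_eq_zero]
    refine hnd _ (fun s => ?_) (fun a => ?_)
    · simp only [map_sub, map_sum, map_smul, fderiv_hamField, htf.self_of_nhds]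
      rw [Finset.sum_eq_single s]
      · simp
      · intro b _ hb
        simp [hb.symm]
      · simp
    · simp [h3, fderiv_hamField, hzf.self_of_nhds a, -Fintype.sum_sum_type]
  rw [Fintype.sum_sum_type] at hv
  simp only [Sum.elim_inl, Sum.elim_inr] at hv
  have h4 : ∀ i, fderiv ℝ (t (Sum.inl i)) x₀ v = 0 := by
    intro i
    have h := h1 i
    rw [hv] at h
    simpa [fderiv_hamField, hθp.self_of_nhds i, hθθ.self_of_nhds i, Pi.single_apply] using h
  have h5 : ∀ i, fderiv ℝ (t (Sum.inr i)) x₀ v = 0 := by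
    intro i
    have h := h2 i
    rw [hv] at h
    simpa [fderiv_hamField, hpp.self_of_nhds i, hpθ.self_of_nhds i, Pi.single_apply] using h
  rw [hv]
  simp [h4, h5]

end LocalPoisson

/-! ### Poisson structures in local coordinates -/

section Pullback

variable {d : ℕ} {M : Type*} [TopologicalSpace M] [ChartedSpace (EuclideanSpace ℝ (Fin d)) M]
  {V : Type} [NormedAddCommGroup V] [NormedSpace ℝ V]

theorem mvfderiv_congr {F F' : M → ℝ} {y : M} (h : F =ᶠ[𝓝 y] F') :
    mvfderiv (𝓡 d) F y = mvfderiv (𝓡 d) F' y := by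
  ext v
  exact DFunLike.congr_fun h.mfderiv_eq v

theorem CotangentBilin.bracket_congr (P : CotangentBilin d M) {F F' H H' : M → ℝ} {y : M}
    (hF : F =ᶠ[𝓝 y] F') (hH : H =ᶠ[𝓝 y] H') : P.bracket F H y = P.bracket F' H' y := by
  rw [bracket, bracket, mvfderiv_congr hF, mvfderiv_congr hH]

/-- A function that is smooth near a point of a manifold. -/
def MSmoothNear (d : ℕ) {M : Type*} [TopologicalSpace M]
    [ChartedSpace (EuclideanSpace ℝ (Fin d)) M] (F : M → ℝ) (y : M) : Prop :=
  ∀ᶠ z in 𝓝 y, ContMDiffAt (𝓡 d) 𝓘(ℝ) ∞ F z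

theorem PoissonStructure.bracket_mSmoothNear (P : PoissonStructure d M) {F H : M → ℝ} {y : M}
    (hF : MSmoothNear d F y) (hH : MSmoothNear d H y) :
    MSmoothNear d (P.bivector.bracket F H) y := by
  obtain ⟨W, hW, hWo, hy⟩ := eventually_nhds_iff.1 (hF.and hH)
  have h := P.smooth W F H hWo (fun z hz => (hW z hz).1.contMDiffWithinAt)
    fun z hz => (hW z hz).2.contMDiffWithinAt
  filter_upwards [hWo.mem_nhds hy] with z hz using h.contMDiffAt (hWo.mem_nhds hz)

theorem PoissonStructure.jacobi_of_mSmoothNear (P : PoissonStructure d M) {F H K : M → ℝ} {y : M}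
    (hF : MSmoothNear d F y) (hH : MSmoothNear d H y) (hK : MSmoothNear d K y) :
    P.bivector.bracket F (P.bivector.bracket H K) y +
      P.bivector.bracket H (P.bivector.bracket K F) y +
        P.bivector.bracket K (P.bivector.bracket F H) y = 0 := by
  obtain ⟨W, hW, hWo, hy⟩ := eventually_nhds_iff.1 (hF.and (hH.and hK))
  exact P.jacobi W F H K hWo (fun z hz => (hW z hz).1.contMDiffWithinAt)
    (fun z hz => (hW z hz).2.1.contMDiffWithinAt) (fun z hz => (hW z hz).2.2.contMDiffWithinAt) y hy

/-- The derivative of a map from a vector space to a manifold. -/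
noncomputable def paramDeriv (d : ℕ) {M : Type*} [TopologicalSpace M]
    [ChartedSpace (EuclideanSpace ℝ (Fin d)) M] (Ψ : V → M) (q : V) :
    V →L[ℝ] TangentSpace (𝓡 d) (Ψ q) :=
  mfderiv 𝓘(ℝ, V) (𝓡 d) Ψ q

/-- `Ψ : V → M` is a smooth local diffeomorphism on the open set `Q`, in infinitesimal form. -/
structure IsLocalParam (d : ℕ) {M : Type*} [TopologicalSpace M]
    [ChartedSpace (EuclideanSpace ℝ (Fin d)) M] (Ψ : V → M) (Q : Set V) : Prop where
  isOpen : IsOpen Q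
  smooth : ∀ q ∈ Q, ContMDiffAt 𝓘(ℝ, V) (𝓡 d) ∞ Ψ q
  invertible : ∀ q ∈ Q, (paramDeriv d Ψ q).IsInvertible

variable {Ψ : V → M} {Q : Set V}

theorem IsLocalParam.mdifferentiableAt (h : IsLocalParam d Ψ Q) {q : V} (hq : q ∈ Q) :
    MDifferentiableAt 𝓘(ℝ, V) (𝓡 d) Ψ q := (h.smooth q hq).mdifferentiableAt (by simp)

/-- The inverse function theorem for maps from a vector space to a manifold. -/
theorem IsLocalParam.exists_inverse [IsManifold (𝓡 d) ∞ M] [CompleteSpace V]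
    (h : IsLocalParam d Ψ Q) {q : V} (hq : q ∈ Q) :
    ∃ ρ : M → V, (∀ᶠ y in 𝓝 (Ψ q), ContMDiffAt (𝓡 d) 𝓘(ℝ, V) ∞ ρ y) ∧ ρ (Ψ q) = q ∧
      (∀ᶠ x in 𝓝 q, ρ (Ψ x) = x) ∧ ∀ᶠ y in 𝓝 (Ψ q), Ψ (ρ y) = y := by
  let φ := extChartAt (𝓡 d) (Ψ q)
  have hs : ∀ᶠ y in 𝓝 (Ψ q), y ∈ (chartAt (EuclideanSpace ℝ (Fin d)) (Ψ q)).source :=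
    (chartAt _ (Ψ q)).open_source.mem_nhds (mem_chart_source _ (Ψ q))
  have hφ : ∀ᶠ y in 𝓝 (Ψ q), ContMDiffAt (𝓡 d) 𝓘(ℝ, EuclideanSpace ℝ (Fin d)) ∞ φ y :=
    hs.mono fun y hy => contMDiffAt_extChartAt' hy
  have hc : ContinuousAt Ψ q := (h.smooth q hq).continuousAt
  have hf : SmoothNear (φ ∘ Ψ) q := by
    filter_upwards [h.isOpen.mem_nhds hq, hc.eventually hφ] with x hx1 hx2
    exact (hx2.comp x (h.smooth x hx1)).contDiffAt
  have hinv : (fderiv ℝ (φ ∘ Ψ) q).IsInvertible := by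
    have h1 := mfderiv_comp q (hφ.self_of_nhds.mdifferentiableAt (by simp)) (h.mdifferentiableAt hq)
    rw [mfderiv_eq_fderiv] at h1
    have h2 := (isInvertible_mfderiv_extChartAt (I := 𝓡 d) (mem_extChartAt_source (Ψ q))).comp
      (h.invertible q hq)
    rw [h1]
    exact h2
  obtain ⟨g, hg, hgx, hgl, hgr⟩ := hf.exists_inverse hinv
  have hφc : ContinuousAt φ (Ψ q) := continuousAt_extChartAt (Ψ q)
  have hρ0 : g (φ (Ψ q)) = q := hgx
  have hρc : ContinuousAt (fun y => g (φ y)) (Ψ q) :=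
    ContinuousAt.comp (g := g) (x := Ψ q) hg.continuousAt hφc
  refine ⟨fun y => g (φ y), ?_, hgx, hgl, ?_⟩
  · filter_upwards [hφ, hφc.eventually hg] with y h1 h2
    exact h2.contMDiffAt.comp y h1
  · have ht : Tendsto (fun y => Ψ (g (φ y))) (𝓝 (Ψ q)) (𝓝 (Ψ q)) := by
      have h1 : Tendsto (fun y => g (φ y)) (𝓝 (Ψ q)) (𝓝 q) := by
        have := hρc.tendsto
        rwa [hρ0] at this
      exact hc.tendsto.comp h1
    filter_upwards [hφc.eventually hgr, hs, ht.eventually hs] with y h1 h2 h3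
    rw [← extChartAt_source (𝓡 d)] at h2 h3
    exact (extChartAt (𝓡 d) (Ψ q)).injOn h3 h2 h1

/-- The bivector in the coordinates given by a local parametrization. -/
noncomputable def PoissonStructure.pullback (P : PoissonStructure d M) (Ψ : V → M) (q : V) :
    (V →L[ℝ] ℝ) →ₗ[ℝ] (V →L[ℝ] ℝ) →ₗ[ℝ] ℝ :=
  LinearMap.mk₂ ℝ (fun α β => P.bivector (Ψ q)
      (α ∘L (paramDeriv d Ψ q).inverse)
      (β ∘L (paramDeriv d Ψ q).inverse))
    (fun α α' β => by rw [ContinuousLinearMap.add_comp, map_add, LinearMap.add_apply])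
    (fun c α β => by rw [ContinuousLinearMap.smul_comp, map_smul, LinearMap.smul_apply])
    (fun α β β' => by rw [ContinuousLinearMap.add_comp, map_add])
    (fun c α β => by rw [ContinuousLinearMap.smul_comp, map_smul])

theorem PoissonStructure.pullback_apply (P : PoissonStructure d M) (Ψ : V → M) (q : V)
    (α β : V →L[ℝ] ℝ) : P.pullback Ψ q α β = P.bivector (Ψ q)
      (α ∘L (paramDeriv d Ψ q).inverse)
      (β ∘L (paramDeriv d Ψ q).inverse) := rfl

/-- The bivector at a point of the manifold is determined by its coordinate expression. -/
theorem IsLocalParam.pullback_comp (h : IsLocalParam d Ψ Q) (P : PoissonStructure d M) {q : V}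
    (hq : q ∈ Q) (α β : Cotangent d (Ψ q)) :
    P.pullback Ψ q (α ∘L paramDeriv d Ψ q)
      (β ∘L paramDeriv d Ψ q) = P.bivector (Ψ q) α β := by
  have key : ∀ γ : Cotangent d (Ψ q), (γ ∘L paramDeriv d Ψ q) ∘L
      (paramDeriv d Ψ q).inverse = γ := by
    intro γ
    rw [ContinuousLinearMap.comp_assoc, (h.invertible q hq).self_comp_inverse,
      ContinuousLinearMap.comp_id]
  rw [P.pullback_apply]
  exact congrArg₂ (fun a b => P.bivector (Ψ q) a b) (key α) (key β)

theorem IsLocalParam.pullback_mvfderiv (h : IsLocalParam d Ψ Q) (P : PoissonStructure d M) {q : V}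
    (hq : q ∈ Q) {F H : M → ℝ} (hF : MDifferentiableAt (𝓡 d) 𝓘(ℝ) F (Ψ q))
    (hH : MDifferentiableAt (𝓡 d) 𝓘(ℝ) H (Ψ q)) :
    bracketOf (P.pullback Ψ) (F ∘ Ψ) (H ∘ Ψ) q = P.bivector.bracket F H (Ψ q) := by
  have key : ∀ K : M → ℝ, MDifferentiableAt (𝓡 d) 𝓘(ℝ) K (Ψ q) →
      fderiv ℝ (K ∘ Ψ) q = (mvfderiv (𝓡 d) K (Ψ q) ∘L paramDeriv d Ψ q) := by
    intro K hK
    rw [← mfderiv_eq_fderiv]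
    exact mfderiv_comp q hK (h.mdifferentiableAt hq)
  rw [bracketOf, key F hF, key H hH]
  exact h.pullback_comp P hq _ _

/-- A Poisson structure is given by a Poisson structure in local coordinates. -/
theorem IsLocalParam.isPoissonOn_pullback [IsManifold (𝓡 d) ∞ M] [CompleteSpace V]
    (h : IsLocalParam d Ψ Q) (P : PoissonStructure d M) : IsPoissonOn (P.pullback Ψ) Q := by
  -- A local inverse `ρ` carries functions near `q` to functions on `M` and intertwines the
  -- brackets; smoothness and the Jacobi identity are then read off on `M`.
  have key : ∀ q ∈ Q, ∃ ρ : M → V, ρ (Ψ q) = q ∧ (∀ᶠ x in 𝓝 q, ρ (Ψ x) = x) ∧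
      (∀ F, SmoothNear F q → MSmoothNear d (F ∘ ρ) (Ψ q)) ∧
      (∀ F H, SmoothNear F q → SmoothNear H q →
        (bracketOf (P.pullback Ψ) F H) ∘ ρ =ᶠ[𝓝 (Ψ q)] P.bivector.bracket (F ∘ ρ) (H ∘ ρ)) := by
    intro q hq
    obtain ⟨ρ, hρ, hρq, hρl, hρr⟩ := h.exists_inverse hq
    have hρt : Tendsto ρ (𝓝 (Ψ q)) (𝓝 q) := by
      have := hρ.self_of_nhds.continuousAt.tendsto
      rwa [hρq] at this
    have hS : ∀ F, SmoothNear F q → MSmoothNear d (F ∘ ρ) (Ψ q) := by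
      intro F hF
      filter_upwards [hρ, hρt.eventually hF] with y h1 h2
      exact h2.contMDiffAt.comp y h1
    refine ⟨ρ, hρq, hρl, hS, fun F H hF hH => ?_⟩
    filter_upwards [hS F hF, hS H hH, hρr, hρt.eventually hρl.eventually_nhds,
      hρt.eventually (h.isOpen.mem_nhds hq)] with y h1 h2 h3 h4 h5
    have h6 := h.pullback_mvfderiv P h5 (F := F ∘ ρ) (H := H ∘ ρ)
      (by rw [h3]; exact h1.mdifferentiableAt (by simp))
      (by rw [h3]; exact h2.mdifferentiableAt (by simp))
    rw [h3] at h6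
    rw [← h6, Function.comp_apply]
    exact bracketOf_congr (h4.mono fun x hx => congrArg F hx.symm)
      (h4.mono fun x hx => congrArg H hx.symm)
  have hsm : ∀ q ∈ Q, ∀ F H, SmoothNear F q → SmoothNear H q →
      SmoothNear (bracketOf (P.pullback Ψ) F H) q := by
    intro q hq F H hF hH
    obtain ⟨ρ, hρq, hρl, hS, hB⟩ := key q hq
    have hc := (h.smooth q hq).continuousAt
    filter_upwards [hc.eventually (P.bracket_mSmoothNear (hS F hF) (hS H hH)),
      hc.eventually (hB F H hF hH).eventually_nhds, hρl.eventually_nhds, h.isOpen.mem_nhds hq]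
      with x h1 h2 h3 h4
    have h5 : ContMDiffAt 𝓘(ℝ, V) 𝓘(ℝ) ∞ (P.bivector.bracket (F ∘ ρ) (H ∘ ρ) ∘ Ψ) x :=
      h1.comp x (h.smooth x h4)
    refine h5.contDiffAt.congr_of_eventuallyEq ?_
    filter_upwards [h3, (h.smooth x h4).continuousAt.eventually h2] with x' h6 h7
    rw [Function.comp_apply, ← h7, Function.comp_apply, h6]
  refine ⟨fun q hq α => P.alternating _ _, hsm, fun q hq F H K hF hH hK => ?_⟩
  · obtain ⟨ρ, hρq, hρl, hS, hB⟩ := key q hq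
    have hBS : ∀ F H, SmoothNear F q → SmoothNear H q →
        SmoothNear (bracketOf (P.pullback Ψ) F H) q := hsm q hq
    have e : ∀ F H K, SmoothNear F q → SmoothNear H q → SmoothNear K q →
        bracketOf (P.pullback Ψ) F (bracketOf (P.pullback Ψ) H K) q =
          P.bivector.bracket (F ∘ ρ) (P.bivector.bracket (H ∘ ρ) (K ∘ ρ)) (Ψ q) := by
      intro F H K hF hH hK
      have h1 := (hB F _ hF (hBS H K hH hK)).eq_of_nhds
      rw [Function.comp_apply, hρq] at h1
      rw [h1]
      exact P.bivector.bracket_congr EventuallyEq.rfl (hB H K hH hK)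
    rw [e F H K hF hH hK, e H K F hH hK hF, e K F H hK hF hH]
    exact P.jacobi_of_mSmoothNear (hS F hF) (hS H hH) (hS K hK)

end Pullback

/-! ### The exponential map of the generalized torus -/

namespace GenTorus

variable {ℓ₁ ℓ₂ : ℕ}

theorem exp_add (s t : Idx ℓ₁ ℓ₂ → ℝ) : (exp (s + t) : GenTorus ℓ₁ ℓ₂) = exp s * exp t := by
  refine Prod.ext (funext fun i => ?_) rfl
  exact Circle.exp_add _ _

@[simp]
theorem exp_zero : (exp (0 : Idx ℓ₁ ℓ₂ → ℝ) : GenTorus ℓ₁ ℓ₂) = 1 := by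
  refine Prod.ext (funext fun i => ?_) rfl
  exact Circle.exp_zero

/-- The principal branch of the logarithm. -/
noncomputable def log (g : GenTorus ℓ₁ ℓ₂) : Idx ℓ₁ ℓ₂ → ℝ :=
  Sum.elim (fun i => Complex.arg (g.1 i)) (fun j => Multiplicative.toAdd g.2 j)

@[simp]
theorem exp_log (g : GenTorus ℓ₁ ℓ₂) : exp (log g) = g :=
  Prod.ext (funext fun i => Circle.exp_arg (g.1 i)) rfl

theorem log_one : log (1 : GenTorus ℓ₁ ℓ₂) = 0 := by
  funext i
  rcases i with i | j
  · change Complex.arg ((1 : Circle) : ℂ) = 0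
    simp
  · rfl

/-- The branch cut of the argument lies on the negative real axis, away from the identity. -/
theorem continuousAt_log_one : ContinuousAt (log : GenTorus ℓ₁ ℓ₂ → _) 1 := by
  refine continuousAt_pi.2 fun i => ?_
  rcases i with i | j
  · have h : ContinuousAt Complex.arg (((1 : GenTorus ℓ₁ ℓ₂).1 i : Circle) : ℂ) :=
      Complex.continuousAt_arg (by simp)
    exact h.comp (f := fun g : GenTorus ℓ₁ ℓ₂ => ((g.1 i : Circle) : ℂ))
      (Continuous.continuousAt (by fun_prop))
  · have h : Continuous fun g : GenTorus ℓ₁ ℓ₂ => Multiplicative.toAdd g.2 j :=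
      (continuous_apply j).comp (continuous_toAdd.comp continuous_snd)
    exact h.continuousAt

/-- If `c i ≠ 0`, the parameter `s = 1 / c i` makes the `i`-th coordinate `1`; this is nonzero in
`ℝ`, and as an angle it lies strictly between `0` and `π`. -/
theorem eq_zero_of_exp_smul_eq_one {c : Idx ℓ₁ ℓ₂ → ℝ}
    (h : ∀ s : ℝ, (exp (s • c) : GenTorus ℓ₁ ℓ₂) = 1) : c = 0 := by
  funext i
  by_contra hi
  rw [Pi.zero_apply] at hi
  have h1 := h (c i)⁻¹
  rcases i with i | j
  · have h2 := congrFun (congrArg Prod.fst h1) i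
    change Circle.exp ((c (Sum.inl i))⁻¹ * c (Sum.inl i)) = 1 at h2
    rw [inv_mul_cancel₀ hi] at h2
    have h3 := Circle.arg_exp (x := 1) (by linarith [Real.pi_pos]) (by linarith [Real.pi_gt_three])
    rw [h2] at h3
    simp at h3
  · have h2 := congrFun (congrArg (fun g => Multiplicative.toAdd (Prod.snd g)) h1) j
    change (c (Sum.inr j))⁻¹ * c (Sum.inr j) = 0 at h2
    rw [inv_mul_cancel₀ hi] at h2
    exact one_ne_zero h2

end GenTorus

/-! ### Curves with vanishing derivative -/

/-- In charts the curve is locally constant, and the line is connected. -/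
theorem eq_of_mfderiv_eq_zero {d : ℕ} {M : Type*} [TopologicalSpace M]
    [ChartedSpace (EuclideanSpace ℝ (Fin d)) M] [IsManifold (𝓡 d) ∞ M] {γ : ℝ → M}
    (hγ : ∀ s, MDifferentiableAt 𝓘(ℝ) (𝓡 d) γ s) (h : ∀ s, mfderiv 𝓘(ℝ) (𝓡 d) γ s = 0) (s t : ℝ) :
    γ s = γ t := by
  have : IsLocallyConstant γ := by
    rw [IsLocallyConstant.iff_eventually_eq]
    intro s
    let φ := extChartAt (𝓡 d) (γ s)
    have hsrc : ∀ᶠ t in 𝓝 s, γ t ∈ (chartAt (EuclideanSpace ℝ (Fin d)) (γ s)).source :=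
      (hγ s).continuousAt.eventually
        ((chartAt _ (γ s)).open_source.mem_nhds (mem_chart_source _ (γ s)))
    obtain ⟨r, hr, hball⟩ := Metric.eventually_nhds_iff_ball.1 hsrc
    have hd : ∀ t ∈ Metric.ball s r, HasFDerivAt (φ ∘ γ) (0 : ℝ →L[ℝ] _) t := by
      intro t ht
      have h1 := (mdifferentiableAt_extChartAt (I := 𝓡 d) (hball t ht)).hasMFDerivAt.comp t
        (hγ t).hasMFDerivAt
      rw [h t] at h1
      have h2 := hasMFDerivAt_iff_hasFDerivAt.1 h1
      refine h2.congr_fderiv ?_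
      exact ContinuousLinearMap.comp_zero _
    filter_upwards [Metric.ball_mem_nhds s hr] with t ht
    have hc := (convex_ball s r).is_const_of_fderivWithin_eq_zero (𝕜 := ℝ) (f := φ ∘ γ)
      (fun x hx => (hd x hx).differentiableAt.differentiableWithinAt)
      (fun x hx => by
        rw [fderivWithin_of_isOpen Metric.isOpen_ball hx, (hd x hx).fderiv])
      ht (Metric.mem_ball_self hr)
    have h1 := hball t ht
    have h2 := hball s (Metric.mem_ball_self hr)
    rw [← extChartAt_source (𝓡 d)] at h1 h2
    exact (extChartAt (𝓡 d) (γ s)).injOn h1 h2 hc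
  exact this.apply_eq_of_preconnectedSpace s t

/-! ### Orbits -/

section Orbit

variable {ℓ₁ ℓ₂ d : ℕ} {M : Type*} [TopologicalSpace M] [ChartedSpace (EuclideanSpace ℝ (Fin d)) M]
  [MulAction (GenTorus ℓ₁ ℓ₂) M]
  {V : Type} [NormedAddCommGroup V] [NormedSpace ℝ V]
  {Ψ : V → M} {Q : Set V} {P : PoissonStructure d M} {p : GenTorus.Idx ℓ₁ ℓ₂ → M → ℝ}

/-- In coordinates, the Hamiltonian vector fields of the momenta are the fundamental fields. -/
theorem IsLocalParam.paramDeriv_hamField [FiniteDimensional ℝ V] (h : IsLocalParam d Ψ Q) (hp : IsMomentumMap P p) {q : V}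
    (hq : q ∈ Q) (i : GenTorus.Idx ℓ₁ ℓ₂) :
    paramDeriv d Ψ q (hamField (P.pullback Ψ) (p i ∘ Ψ) q) = fundamentalField d i (Ψ q) := by
  refine (SeparatingDual.eq_iff_forall_dual_eq (R := ℝ) (V := EuclideanSpace ℝ (Fin d))).2
    fun α => ?_
  have h1 := apply_hamField (π := P.pullback Ψ) (p i ∘ Ψ) q
    (show V →L[ℝ] ℝ from (show Cotangent d (Ψ q) from α) ∘L paramDeriv d Ψ q)
  have hpd : MDifferentiableAt (𝓡 d) 𝓘(ℝ) (p i) (Ψ q) := (hp.smooth i).mdifferentiableAt (by simp)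
  have h2 : fderiv ℝ (p i ∘ Ψ) q = mvfderiv (𝓡 d) (p i) (Ψ q) ∘L paramDeriv d Ψ q := by
    rw [← mfderiv_eq_fderiv]
    exact mfderiv_comp q hpd (h.mdifferentiableAt hq)
  rw [h2] at h1
  refine Eq.trans h1 ?_
  exact (h.pullback_comp P hq _ _).trans (hp.hamiltonian i (Ψ q) α).symm

variable [ContMDiffSMul (GenTorus.model ℓ₁ ℓ₂) (𝓡 d) ∞ (GenTorus ℓ₁ ℓ₂) M]

theorem contMDiff_orbit (y : M) :
    ContMDiff 𝓘(ℝ, GenTorus.Idx ℓ₁ ℓ₂ → ℝ) (𝓡 d) ∞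
      fun t : GenTorus.Idx ℓ₁ ℓ₂ → ℝ => (GenTorus.exp t : GenTorus ℓ₁ ℓ₂) • y :=
  GenTorus.contMDiff_exp.smul contMDiff_const

theorem mdifferentiableAt_orbit (y : M) (t : GenTorus.Idx ℓ₁ ℓ₂ → ℝ) :
    MDifferentiableAt 𝓘(ℝ, GenTorus.Idx ℓ₁ ℓ₂ → ℝ) (𝓡 d)
      (fun t : GenTorus.Idx ℓ₁ ℓ₂ → ℝ => (GenTorus.exp t : GenTorus ℓ₁ ℓ₂) • y) t :=
  (contMDiff_orbit y).mdifferentiableAt (by simp)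

/-- The derivative of the orbit map is given by the fundamental vector fields. -/
theorem paramDeriv_orbit (y : M) (t v : GenTorus.Idx ℓ₁ ℓ₂ → ℝ) :
    paramDeriv d (fun t : GenTorus.Idx ℓ₁ ℓ₂ → ℝ => (GenTorus.exp t : GenTorus ℓ₁ ℓ₂) • y) t v =
      ∑ i, v i • fundamentalField d i ((GenTorus.exp t : GenTorus ℓ₁ ℓ₂) • y) := by
  have key : ∀ i, paramDeriv d
      (fun t : GenTorus.Idx ℓ₁ ℓ₂ → ℝ => (GenTorus.exp t : GenTorus ℓ₁ ℓ₂) • y) t (Pi.single i 1) =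
        fundamentalField d i ((GenTorus.exp t : GenTorus ℓ₁ ℓ₂) • y) := by
    intro i
    have h1 : HasFDerivAt (fun s : ℝ => (Pi.single i s : GenTorus.Idx ℓ₁ ℓ₂ → ℝ) + t)
        (ContinuousLinearMap.single ℝ (fun _ : GenTorus.Idx ℓ₁ ℓ₂ => ℝ) i) 0 :=
      (ContinuousLinearMap.single ℝ (fun _ : GenTorus.Idx ℓ₁ ℓ₂ => ℝ) i).hasFDerivAt.add_const t
    have h2 : MDifferentiableAt 𝓘(ℝ, GenTorus.Idx ℓ₁ ℓ₂ → ℝ) (𝓡 d)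
        (fun t : GenTorus.Idx ℓ₁ ℓ₂ → ℝ => (GenTorus.exp t : GenTorus ℓ₁ ℓ₂) • y)
        ((Pi.single i (0 : ℝ) : GenTorus.Idx ℓ₁ ℓ₂ → ℝ) + t) := mdifferentiableAt_orbit y _
    have h3 := (h2.hasMFDerivAt.comp (0 : ℝ) h1.hasMFDerivAt).mfderiv
    have e : (fun t : GenTorus.Idx ℓ₁ ℓ₂ → ℝ => (GenTorus.exp t : GenTorus ℓ₁ ℓ₂) • y) ∘
        (fun s : ℝ => (Pi.single i s : GenTorus.Idx ℓ₁ ℓ₂ → ℝ) + t) =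
        fun s : ℝ => (GenTorus.exp (Pi.single i s) : GenTorus ℓ₁ ℓ₂) •
          (GenTorus.exp t : GenTorus ℓ₁ ℓ₂) • y := by
      funext s
      rw [Function.comp_apply, GenTorus.exp_add, mul_smul]
    have e0 : (Pi.single i (0 : ℝ) : GenTorus.Idx ℓ₁ ℓ₂ → ℝ) + t = t := by simp
    rw [e] at h3
    have h4 := DFunLike.congr_fun h3 (1 : ℝ)
    refine Eq.trans ?_ h4.symm
    change mfderiv 𝓘(ℝ, GenTorus.Idx ℓ₁ ℓ₂ → ℝ) (𝓡 d)
      (fun t : GenTorus.Idx ℓ₁ ℓ₂ → ℝ => (GenTorus.exp t : GenTorus ℓ₁ ℓ₂) • y) t (Pi.single i 1) =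
      mfderiv 𝓘(ℝ, GenTorus.Idx ℓ₁ ℓ₂ → ℝ) (𝓡 d)
      (fun t : GenTorus.Idx ℓ₁ ℓ₂ → ℝ => (GenTorus.exp t : GenTorus ℓ₁ ℓ₂) • y)
      ((Pi.single i (0 : ℝ) : GenTorus.Idx ℓ₁ ℓ₂ → ℝ) + t) (Pi.single i 1)
    congr 1
    rw [e0]
  conv_lhs => rw [pi_eq_sum_univ' v]
  rw [map_sum]
  refine Finset.sum_congr rfl fun i _ => ?_
  rw [map_smul, key]

/-- The fundamental vector fields are independent at points with trivial isotropy group. -/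
theorem linearIndependent_fundamentalField [IsManifold (𝓡 d) ∞ M] {y₀ : M}
    (hy₀ : MulAction.stabilizer (GenTorus ℓ₁ ℓ₂) y₀ = ⊥) :
    LinearIndependent ℝ fun i : GenTorus.Idx ℓ₁ ℓ₂ => fundamentalField d i y₀ := by
  rw [Fintype.linearIndependent_iff]
  intro c hc
  let o : (GenTorus.Idx ℓ₁ ℓ₂ → ℝ) → M := fun t => (GenTorus.exp t : GenTorus ℓ₁ ℓ₂) • y₀
  -- A relation `∑ c_i T_i = 0` at `y₀` says that this one-parameter orbit has zero velocity at `s =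
  -- 0`, hence, by the group law, at all times. It is then constant, its group elements fix `y₀`,
  -- and triviality of the isotropy group forces `c = 0`.
  let γ : ℝ → M := fun s => (GenTorus.exp (s • c) : GenTorus ℓ₁ ℓ₂) • y₀
  let L : ℝ →L[ℝ] (GenTorus.Idx ℓ₁ ℓ₂ → ℝ) := (ContinuousLinearMap.id ℝ ℝ).smulRight c
  have hγo : ∀ s, HasMFDerivAt 𝓘(ℝ) (𝓡 d) γ s (paramDeriv d o (s • c) ∘L L) := by
    intro s
    have h1 : HasFDerivAt (fun s : ℝ => s • c) L s := (hasFDerivAt_id s).smul_const c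
    exact (mdifferentiableAt_orbit (d := d) y₀ (s • c)).hasMFDerivAt.comp s h1.hasMFDerivAt
  have hγ : ∀ s, MDifferentiableAt 𝓘(ℝ) (𝓡 d) γ s := fun s => (hγo s).mdifferentiableAt
  have h0 : mfderiv 𝓘(ℝ) (𝓡 d) γ 0 = 0 := by
    rw [(hγo 0).mfderiv]
    refine ContinuousLinearMap.ext_ring ?_
    have e : L 1 = c := by simp [L]
    have h1 := paramDeriv_orbit (d := d) y₀ ((0 : ℝ) • c) c
    have e1 : (GenTorus.exp ((0 : ℝ) • c) : GenTorus ℓ₁ ℓ₂) • y₀ = y₀ := by simp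
    rw [e1] at h1
    exact (congrArg (paramDeriv d o ((0 : ℝ) • c)) e).trans (h1.trans hc)
  have hs : ∀ s, mfderiv 𝓘(ℝ) (𝓡 d) γ s = 0 := by
    intro s
    have e : γ = (fun y => (GenTorus.exp (s • c) : GenTorus ℓ₁ ℓ₂) • y) ∘ γ ∘ fun r => r - s := by
      funext r
      simp only [γ, Function.comp_apply]
      rw [← mul_smul, ← GenTorus.exp_add, ← add_smul]
      congr 3
      ring
    have h1 : HasFDerivAt (fun r : ℝ => r - s) (ContinuousLinearMap.id ℝ ℝ) s :=
      (hasFDerivAt_id s).sub_const s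
    have h2 : HasMFDerivAt 𝓘(ℝ) (𝓡 d) γ ((fun r : ℝ => r - s) s) 0 := by
      beta_reduce
      have : s - s = 0 := sub_self s
      rw [this, ← h0]
      exact (hγ 0).hasMFDerivAt
    have h3 := HasMFDerivAt.comp (g := γ) (f := fun r : ℝ => r - s) s h2 h1.hasMFDerivAt
    have h4 : MDifferentiableAt (𝓡 d) (𝓡 d)
        (fun y : M => (GenTorus.exp (s • c) : GenTorus ℓ₁ ℓ₂) • y) ((γ ∘ fun r => r - s) s) :=
      ((ContMDiffSMul.contMDiff_const_smul (I := GenTorus.model ℓ₁ ℓ₂) (n := ∞)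
        (GenTorus.exp (s • c) : GenTorus ℓ₁ ℓ₂)) _).mdifferentiableAt (by simp)
    have h5 := (h4.hasMFDerivAt.comp s h3).mfderiv
    rw [← e] at h5
    rw [h5]
    refine ContinuousLinearMap.ext fun v => ?_
    exact (mfderiv (𝓡 d) (𝓡 d) (fun y : M => (GenTorus.exp (s • c) : GenTorus ℓ₁ ℓ₂) • y)
      ((γ ∘ fun r => r - s) s)).map_zero
  have hfix : ∀ s : ℝ, (GenTorus.exp (s • c) : GenTorus ℓ₁ ℓ₂) = 1 := by
    intro s
    have h1 : γ s = γ 0 := eq_of_mfderiv_eq_zero hγ hs s 0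
    have h2 : (GenTorus.exp (s • c) : GenTorus ℓ₁ ℓ₂) ∈ MulAction.stabilizer _ y₀ := by
      rw [MulAction.mem_stabilizer_iff]
      have h3 : γ 0 = y₀ := by simp [γ]
      rw [← h3, ← h1]
      simpa [γ] using h1
    rwa [hy₀, Subgroup.mem_bot] at h2
  exact congrFun (GenTorus.eq_zero_of_exp_smul_eq_one hfix)

/-- Invariant functions are annihilated by the fundamental vector fields. -/
theorem mvfderiv_fundamentalField_of_invariant {F : M → ℝ} {y : M}
    (hF : MDifferentiableAt (𝓡 d) 𝓘(ℝ) F y) (h : ∀ (g : GenTorus ℓ₁ ℓ₂) (y : M), F (g • y) = F y)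
    (i : GenTorus.Idx ℓ₁ ℓ₂) : mvfderiv (𝓡 d) F y (fundamentalField d i y) = 0 := by
  let o : (GenTorus.Idx ℓ₁ ℓ₂ → ℝ) → M := fun t => (GenTorus.exp t : GenTorus ℓ₁ ℓ₂) • y
  have e0 : (GenTorus.exp (0 : GenTorus.Idx ℓ₁ ℓ₂ → ℝ) : GenTorus ℓ₁ ℓ₂) • y = y := by simp
  have h1 := paramDeriv_orbit (d := d) y 0 (Pi.single i 1 : GenTorus.Idx ℓ₁ ℓ₂ → ℝ)
  rw [e0] at h1
  have h2 : fundamentalField d i y = mfderiv 𝓘(ℝ, GenTorus.Idx ℓ₁ ℓ₂ → ℝ) (𝓡 d) o 0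
      (Pi.single i 1 : GenTorus.Idx ℓ₁ ℓ₂ → ℝ) := by
    refine Eq.trans ?_ h1.symm
    simp [Pi.single_apply]
  have hF' : MDifferentiableAt (𝓡 d) 𝓘(ℝ) F (o 0) := by
    change MDifferentiableAt (𝓡 d) 𝓘(ℝ) F
      ((GenTorus.exp (0 : GenTorus.Idx ℓ₁ ℓ₂ → ℝ) : GenTorus ℓ₁ ℓ₂) • y)
    rwa [e0]
  have h3 := mvfderiv_comp_apply (0 : GenTorus.Idx ℓ₁ ℓ₂ → ℝ) hF' (mdifferentiableAt_orbit y 0)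
    (Pi.single i 1 : GenTorus.Idx ℓ₁ ℓ₂ → ℝ)
  have h4 : F ∘ o = fun _ => F y := funext fun t => h _ y
  rw [h4, mvfderiv_const] at h3
  have h5 : o 0 = y := e0
  rw [h2]
  rw [h5] at h3
  exact h3.symm

/-- The bracket is `dp_i(T_j)`, the derivative of an invariant function along an orbit. -/
theorem IsLocalParam.bracketOf_momenta (h : IsLocalParam d Ψ Q) (hp : IsMomentumMap P p) {q : V}
    (hq : q ∈ Q) (i j : GenTorus.Idx ℓ₁ ℓ₂) :
    bracketOf (P.pullback Ψ) (p i ∘ Ψ) (p j ∘ Ψ) q = 0 := by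
  have hpd : ∀ i, MDifferentiableAt (𝓡 d) 𝓘(ℝ) (p i) (Ψ q) := fun i =>
    (hp.smooth i).mdifferentiableAt (by simp)
  rw [h.pullback_mvfderiv P hq (hpd i) (hpd j)]
  exact (hp.hamiltonian j (Ψ q) _).symm.trans
    (mvfderiv_fundamentalField_of_invariant (hpd i) (hp.equivariant i) j)

theorem IsLocalParam.linearIndependent_hamField [IsManifold (𝓡 d) ∞ M]
    [FiniteDimensional ℝ V] (h : IsLocalParam d Ψ Q) (hp : IsMomentumMap P p) {q : V} (hq : q ∈ Q)
    (hstab : MulAction.stabilizer (GenTorus ℓ₁ ℓ₂) (Ψ q) = ⊥) :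
    LinearIndependent ℝ fun i => hamField (P.pullback Ψ) (p i ∘ Ψ) q := by
  refine LinearIndependent.of_comp (paramDeriv d Ψ q).toLinearMap ?_
  have h1 := linearIndependent_fundamentalField (d := d) hstab
  have h2 : (⇑(paramDeriv d Ψ q).toLinearMap ∘ fun i => hamField (P.pullback Ψ) (p i ∘ Ψ) q) =
      fun i => fundamentalField d i (Ψ q) := funext fun i => h.paramDeriv_hamField hp hq i
  rw [h2]
  exact h1

end Orbit

/-! ### Tubes around free orbits -/

section Tube

/-- The map `(t, x) ↦ exp t • σ(x)` defined by a slice `σ`. -/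
noncomputable def tubeMap (ℓ₁ ℓ₂ : ℕ) {M : Type*} [MulAction (GenTorus ℓ₁ ℓ₂) M] {κ : Type}
    (σ : (κ → ℝ) → M) (q : (GenTorus.Idx ℓ₁ ℓ₂ → ℝ) × (κ → ℝ)) : M :=
  (GenTorus.exp q.1 : GenTorus ℓ₁ ℓ₂) • σ q.2

theorem tubeMap_add {ℓ₁ ℓ₂ : ℕ} {M : Type*} [MulAction (GenTorus ℓ₁ ℓ₂) M] {κ : Type}
    {σ : (κ → ℝ) → M} (t : GenTorus.Idx ℓ₁ ℓ₂ → ℝ) (q : (GenTorus.Idx ℓ₁ ℓ₂ → ℝ) × (κ → ℝ)) :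
    tubeMap ℓ₁ ℓ₂ σ (t + q.1, q.2) = (GenTorus.exp t : GenTorus ℓ₁ ℓ₂) • tubeMap ℓ₁ ℓ₂ σ q := by
  simp [tubeMap, GenTorus.exp_add, mul_smul]

variable {ℓ₁ ℓ₂ d : ℕ} {M : Type*} [TopologicalSpace M] [ChartedSpace (EuclideanSpace ℝ (Fin d)) M]

variable [MulAction (GenTorus ℓ₁ ℓ₂) M] {κ : Type} [Fintype κ]
  {σ : (κ → ℝ) → M}

theorem mem_cube_iff {ε : ℝ} {x : κ → ℝ} : x ∈ Cube κ ε ↔ ∀ i, |x i| < ε := by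
  simp only [abs_lt]
  exact ⟨fun h i => h i trivial, fun h i _ => h i⟩

theorem exists_cube_subset {N : Set (κ → ℝ)} (hN : N ∈ 𝓝 0) :
    ∃ ε > 0, (Cube κ ε : Set (κ → ℝ)) ⊆ N := by
  obtain ⟨ε, hε, h⟩ := Metric.mem_nhds_iff.1 hN
  refine ⟨ε, hε, fun x hx => h ?_⟩
  rw [mem_ball_zero_iff, pi_norm_lt_iff hε]
  exact mem_cube_iff.1 hx

theorem zero_mem_cube {ε : ℝ} (hε : 0 < ε) : (0 : κ → ℝ) ∈ Cube κ ε :=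
  mem_cube_iff.2 fun i => by simpa using hε

/-- A neighbourhood of a free orbit of a proper action is determined by a slice. -/
theorem eventually_injective_tube [IsManifold (𝓡 d) ∞ M] [T2Space M]
    [ProperSMul (GenTorus ℓ₁ ℓ₂) M] {Q : Set ((GenTorus.Idx ℓ₁ ℓ₂ → ℝ) × (κ → ℝ))}
    (hQ : IsLocalParam d (tubeMap ℓ₁ ℓ₂ σ) Q) (h0 : 0 ∈ Q)
    (hσ : ContinuousAt σ 0)
    (hstab : MulAction.stabilizer (GenTorus ℓ₁ ℓ₂) (σ 0) = ⊥) :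
    ∃ N ∈ 𝓝 (0 : κ → ℝ), ∀ x ∈ N, ∀ x' ∈ N, ∀ g : GenTorus ℓ₁ ℓ₂, g • σ x = σ x' →
      g = 1 ∧ x = x' := by
  obtain ⟨ρ, -, -, hρ, -⟩ := hQ.exists_inverse h0
  obtain ⟨A, hA, B, hB, hAB⟩ := mem_nhds_prod_iff.1 hρ
  have hO : GenTorus.log ⁻¹' A ∈ 𝓝 (1 : GenTorus ℓ₁ ℓ₂) := by
    refine GenTorus.continuousAt_log_one ?_
    rw [GenTorus.log_one]
    exact hA
  obtain ⟨O, hOA, hOo, hO1⟩ := mem_nhds_iff.1 hO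
  -- Properness makes this image closed, and trivial isotropy keeps `(σ 0, σ 0)` out of it. Hence `g
  -- • σ x = σ x'` with `x`, `x'` small forces `g` into the neighbourhood `O` of `1`, where local
  -- injectivity of the tube map finishes the argument.
  have hcl : IsClosed ((fun gx : GenTorus ℓ₁ ℓ₂ × M => (gx.1 • gx.2, gx.2)) '' (Oᶜ ×ˢ Set.univ)) :=
    (ProperSMul.isProperMap_smul_pair (G := GenTorus ℓ₁ ℓ₂) (X := M)).isClosedMap _
      (hOo.isClosed_compl.prod isClosed_univ)
  have hnot : (σ 0, σ 0) ∉
      (fun gx : GenTorus ℓ₁ ℓ₂ × M => (gx.1 • gx.2, gx.2)) '' (Oᶜ ×ˢ Set.univ) := by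
    rintro ⟨⟨g, y⟩, ⟨hg, -⟩, he⟩
    obtain ⟨h1, rfl⟩ := Prod.mk.inj he
    have h2 : g ∈ MulAction.stabilizer (GenTorus ℓ₁ ℓ₂) (σ 0) := h1
    rw [hstab, Subgroup.mem_bot] at h2
    exact hg (h2 ▸ hO1)
  obtain ⟨C, hC, D, hD, hCD⟩ := mem_nhds_prod_iff.1 (hcl.isOpen_compl.mem_nhds hnot)
  refine ⟨B ∩ (σ ⁻¹' C ∩ σ ⁻¹' D), inter_mem hB (inter_mem (hσ hC) (hσ hD)), ?_⟩
  rintro x ⟨hxB, -, hxD⟩ x' ⟨hxB', hxC', -⟩ g hg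
  have hgO : g ∈ O := by
    by_contra hgO
    exact hCD (Set.mk_mem_prod hxC' hxD) ⟨(g, σ x), ⟨hgO, trivial⟩, by simp [hg]⟩
  have e1 : ρ (tubeMap ℓ₁ ℓ₂ σ (GenTorus.log g, x)) = (GenTorus.log g, x) :=
    hAB (Set.mk_mem_prod (hOA hgO) hxB)
  have e2 : ρ (tubeMap ℓ₁ ℓ₂ σ (0, x')) = (0, x') :=
    hAB (Set.mk_mem_prod (mem_of_mem_nhds hA) hxB')
  have e3 : tubeMap ℓ₁ ℓ₂ σ (GenTorus.log g, x) = tubeMap ℓ₁ ℓ₂ σ (0, x') := by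
    simp [tubeMap, hg]
  rw [e3, e2] at e1
  obtain ⟨e4, e5⟩ := Prod.mk.inj e1
  refine ⟨?_, e5.symm⟩
  rw [← GenTorus.exp_log g, ← e4, GenTorus.exp_zero]

variable [ContMDiffSMul (GenTorus.model ℓ₁ ℓ₂) (𝓡 d) ∞ (GenTorus ℓ₁ ℓ₂) M]

theorem contMDiffAt_tubeMap {q : (GenTorus.Idx ℓ₁ ℓ₂ → ℝ) × (κ → ℝ)}
    (hσ : ContMDiffAt 𝓘(ℝ, κ → ℝ) (𝓡 d) ∞ σ q.2) :
    ContMDiffAt 𝓘(ℝ, (GenTorus.Idx ℓ₁ ℓ₂ → ℝ) × (κ → ℝ)) (𝓡 d) ∞ (tubeMap ℓ₁ ℓ₂ σ) q := by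
  refine ContMDiffAt.smul (I := GenTorus.model ℓ₁ ℓ₂) ?_ ?_
  · exact (GenTorus.contMDiff_exp _).comp q contDiff_fst.contMDiff.contMDiffAt
  · exact ContMDiffAt.comp q hσ contDiff_snd.contMDiff.contMDiffAt

theorem isInvertible_mfderiv_smul (g : GenTorus ℓ₁ ℓ₂) (y : M) :
    (mfderiv (𝓡 d) (𝓡 d) (fun y : M => g • y) y).IsInvertible :=
  ⟨_, (Diffeomorph.smul (GenTorus.model ℓ₁ ℓ₂) (𝓡 d) ∞ g).mfderivToContinuousLinearEquiv_coe
    (by simp)⟩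

theorem isInvertible_paramDeriv_smul {V : Type} [NormedAddCommGroup V] [NormedSpace ℝ V]
    {Ψ : V → M} {q : V} (g : GenTorus ℓ₁ ℓ₂) (hΨ : MDifferentiableAt 𝓘(ℝ, V) (𝓡 d) Ψ q)
    (h : (paramDeriv d Ψ q).IsInvertible) : (paramDeriv d (fun x => g • Ψ x) q).IsInvertible := by
  have h4 : MDifferentiableAt (𝓡 d) (𝓡 d) (fun y : M => g • y) (Ψ q) :=
    ((ContMDiffSMul.contMDiff_const_smul (I := GenTorus.model ℓ₁ ℓ₂) (n := ∞) g)
      _).mdifferentiableAt (by simp)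
  have h5 : paramDeriv d (fun x => g • Ψ x) q =
      mfderiv (𝓡 d) (𝓡 d) (fun y : M => g • y) (Ψ q) ∘L paramDeriv d Ψ q := mfderiv_comp q h4 hΨ
  rw [h5]
  exact (isInvertible_mfderiv_smul g _).comp h

theorem paramDeriv_comp_add {V : Type} [NormedAddCommGroup V] [NormedSpace ℝ V]
    {Ψ : V → M} {q c : V} (hΨ : MDifferentiableAt 𝓘(ℝ, V) (𝓡 d) Ψ (q + c)) :
    paramDeriv d (fun x => Ψ (x + c)) q = paramDeriv d Ψ (q + c) := by
  have h1 : HasFDerivAt (fun q : V => q + c) (ContinuousLinearMap.id ℝ _) q :=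
    (hasFDerivAt_id _).add_const _
  exact (HasMFDerivAt.comp (g := Ψ) (f := fun q => q + c) q hΨ.hasMFDerivAt
    h1.hasMFDerivAt).mfderiv

/-- Translation by `t` in the parameters corresponds to the diffeomorphism `y ↦ exp t • y` of `M`,
so invertibility on the slice spreads along the orbits. -/
theorem isInvertible_paramDeriv_tubeMap {t : GenTorus.Idx ℓ₁ ℓ₂ → ℝ} {x : κ → ℝ}
    (hσ : ContMDiffAt 𝓘(ℝ, κ → ℝ) (𝓡 d) ∞ σ x)
    (h : (paramDeriv d (tubeMap ℓ₁ ℓ₂ σ) (0, x)).IsInvertible) :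
    (paramDeriv d (tubeMap ℓ₁ ℓ₂ σ) (t, x)).IsInvertible := by
  have e : tubeMap ℓ₁ ℓ₂ σ =
      fun q => (fun q => (GenTorus.exp t : GenTorus ℓ₁ ℓ₂) • tubeMap ℓ₁ ℓ₂ σ q) (q + (-t, 0)) := by
    funext q
    simp only
    rw [← tubeMap_add]
    congr 1
    ext <;> simp
  have e1 : ((t, x) : (GenTorus.Idx ℓ₁ ℓ₂ → ℝ) × (κ → ℝ)) + (-t, 0) = (0, x) := by simp
  have h1 : MDifferentiableAt 𝓘(ℝ, (GenTorus.Idx ℓ₁ ℓ₂ → ℝ) × (κ → ℝ)) (𝓡 d)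
      (tubeMap ℓ₁ ℓ₂ σ) (0, x) :=
    (contMDiffAt_tubeMap (q := (0, x)) hσ).mdifferentiableAt (by simp)
  have h2 := isInvertible_paramDeriv_smul (GenTorus.exp t : GenTorus ℓ₁ ℓ₂) h1 h
  have h3 : MDifferentiableAt 𝓘(ℝ, (GenTorus.Idx ℓ₁ ℓ₂ → ℝ) × (κ → ℝ)) (𝓡 d)
      (fun q => (GenTorus.exp t : GenTorus ℓ₁ ℓ₂) • tubeMap ℓ₁ ℓ₂ σ q) (0, x) :=
    MDifferentiableAt.comp (0, x) (g := fun y : M => (GenTorus.exp t : GenTorus ℓ₁ ℓ₂) • y)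
      (((ContMDiffSMul.contMDiff_const_smul (I := GenTorus.model ℓ₁ ℓ₂) (n := ∞)
        (GenTorus.exp t : GenTorus ℓ₁ ℓ₂)) _).mdifferentiableAt (by simp)) h1
  rw [← e1] at h2 h3
  rw [e]
  rw [← paramDeriv_comp_add h3] at h2
  exact h2

/-- A slice which is transversal to the orbits and meets every orbit at most once defines a
diffeomorphism onto a tube. -/
theorem exists_tubeDiffeo [IsManifold (𝓡 d) ∞ M] {ε : ℝ}
    (hσ : ∀ x ∈ Cube κ ε, ContMDiffAt 𝓘(ℝ, κ → ℝ) (𝓡 d) ∞ σ x)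
    (hQ : IsLocalParam d (tubeMap ℓ₁ ℓ₂ σ) (Set.univ ×ˢ (Cube κ ε : Set (κ → ℝ))))
    (hinj : ∀ x ∈ Cube κ ε, ∀ x' ∈ Cube κ ε, ∀ g : GenTorus ℓ₁ ℓ₂, g • σ x = σ x' →
      g = 1 ∧ x = x') :
    ∃ (U : TopologicalSpace.Opens M) (Φ : TubeDiffeo d ℓ₁ ℓ₂ U κ ε),
      (∀ y, y ∈ U ↔ ∃ (g : GenTorus ℓ₁ ℓ₂) (x : Cube κ ε), g • σ x = y) ∧
      ∀ q, ((Φ.symm q : U) : M) = q.1 • σ q.2 := by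
  have hmem : ∀ y, y ∈ tubeMap ℓ₁ ℓ₂ σ '' (Set.univ ×ˢ (Cube κ ε : Set (κ → ℝ))) ↔
      ∃ (g : GenTorus ℓ₁ ℓ₂) (x : Cube κ ε), g • σ x = y := by
    intro y
    constructor
    · rintro ⟨⟨t, x⟩, ⟨-, hx⟩, rfl⟩
      exact ⟨GenTorus.exp t, ⟨x, hx⟩, rfl⟩
    · rintro ⟨g, x, rfl⟩
      exact ⟨(GenTorus.log g, x), ⟨trivial, x.2⟩, by simp [tubeMap]⟩
  have hopen : IsOpen (tubeMap ℓ₁ ℓ₂ σ '' (Set.univ ×ˢ (Cube κ ε : Set (κ → ℝ)))) := by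
    rw [isOpen_iff_mem_nhds]
    rintro _ ⟨q, hq, rfl⟩
    obtain ⟨ρ, hρ, hρq, -, hρr⟩ := hQ.exists_inverse hq
    have ht : Tendsto ρ (𝓝 (tubeMap ℓ₁ ℓ₂ σ q)) (𝓝 q) := by
      have := hρ.self_of_nhds.continuousAt.tendsto
      rwa [hρq] at this
    filter_upwards [hρr, ht (hQ.isOpen.mem_nhds hq)] with y h1 h2
    exact ⟨ρ y, h2, h1⟩
  let U : TopologicalSpace.Opens M := ⟨_, hopen⟩
  let F : GenTorus ℓ₁ ℓ₂ × Cube κ ε → U := fun q => ⟨q.1 • σ q.2, (hmem _).2 ⟨q.1, q.2, rfl⟩⟩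
  have hF : Function.Bijective F := by
    constructor
    · rintro ⟨g, x⟩ ⟨g', x'⟩ h
      have h1 : g • σ x = g' • σ x' := congrArg Subtype.val h
      have h2 : (g'⁻¹ * g) • σ x = σ x' := by rw [mul_smul, h1, inv_smul_smul]
      obtain ⟨h3, h4⟩ := hinj x x.2 x' x'.2 _ h2
      rw [inv_mul_eq_one] at h3
      exact Prod.ext h3.symm (Subtype.ext h4)
    · rintro ⟨y, hy⟩
      obtain ⟨g, x, h⟩ := (hmem y).1 hy
      exact ⟨(g, x), Subtype.ext h⟩
  let e := Equiv.ofBijective F hF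
  have hFs : ContMDiff ((GenTorus.model ℓ₁ ℓ₂).prod 𝓘(ℝ, κ → ℝ)) (𝓡 d) ∞ F := by
    rw [← ContMDiff.subtypeVal_comp_iff]
    intro q
    have h1 : ContMDiff ((GenTorus.model ℓ₁ ℓ₂).prod 𝓘(ℝ, κ → ℝ)) 𝓘(ℝ, κ → ℝ) ∞
        fun q : GenTorus ℓ₁ ℓ₂ × Cube κ ε => (q.2 : κ → ℝ) := by
      have h2 : ContMDiff 𝓘(ℝ, κ → ℝ) 𝓘(ℝ, κ → ℝ) ∞ (Subtype.val : Cube κ ε → κ → ℝ) :=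
        contMDiff_subtype_val
      exact h2.comp (contMDiff_snd (I := GenTorus.model ℓ₁ ℓ₂) (M := GenTorus ℓ₁ ℓ₂))
    have h3 : ContMDiffAt ((GenTorus.model ℓ₁ ℓ₂).prod 𝓘(ℝ, κ → ℝ)) (GenTorus.model ℓ₁ ℓ₂) ∞
        (fun q : GenTorus ℓ₁ ℓ₂ × Cube κ ε => q.1) q := contMDiffAt_fst
    have h4 : ContMDiffAt ((GenTorus.model ℓ₁ ℓ₂).prod 𝓘(ℝ, κ → ℝ)) (𝓡 d) ∞
        (fun q : GenTorus ℓ₁ ℓ₂ × Cube κ ε => σ q.2) q :=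
      ContMDiffAt.comp (g := σ) q (hσ q.2 q.2.2) h1.contMDiffAt
    exact h3.smul h4
  have hGs : ContMDiff (𝓡 d) ((GenTorus.model ℓ₁ ℓ₂).prod 𝓘(ℝ, κ → ℝ)) ∞ e.symm := by
    intro y
    obtain ⟨q, hq, hqy⟩ := y.2
    obtain ⟨ρ, hρ, hρq, -, hρr⟩ := hQ.exists_inverse hq
    have ht : Tendsto ρ (𝓝 (tubeMap ℓ₁ ℓ₂ σ q)) (𝓝 q) := by
      have := hρ.self_of_nhds.continuousAt.tendsto
      rwa [hρq] at this
    rw [hqy] at hρ hρr ht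
    -- The inverse is locally `exp` applied to a local inverse `ρ` of the tube map; the angles
    -- chosen by `ρ` are immaterial after exponentiation.
    have hey : ∀ᶠ z : U in 𝓝 y, (e.symm z).1 = GenTorus.exp (ρ z).1 ∧
        ((e.symm z).2 : κ → ℝ) = (ρ z).2 := by
      filter_upwards [continuous_subtype_val.continuousAt.eventually hρr,
        continuous_subtype_val.continuousAt.eventually (ht (hQ.isOpen.mem_nhds hq))] with z h1 h2
      have h3 : e.symm z = (GenTorus.exp (ρ z).1, ⟨(ρ z).2, h2.2⟩) := by
        rw [Equiv.symm_apply_eq]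
        exact Subtype.ext h1.symm
      rw [h3]
      exact ⟨rfl, rfl⟩
    have hρy : ContMDiffAt (𝓡 d) 𝓘(ℝ, (GenTorus.Idx ℓ₁ ℓ₂ → ℝ) × (κ → ℝ)) ∞
        (fun z : U => ρ z) y :=
      ContMDiffAt.comp y hρ.self_of_nhds contMDiff_subtype_val.contMDiffAt
    refine ContMDiffAt.prodMk (f := fun z => (e.symm z).1) (g := fun z => (e.symm z).2) ?_ ?_
    · have h1 : ContMDiffAt (𝓡 d) (GenTorus.model ℓ₁ ℓ₂) ∞
          (fun z : U => (GenTorus.exp (ρ z).1 : GenTorus ℓ₁ ℓ₂)) y :=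
        (GenTorus.contMDiff_exp.comp contDiff_fst.contMDiff).contMDiffAt.comp y hρy
      exact h1.congr_of_eventuallyEq (hey.mono fun z h => h.1)
    · rw [← ContMDiffAt.subtypeVal_comp_iff]
      have h1 : ContMDiffAt (𝓡 d) 𝓘(ℝ, κ → ℝ) ∞ (fun z : U => (ρ z).2) y :=
        contDiff_snd.contMDiff.contMDiffAt.comp y hρy
      exact h1.congr_of_eventuallyEq (hey.mono fun z h => h.2)
  exact ⟨U, ⟨e.symm, hGs, hFs⟩, hmem, fun q => rfl⟩

end Tube

/-! ### Coordinates on a tube -/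

section TubeCoordinates

/-- The derivative of the inclusion of a product with an open subset of a vector space. -/
theorem hasMFDerivAt_prod_subtype_val {A F : Type*} [NormedAddCommGroup A] [NormedSpace ℝ A]
    [NormedAddCommGroup F] [NormedSpace ℝ F] (N : TopologicalSpace.Opens F) (q : A × N) :
    HasMFDerivAt (𝓘(ℝ, A).prod 𝓘(ℝ, F)) 𝓘(ℝ, A × F) (fun q : A × N => (q.1, (q.2 : F))) q
      (ContinuousLinearMap.id ℝ (A × F)) := by
  refine ⟨by fun_prop, ?_⟩
  have hN : id =ᶠ[𝓝 (q.2 : F)] fun x : F => ((chartAt F q.2).symm x : F) :=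
    N.chartAt_subtype_val_symm_eventuallyEq (H := F) (x := q.2)
  have h : (fun x : A × F => (x.1, ((chartAt F q.2).symm x.2 : F))) =ᶠ[𝓝 (q.1, (q.2 : F))] id := by
    filter_upwards [continuousAt_snd.eventually hN] with x hx
    exact Prod.ext rfl hx.symm
  have h1 := (hasFDerivAt_id (𝕜 := ℝ) (q.1, (q.2 : F))).congr_of_eventuallyEq h
  exact h1.hasFDerivWithinAt

variable {ℓ₁ ℓ₂ d : ℕ} {M : Type*} [TopologicalSpace M] [ChartedSpace (EuclideanSpace ℝ (Fin d)) M]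

/-- This turns the fields `dTheta` and `dX`, defined on the product with the open cube, into values
of `paramDeriv` on the ambient vector space. -/
theorem mfderiv_comp_prod_subtype_val {A F : Type} [NormedAddCommGroup A] [NormedSpace ℝ A]
    [NormedAddCommGroup F] [NormedSpace ℝ F] {N : TopologicalSpace.Opens F} {q : A × N}
    {Ψ : A × F → M} (h : MDifferentiableAt 𝓘(ℝ, A × F) (𝓡 d) Ψ (q.1, q.2)) :
    mfderiv (𝓘(ℝ, A).prod 𝓘(ℝ, F)) (𝓡 d) (fun q : A × N => Ψ (q.1, q.2)) q =
      paramDeriv d Ψ (q.1, q.2) :=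
  (HasMFDerivAt.comp (g := Ψ) (f := fun q : A × N => (q.1, (q.2 : F))) q h.hasMFDerivAt
    (hasMFDerivAt_prod_subtype_val N q)).mfderiv

end TubeCoordinates

/-! ### Bivectors with canonical brackets. -/

section CanonicalForm

variable {ι κ : Type}

/-- The coordinate functions `θ_i`, `p_i`, `z_a`, as linear functionals. -/
def tubeCoord : ι ⊕ (ι ⊕ κ) → ((ι → ℝ) × (ι ⊕ κ → ℝ)) →L[ℝ] ℝ :=
  Sum.elim
    (fun i => ContinuousLinearMap.proj (R := ℝ) (φ := fun _ : ι => ℝ) i ∘L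
      ContinuousLinearMap.fst ℝ (ι → ℝ) (ι ⊕ κ → ℝ))
    fun c => ContinuousLinearMap.proj (R := ℝ) (φ := fun _ : ι ⊕ κ => ℝ) c ∘L
      ContinuousLinearMap.snd ℝ (ι → ℝ) (ι ⊕ κ → ℝ)

@[simp]
theorem tubeCoord_inl (i : ι) (x : (ι → ℝ) × (ι ⊕ κ → ℝ)) : tubeCoord (Sum.inl i) x = x.1 i := rfl

@[simp]
theorem tubeCoord_inr (c : ι ⊕ κ) (x : (ι → ℝ) × (ι ⊕ κ → ℝ)) :
    tubeCoord (Sum.inr c) x = x.2 c := rfl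

variable [Fintype ι] [Fintype κ] [DecidableEq ι] [DecidableEq κ]

theorem prodMk_zero_eq_sum {F : Type*} [AddCommGroup F] [Module ℝ F] {ι : Type*} [Fintype ι]
    [DecidableEq ι] (v : ι → ℝ) :
    (v, (0 : F)) = ∑ i, v i • ((Pi.single i 1 : ι → ℝ), (0 : F)) := by
  refine Prod.ext (funext fun i => ?_) ?_ <;>
    simp [Prod.fst_sum, Prod.snd_sum, Finset.sum_apply, Pi.single_apply]

theorem eq_sum_tubeCoord (α : ((ι → ℝ) × (ι ⊕ κ → ℝ)) →L[ℝ] ℝ) :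
    α = ∑ i, α (Pi.single i 1, 0) • tubeCoord (Sum.inl i) +
      (∑ i, α (0, Pi.single (Sum.inl i) 1) • tubeCoord (Sum.inr (Sum.inl i)) +
        ∑ a, α (0, Pi.single (Sum.inr a) 1) • tubeCoord (Sum.inr (Sum.inr a))) := by
  refine ContinuousLinearMap.ext fun v => ?_
  have h : v = ∑ i, v.1 i • ((Pi.single i 1 : ι → ℝ), (0 : ι ⊕ κ → ℝ)) +
      ∑ c, v.2 c • ((0 : ι → ℝ), (Pi.single c 1 : ι ⊕ κ → ℝ)) := by
    refine Prod.ext (funext fun i => ?_) (funext fun c => ?_)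
    · simp [Prod.fst_sum, Finset.sum_apply, Pi.single_apply]
    · rcases c with i | a <;> simp [Prod.snd_sum, Finset.sum_apply, Pi.single_apply]
  conv_lhs => rw [h, map_add, map_sum, map_sum, Fintype.sum_sum_type]
  simp only [map_smul]
  simp [mul_comm]

/-- A bivector with canonical brackets of the coordinates `θ` and `p`. -/
theorem bilin_eq_sum_wedge [LinearOrder κ]
    (B : (((ι → ℝ) × (ι ⊕ κ → ℝ)) →L[ℝ] ℝ) →ₗ[ℝ] (((ι → ℝ) × (ι ⊕ κ → ℝ)) →L[ℝ] ℝ) →ₗ[ℝ] ℝ)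
    (hB : ∀ α, B α α = 0)
    (hθθ : ∀ i j, B (tubeCoord (Sum.inl i)) (tubeCoord (Sum.inl j)) = 0)
    (hθp : ∀ i j, B (tubeCoord (Sum.inl i)) (tubeCoord (Sum.inr (Sum.inl j))) =
      (Pi.single j 1 : ι → ℝ) i)
    (hpp : ∀ i j, B (tubeCoord (Sum.inr (Sum.inl i))) (tubeCoord (Sum.inr (Sum.inl j))) = 0)
    (hzθ : ∀ a j, B (tubeCoord (Sum.inr (Sum.inr a))) (tubeCoord (Sum.inl j)) = 0)
    (hzp : ∀ a j, B (tubeCoord (Sum.inr (Sum.inr a))) (tubeCoord (Sum.inr (Sum.inl j))) = 0)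
    (α β : ((ι → ℝ) × (ι ⊕ κ → ℝ)) →L[ℝ] ℝ) :
    B α β = ∑ i, (α (Pi.single i 1, 0) * β (0, Pi.single (Sum.inl i) 1) -
        α (0, Pi.single (Sum.inl i) 1) * β (Pi.single i 1, 0)) +
      ∑ a, ∑ b with a < b,
        B (tubeCoord (Sum.inr (Sum.inr a))) (tubeCoord (Sum.inr (Sum.inr b))) *
          (α (0, Pi.single (Sum.inr a) 1) * β (0, Pi.single (Sum.inr b) 1) -
            α (0, Pi.single (Sum.inr b) 1) * β (0, Pi.single (Sum.inr a) 1)) := by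
  have hs : ∀ α β, B α β = -B β α := by
    intro α β
    have h := hB (α + β)
    simp only [map_add, LinearMap.add_apply, hB α, hB β] at h
    linarith
  have hpθ : ∀ i j, B (tubeCoord (Sum.inr (Sum.inl i))) (tubeCoord (Sum.inl j)) =
      -(Pi.single i 1 : ι → ℝ) j := fun i j => by rw [hs, hθp]
  have hθz : ∀ j a, B (tubeCoord (Sum.inl j)) (tubeCoord (Sum.inr (Sum.inr a))) = 0 :=
    fun j a => by rw [hs, hzθ, neg_zero]
  have hpz : ∀ j a, B (tubeCoord (Sum.inr (Sum.inl j))) (tubeCoord (Sum.inr (Sum.inr a))) = 0 :=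
    fun j a => by rw [hs, hzp, neg_zero]
  -- Skew symmetry folds the full double sum of the `{z_a, z_b}` terms onto the pairs `a < b`; the
  -- diagonal vanishes.
  have hanti : ∀ u w : κ → ℝ, ∑ b, ∑ a, w b * (u a *
      B (tubeCoord (Sum.inr (Sum.inr a))) (tubeCoord (Sum.inr (Sum.inr b)))) =
      ∑ a, ∑ b with a < b,
        B (tubeCoord (Sum.inr (Sum.inr a))) (tubeCoord (Sum.inr (Sum.inr b))) *
          (u a * w b - u b * w a) := by
    intro u w
    let g : κ → κ → ℝ := fun a b => w b * (u a *
      B (tubeCoord (Sum.inr (Sum.inr a))) (tubeCoord (Sum.inr (Sum.inr b))))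
    have hg : ∀ a, g a a = 0 := fun a => by simp [g, hB]
    have h1 : ∀ a, ∑ b, g a b = ∑ b with a < b, g a b + ∑ b with b < a, g a b := by
      intro a
      rw [Finset.sum_filter, Finset.sum_filter, ← Finset.sum_add_distrib]
      refine Finset.sum_congr rfl fun b _ => ?_
      rcases lt_trichotomy a b with h | h | h
      · simp [h, h.not_gt]
      · simp [h, hg]
      · simp [h, h.not_gt]
    have h2 : ∑ a, ∑ b with b < a, g a b = ∑ a, ∑ b with a < b, g b a := by
      simp only [Finset.sum_filter]
      exact Finset.sum_comm
    calc ∑ b, ∑ a, g a b = ∑ a, ∑ b, g a b := Finset.sum_comm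
      _ = ∑ a, ∑ b with a < b, (g a b + g b a) := by
          simp only [h1, Finset.sum_add_distrib, h2]
      _ = _ := by
          refine Finset.sum_congr rfl fun a _ => Finset.sum_congr rfl fun b _ => ?_
          simp only [g]
          rw [hs (tubeCoord (Sum.inr (Sum.inr b)))]
          ring
  conv_lhs => rw [eq_sum_tubeCoord α, eq_sum_tubeCoord β]
  simp only [map_add, map_sum, map_smul, LinearMap.add_apply, LinearMap.sum_apply,
    LinearMap.smul_apply, smul_eq_mul, hθθ, hθp, hpp, hzθ, hzp, hpθ, hθz, hpz, mul_zero,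
    Finset.sum_const_zero, add_zero, zero_add, ← hanti, Finset.mul_sum]
  simp only [Pi.single_apply, mul_ite, mul_neg, mul_one, mul_zero,
    Finset.sum_ite_eq, Finset.sum_ite_eq', Finset.mem_univ, if_true,
    Finset.sum_sub_distrib, Finset.sum_neg_distrib]
  simp only [mul_comm]
  ring

end CanonicalForm

/-! ### Poisson structures with translation invariant Hamiltonian vector fields -/

section TranslationInvariance

variable {E : Type} [NormedAddCommGroup E] [NormedSpace ℝ E]
  {π : E → (E →L[ℝ] ℝ) →ₗ[ℝ] (E →L[ℝ] ℝ) →ₗ[ℝ] ℝ} {W : Set E}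

theorem IsPoissonOn.smoothNear_apply (hπ : IsPoissonOn π W) {x : E} (hx : x ∈ W) (l m : E →L[ℝ] ℝ) :
    SmoothNear (fun y => π y l m) x := by
  refine (hπ.smooth x hx l m (l.contDiff.smoothNear x) (m.contDiff.smoothNear x)).congr
    (Eventually.of_forall fun y => ?_)
  rw [bracketOf, l.fderiv, m.fderiv]

/-- A linear function whose Hamiltonian vector field is constant acts by Poisson translations. -/
theorem IsPoissonOn.fderiv_apply_eq_zero (hπ : IsPoissonOn π W) (hW : IsOpen W) {n : E →L[ℝ] ℝ}
    {w : E} (hn : ∀ x ∈ W, ∀ α, π x α n = α w) (l m : E →L[ℝ] ℝ) {x : E} (hx : x ∈ W) :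
    fderiv ℝ (fun y => π y l m) x w = 0 := by
  have hbr : ∀ l m : E →L[ℝ] ℝ, bracketOf π l m = fun y => π y l m := by
    intro l m
    funext y
    rw [bracketOf, l.fderiv, m.fderiv]
  -- Both `{l, n}` and `{n, m}` are constant, so the Jacobi identity reduces to `{{l, m}, n} = 0`,
  -- and this bracket is the derivative of `{l, m}` along `w`.
  have h := hπ.bracketOf_bracketOf_comm hW hx (n.contDiff.smoothNear x) (m.contDiff.smoothNear x)
    (l.contDiff.smoothNear x) (c := -m w) (by
      filter_upwards [hW.mem_nhds hx] with y hy
      rw [hbr]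
      exact (hπ.skew hy n m).trans (congrArg Neg.neg (hn y hy m)))
  have h0 : bracketOf π (bracketOf π l n) m x = 0 := by
    rw [hπ.bracketOf_skew hx, bracketOf_eventually_const_right (c := l w), neg_zero]
    filter_upwards [hW.mem_nhds hx] with y hy
    rw [hbr]
    exact hn y hy l
  rw [h0, hbr l m, bracketOf, n.fderiv, hn x hx] at h
  exact h

theorem Convex.eq_of_fderiv_eq_zero {F : E → ℝ} (hW : Convex ℝ W) {x y : E} (hx : x ∈ W)
    (hy : y ∈ W) (hd : ∀ z ∈ W, DifferentiableAt ℝ F z)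
    (h : ∀ z ∈ W, fderiv ℝ F z (y - x) = 0) : F y = F x := by
  obtain ⟨z, hz, he⟩ := domain_mvt (f := F) (f' := fderiv ℝ F) (s := W)
    (fun z hz => (hd z hz).hasFDerivAt.hasFDerivWithinAt) hW hx hy
  rw [h z (hW.segment_subset hx hy hz)] at he
  linarith

theorem convex_cube {κ : Type} [Fintype κ] {ε : ℝ} : Convex ℝ (Cube κ ε : Set (κ → ℝ)) :=
  convex_pi fun _ _ => convex_Ioo _ _

variable {ι κ : Type} [Fintype ι] [Fintype κ] [DecidableEq ι] [DecidableEq κ]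

/-- The local normal form of a Poisson structure on a product of a vector space and a cube, for
which the coordinates `p_i` generate translations in the directions `θ_i`. -/
theorem IsPoissonOn.exists_normal_form [LinearOrder κ]
    {π : (ι → ℝ) × (ι ⊕ κ → ℝ) → (((ι → ℝ) × (ι ⊕ κ → ℝ)) →L[ℝ] ℝ) →ₗ[ℝ]
      (((ι → ℝ) × (ι ⊕ κ → ℝ)) →L[ℝ] ℝ) →ₗ[ℝ] ℝ} {ε : ℝ} (hε : 0 < ε)
    (hπ : IsPoissonOn π (Set.univ ×ˢ (Cube (ι ⊕ κ) ε : Set (ι ⊕ κ → ℝ))))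
    (hp : ∀ q ∈ Set.univ ×ˢ (Cube (ι ⊕ κ) ε : Set (ι ⊕ κ → ℝ)), ∀ α k,
      π q α (tubeCoord (Sum.inr (Sum.inl k))) = α (Pi.single k 1, 0))
    (hθθ : ∀ x ∈ Cube (ι ⊕ κ) ε, ∀ i j,
      π (0, x) (tubeCoord (Sum.inl i)) (tubeCoord (Sum.inl j)) = 0)
    (hzθ : ∀ x ∈ Cube (ι ⊕ κ) ε, ∀ a j,
      π (0, x) (tubeCoord (Sum.inr (Sum.inr a))) (tubeCoord (Sum.inl j)) = 0) :
    ∃ f : κ → κ → (κ → ℝ) → ℝ, (∀ a b, ContDiffOn ℝ ∞ (f a b) (Cube κ ε)) ∧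
      ∀ q ∈ Set.univ ×ˢ (Cube (ι ⊕ κ) ε : Set (ι ⊕ κ → ℝ)), ∀ α β,
        π q α β = ∑ i, (α (Pi.single i 1, 0) * β (0, Pi.single (Sum.inl i) 1) -
            α (0, Pi.single (Sum.inl i) 1) * β (Pi.single i 1, 0)) +
          ∑ a, ∑ b with a < b, f a b (fun c => q.2 (Sum.inr c)) *
            (α (0, Pi.single (Sum.inr a) 1) * β (0, Pi.single (Sum.inr b) 1) -
              α (0, Pi.single (Sum.inr b) 1) * β (0, Pi.single (Sum.inr a) 1)) := by
  set Q : Set ((ι → ℝ) × (ι ⊕ κ → ℝ)) := Set.univ ×ˢ (Cube (ι ⊕ κ) ε : Set (ι ⊕ κ → ℝ))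
  have hQ : IsOpen Q := isOpen_univ.prod (Cube (ι ⊕ κ) ε).isOpen
  have hQc : Convex ℝ Q := convex_univ.prod convex_cube
  have hd : ∀ l m, ∀ q ∈ Q, DifferentiableAt ℝ (fun y => π y l m) q := fun l m q hq =>
    (hπ.smoothNear_apply hq l m).differentiableAt
  have hθ1 : ∀ l m, ∀ q ∈ Q, ∀ v : ι → ℝ, fderiv ℝ (fun y => π y l m) q (v, 0) = 0 := by
    intro l m q hq v
    rw [prodMk_zero_eq_sum, map_sum]
    refine Finset.sum_eq_zero fun k _ => ?_
    rw [map_smul, hπ.fderiv_apply_eq_zero hQ (fun x hx α => hp x hx α k) l m hq, smul_zero]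
  -- Invariance in `θ` reduces every bracket of coordinates to its value on the slice.
  have hinv : ∀ l m, ∀ q ∈ Q, π q l m = π (0, q.2) l m := by
    intro l m q hq
    refine hQc.eq_of_fderiv_eq_zero (F := fun y => π y l m) (x := (0, q.2)) ⟨trivial, hq.2⟩ hq
      (hd l m) fun z hz => ?_
    rw [show q - (0, q.2) = (q.1, 0) from Prod.ext (sub_zero _) (sub_self _)]
    exact hθ1 l m z hz q.1
  have hpθ : ∀ q ∈ Q, ∀ i j, π q (tubeCoord (Sum.inr (Sum.inl i))) (tubeCoord (Sum.inl j)) =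
      -(Pi.single i 1 : ι → ℝ) j := by
    intro q hq i j
    rw [hπ.skew hq, hp q hq]
    rfl
  -- All brackets with `θ_k` are now known on the whole domain: its Hamiltonian field is the
  -- constant field `-∂/∂p_k`, so the translation argument can be repeated in the `p` directions.
  have hθ : ∀ q ∈ Q, ∀ α k, π q α (tubeCoord (Sum.inl k)) = α (0, -Pi.single (Sum.inl k) 1) := by
    intro q hq α k
    have e : ((0 : ι → ℝ), -(Pi.single (Sum.inl k) 1 : ι ⊕ κ → ℝ)) =
      -(0, Pi.single (Sum.inl k) 1) := Prod.ext neg_zero.symm rfl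
    rw [e, map_neg]
    conv_lhs => rw [eq_sum_tubeCoord α]
    simp only [map_add, map_sum, map_smul, LinearMap.add_apply, LinearMap.sum_apply,
      LinearMap.smul_apply, smul_eq_mul, hpθ q hq]
    simp only [hinv _ _ q hq, hθθ q.2 hq.2, hzθ q.2 hq.2]
    simp [Pi.single_apply]
  have hp1 : ∀ l m, ∀ q ∈ Q, ∀ v : ι → ℝ,
      fderiv ℝ (fun y => π y l m) q (0, Sum.elim v 0) = 0 := by
    intro l m q hq v
    have hv : ((0 : ι → ℝ), (Sum.elim v 0 : ι ⊕ κ → ℝ)) =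
        ∑ k, (-v k) • ((0 : ι → ℝ), -(Pi.single (Sum.inl k) 1 : ι ⊕ κ → ℝ)) := by
      refine Prod.ext (funext fun i => ?_) (funext fun i => ?_)
      · simp [Prod.fst_sum, Finset.sum_apply]
      · rcases i with i | a <;> simp [Prod.snd_sum, Finset.sum_apply, Pi.single_apply]
    rw [hv, map_sum]
    refine Finset.sum_eq_zero fun k _ => ?_
    rw [map_smul, hπ.fderiv_apply_eq_zero hQ (fun x hx α => hθ x hx α k) l m hq, smul_zero]
  have hcube : ∀ z ∈ Cube κ ε, ((0 : ι → ℝ), (Sum.elim 0 z : ι ⊕ κ → ℝ)) ∈ Q := by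
    intro z hz
    refine ⟨trivial, mem_cube_iff.2 fun c => ?_⟩
    rcases c with i | a
    · simpa using hε
    · exact mem_cube_iff.1 hz a
  have hmem : ∀ q ∈ Q, (fun c => q.2 (Sum.inr c)) ∈ Cube κ ε := fun q hq =>
    mem_cube_iff.2 fun a => mem_cube_iff.1 hq.2 (Sum.inr a)
  have hinv' : ∀ l m, ∀ q ∈ Q, π q l m = π (0, Sum.elim 0 fun c => q.2 (Sum.inr c)) l m := by
    intro l m q hq
    rw [hinv l m q hq]
    refine hQc.eq_of_fderiv_eq_zero (F := fun y => π y l m)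
      (x := (0, (Sum.elim 0 fun c => q.2 (Sum.inr c) : ι ⊕ κ → ℝ))) (y := (0, q.2)) (hcube _ (hmem q hq))
      ⟨trivial, hq.2⟩ (hd l m) fun z hz => ?_
    have e : ((0 : ι → ℝ), q.2) - (0, (Sum.elim 0 fun c => q.2 (Sum.inr c) : ι ⊕ κ → ℝ)) =
        (0, (Sum.elim (fun i => q.2 (Sum.inl i)) 0 : ι ⊕ κ → ℝ)) := by
      refine Prod.ext (sub_zero _) (funext fun c => ?_)
      rcases c with i | a <;> simp
    rw [e]
    exact hp1 l m z hz _
  -- The functions `f a b` are the brackets `{z_a, z_b}` at `θ = 0`, `p = 0`, to which invariance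
  -- has reduced their values everywhere.
  refine ⟨fun a b z => π (0, Sum.elim 0 z) (tubeCoord (Sum.inr (Sum.inr a)))
    (tubeCoord (Sum.inr (Sum.inr b))), fun a b z hz => ?_, fun q hq α β => ?_⟩
  · have h1 : ContDiff ℝ ∞ fun z : κ → ℝ => ((0 : ι → ℝ), (Sum.elim 0 z : ι ⊕ κ → ℝ)) := by
      refine contDiff_const.prodMk (contDiff_pi.2 fun c => ?_)
      rcases c with i | a
      · exact contDiff_const
      · exact contDiff_apply ℝ ℝ a
    exact ((hπ.smoothNear_apply (hcube z hz) _ _).contDiffAt.comp z h1.contDiffAt).contDiffWithinAt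
  · have h := bilin_eq_sum_wedge (π q) (hπ.alternating q hq)
      (fun i j => by rw [hinv _ _ q hq, hθθ q.2 hq.2]) (fun i j => by rw [hp q hq]; rfl)
      (fun i j => by rw [hp q hq]; rfl)
      (fun a j => by rw [hinv _ _ q hq, hzθ q.2 hq.2]) (fun a j => by rw [hp q hq]; rfl) α β
    rw [h]
    simp only [hinv' (tubeCoord (Sum.inr (Sum.inr _))) _ q hq]

end TranslationInvariance

/-! ### Canonical charts -/

section CanonicalChart

variable {E : Type} [NormedAddCommGroup E] [NormedSpace ℝ E] [FiniteDimensional ℝ E]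
  {π : E → (E →L[ℝ] ℝ) →ₗ[ℝ] (E →L[ℝ] ℝ) →ₗ[ℝ] ℝ} {W : Set E} {ι : Type} [Fintype ι]
  [DecidableEq ι]

/-- Functions in involution with independent Hamiltonian vector fields are part of a parametrization
by canonical coordinates. -/
theorem IsPoissonOn.exists_canonical_param (hπ : IsPoissonOn π W) (hW : IsOpen W) {x₀ : E}
    (hx : x₀ ∈ W) {p : ι → E → ℝ} (hp : ∀ i, SmoothNear (p i) x₀)
    (hpp : ∀ᶠ x in 𝓝 x₀, ∀ i j, bracketOf π (p i) (p j) x = 0)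
    (hli : LinearIndependent ℝ fun i => hamField π (p i) x₀) :
    ∃ k, Module.finrank ℝ E = 2 * Fintype.card ι + k ∧
      ∃ D : (ι → ℝ) × (ι ⊕ Fin k → ℝ) → E, SmoothNear D 0 ∧ D 0 = x₀ ∧
        ∀ᶠ q in 𝓝 0, (fderiv ℝ D q).IsInvertible ∧
          (∀ i, fderiv ℝ D q (Pi.single i 1, 0) = hamField π (p i) (D q)) ∧
          (∀ i, p i (D q) = p i x₀ + q.2 (Sum.inl i)) ∧
          (∀ i j, π (D q) (tubeCoord (Sum.inl i) ∘L (fderiv ℝ D q).inverse)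
            (tubeCoord (Sum.inl j) ∘L (fderiv ℝ D q).inverse) = 0) ∧
          ∀ a j, π (D q) (tubeCoord (Sum.inr (Sum.inr a)) ∘L (fderiv ℝ D q).inverse)
            (tubeCoord (Sum.inl j) ∘L (fderiv ℝ D q).inverse) = 0 := by
  obtain ⟨k, hk, θ, z, hθ, hz, hθ0, hz0, hθp, hθθ, hzp, hzθ, hinj⟩ :=
    hπ.exists_canonical_coordinates hW hx hp hpp hli
  refine ⟨k, hk, ?_⟩
  let C : E → (ι → ℝ) × (ι ⊕ Fin k → ℝ) := fun x =>
    (fun i => θ i x, Sum.elim (fun i => p i x - p i x₀) fun a => z a x)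
  have hC : SmoothNear C x₀ := by
    refine SmoothNear.prodMk (smoothNear_pi.2 hθ) (smoothNear_pi.2 fun c => ?_)
    rcases c with i | a
    · exact ((hp i).add (contDiff_const.smoothNear x₀) :
        SmoothNear (fun x => p i x + -p i x₀) x₀)
    · exact hz a
  have hC0 : C x₀ = 0 := by
    refine Prod.ext (funext fun i => hθ0 i) (funext fun c => ?_)
    rcases c with i | a
    · exact sub_self _
    · exact hz0 a
  have hdC : ∀ {x}, DifferentiableAt ℝ C x →
      (∀ i, fderiv ℝ (θ i) x = tubeCoord (Sum.inl i) ∘L fderiv ℝ C x) ∧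
      (∀ i, fderiv ℝ (p i) x = tubeCoord (Sum.inr (Sum.inl i)) ∘L fderiv ℝ C x) ∧
      ∀ a, fderiv ℝ (z a) x = tubeCoord (Sum.inr (Sum.inr a)) ∘L fderiv ℝ C x := by
    intro x h
    have key : ∀ c, fderiv ℝ (fun y => tubeCoord c (C y)) x = tubeCoord c ∘L fderiv ℝ C x :=
      fun c => ((tubeCoord c).hasFDerivAt.comp x h.hasFDerivAt).fderiv
    refine ⟨fun i => key (Sum.inl i), fun i => ?_, fun a => key (Sum.inr (Sum.inr a))⟩
    rw [← key, ← fderiv_sub_const (p i x₀)]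
    rfl
  -- The differentials of `θ`, `p`, `z` separate vectors and their number is the dimension.
  have hinv : (fderiv ℝ C x₀).IsInvertible := by
    have h1 : Function.Injective (fderiv ℝ C x₀).toLinearMap := by
      rw [injective_iff_map_eq_zero]
      intro v hv
      change fderiv ℝ C x₀ v = 0 at hv
      obtain ⟨h1, h2, h3⟩ := hdC hC.differentiableAt
      refine hinj v (fun i => ?_) (fun i => ?_) fun a => ?_
      · rw [h1, ContinuousLinearMap.comp_apply, hv, map_zero]
      · rw [h2, ContinuousLinearMap.comp_apply, hv, map_zero]
      · rw [h3, ContinuousLinearMap.comp_apply, hv, map_zero]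
    have h2 : Module.finrank ℝ E = Module.finrank ℝ ((ι → ℝ) × (ι ⊕ Fin k → ℝ)) := by
      rw [hk, Module.finrank_prod, Module.finrank_fintype_fun_eq_card,
        Module.finrank_fintype_fun_eq_card, Fintype.card_sum, Fintype.card_fin]
      ring
    exact ⟨(LinearEquiv.ofInjectiveOfFinrankEq _ h1 h2).toContinuousLinearEquiv, by ext1; rfl⟩
  obtain ⟨D, hD, hD0, hDC, hCD⟩ := hC.exists_inverse hinv
  rw [hC0] at hD hD0 hCD
  refine ⟨D, hD, hD0, ?_⟩
  have ht : Tendsto D (𝓝 0) (𝓝 x₀) := by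
    have := hD.continuousAt.tendsto
    rwa [hD0] at this
  filter_upwards [hD, hCD.eventually_nhds, ht.eventually hDC.eventually_nhds,
    ht.eventually hC, ht.eventually hpp, ht.eventually hθp, ht.eventually hθθ, ht.eventually hzp,
    ht.eventually hzθ] with q h1 h2 h3 h4 h5 h6 h7 h8 h9
  have hDd : DifferentiableAt ℝ D q := h1.differentiableAt (by simp)
  have hCd : DifferentiableAt ℝ C (D q) := h4.differentiableAt (by simp)
  have hCDq : C (D q) = q := h2.self_of_nhds
  have e1 : fderiv ℝ C (D q) ∘L fderiv ℝ D q = ContinuousLinearMap.id ℝ _ := by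
    have h : C ∘ D =ᶠ[𝓝 q] id := h2
    rw [← fderiv_comp q hCd hDd, h.fderiv_eq, fderiv_id]
  have e2 : fderiv ℝ D q ∘L fderiv ℝ C (D q) = ContinuousLinearMap.id ℝ _ := by
    have h : D ∘ C =ᶠ[𝓝 (D q)] id := h3
    have hDd' : DifferentiableAt ℝ D (C (D q)) := by rwa [hCDq]
    have h' := fderiv_comp (D q) hDd' hCd
    rw [h.fderiv_eq, fderiv_id, hCDq] at h'
    exact h'.symm
  have e3 : (fderiv ℝ D q).inverse = fderiv ℝ C (D q) := ContinuousLinearMap.inverse_eq e2 e1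
  obtain ⟨k1, k2, k3⟩ := hdC hCd
  rw [e3]
  simp only [← k1, ← k3]
  refine ⟨ContinuousLinearMap.IsInvertible.of_inverse e2 e1, fun j => ?_, fun i => ?_, h7, h9⟩
  -- The components of the field of `p_j` in these coordinates are its brackets `{θ_i, p_j} = δ_ij`,
  -- `{p_i, p_j} = 0`, `{z_a, p_j} = 0`.
  · have h : fderiv ℝ C (D q) (hamField π (p j) (D q)) = (Pi.single j 1, 0) := by
      refine Prod.ext (funext fun i => ?_) (funext fun c => ?_)
      · refine Eq.trans ?_ (h6 i j)
        rw [← fderiv_hamField, k1]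
        rfl
      · rcases c with i | a
        · refine Eq.trans ?_ (h5 i j)
          rw [← fderiv_hamField, k2]
          rfl
        · refine Eq.trans ?_ (h8 a j)
          rw [← fderiv_hamField, k3]
          rfl
    rw [← h]
    exact DFunLike.congr_fun e2 _
  · have h := congrFun (congrArg Prod.snd hCDq) (Sum.inl i)
    rw [← h]
    exact (add_sub_cancel _ _).symm

end CanonicalChart

/-! ### Adapted parametrizations -/

section AdaptedParam

variable {ℓ₁ ℓ₂ d : ℕ} {M : Type*} [TopologicalSpace M] [ChartedSpace (EuclideanSpace ℝ (Fin d)) M]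

theorem exists_isLocalParam [IsManifold (𝓡 d) ∞ M] (y₀ : M) :
    ∃ (Ψ : EuclideanSpace ℝ (Fin d) → M) (Q : Set (EuclideanSpace ℝ (Fin d)))
      (x₀ : EuclideanSpace ℝ (Fin d)), IsLocalParam d Ψ Q ∧ x₀ ∈ Q ∧ Ψ x₀ = y₀ := by
  refine ⟨(extChartAt (𝓡 d) y₀).symm, (extChartAt (𝓡 d) y₀).target, extChartAt (𝓡 d) y₀ y₀,
    ⟨isOpen_extChartAt_target y₀, fun q hq => ?_, fun q hq => ?_⟩, mem_extChartAt_target y₀,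
    extChartAt_to_inv y₀⟩
  · exact (contMDiffOn_extChartAt_symm y₀).contMDiffAt
      ((isOpen_extChartAt_target y₀).mem_nhds hq)
  · have h := isInvertible_mfderivWithin_extChartAt_symm (I := 𝓡 d) hq
    rw [ModelWithCorners.range_eq_univ, mfderivWithin_univ] at h
    exact h

variable {V V' : Type} [NormedAddCommGroup V] [NormedSpace ℝ V] [NormedAddCommGroup V']
  [NormedSpace ℝ V']

theorem paramDeriv_comp {Ψ : V → M} {D : V' → V} {q : V'}
    (hΨ : MDifferentiableAt 𝓘(ℝ, V) (𝓡 d) Ψ (D q)) (hD : DifferentiableAt ℝ D q) :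
    paramDeriv d (Ψ ∘ D) q = paramDeriv d Ψ (D q) ∘L fderiv ℝ D q :=
  (HasMFDerivAt.comp (g := Ψ) (f := D) q hΨ.hasMFDerivAt hD.hasFDerivAt.hasMFDerivAt).mfderiv

/-- The transformation law of the bivector under a change of coordinates `D`; through it the
brackets from `exists_canonical_param` become brackets for the parametrization `Ψ ∘ D` of `M`. -/
theorem PoissonStructure.pullback_comp_param (P : PoissonStructure d M) {Ψ : V → M} {D : V' → V}
    {q : V'} (hΨ : MDifferentiableAt 𝓘(ℝ, V) (𝓡 d) Ψ (D q)) (hD : DifferentiableAt ℝ D q)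
    (hinv : (fderiv ℝ D q).IsInvertible) (l m : V' →L[ℝ] ℝ) :
    P.pullback (Ψ ∘ D) q l m =
      P.pullback Ψ (D q) (l ∘L (fderiv ℝ D q).inverse) (m ∘L (fderiv ℝ D q).inverse) := by
  rw [P.pullback_apply, P.pullback_apply, paramDeriv_comp hΨ hD]
  have h : (paramDeriv d Ψ (D q) ∘L fderiv ℝ D q).inverse =
    (fderiv ℝ D q).inverse ∘L (paramDeriv d Ψ (D q)).inverse := hinv.inverse_comp_of_right
  have key : ∀ γ : V' →L[ℝ] ℝ, γ ∘L (paramDeriv d Ψ (D q) ∘L fderiv ℝ D q).inverse =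
      (γ ∘L (fderiv ℝ D q).inverse) ∘L (paramDeriv d Ψ (D q)).inverse := by
    intro γ
    rw [h]
    rfl
  exact congrArg₂ (fun a b => P.bivector (Ψ (D q)) a b) (key l) (key m)

theorem IsLocalParam.comp [IsManifold (𝓡 d) ∞ M] {Ψ : V → M} {Q : Set V} (h : IsLocalParam d Ψ Q)
    {D : V' → V} {q₀ : V'} (hD : SmoothNear D q₀) (hq₀ : D q₀ ∈ Q)
    (hinv : ∀ᶠ q in 𝓝 q₀, (fderiv ℝ D q).IsInvertible) :
    ∃ Q', IsLocalParam d (Ψ ∘ D) Q' ∧ q₀ ∈ Q' ∧ ∀ q ∈ Q', D q ∈ Q := by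
  obtain ⟨Q', hQ', hQo, hq'⟩ := eventually_nhds_iff.1
    (hD.and (hinv.and (hD.continuousAt.eventually (h.isOpen.mem_nhds hq₀))))
  refine ⟨Q', ⟨hQo, fun q hq => ?_, fun q hq => ?_⟩, hq', fun q hq => (hQ' q hq).2.2⟩
  · obtain ⟨h1, -, h3⟩ := hQ' q hq
    exact (h.smooth _ h3).comp q h1.contMDiffAt
  · obtain ⟨h1, h2, h3⟩ := hQ' q hq
    rw [paramDeriv_comp (h.mdifferentiableAt h3) (h1.differentiableAt (by simp))]
    exact (h.invertible _ h3).comp h2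

variable [MulAction (GenTorus ℓ₁ ℓ₂) M]
  [ContMDiffSMul (GenTorus.model ℓ₁ ℓ₂) (𝓡 d) ∞ (GenTorus ℓ₁ ℓ₂) M]
  {P : PoissonStructure d M} {p : GenTorus.Idx ℓ₁ ℓ₂ → M → ℝ}

/-- Near a point with trivial isotropy group there is a canonical parametrization for which the
momenta are coordinates and the conjugate coordinate directions are tangent to the orbits. -/
theorem IsMomentumMap.exists_adapted_param [IsManifold (𝓡 d) ∞ M] (hp : IsMomentumMap P p) {y₀ : M}
    (hy₀ : MulAction.stabilizer (GenTorus ℓ₁ ℓ₂) y₀ = ⊥) :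
    ∃ k, d = 2 * (ℓ₁ + ℓ₂) + k ∧
      ∃ (Ψ : (GenTorus.Idx ℓ₁ ℓ₂ → ℝ) × (GenTorus.Idx ℓ₁ ℓ₂ ⊕ Fin k → ℝ) → M) (Q : Set _),
        IsLocalParam d Ψ Q ∧ 0 ∈ Q ∧ Ψ 0 = y₀ ∧ ∀ᶠ q in 𝓝 0,
          (∀ i, paramDeriv d Ψ q (Pi.single i 1, 0) = fundamentalField d i (Ψ q)) ∧
          (∀ i, p i (Ψ q) = p i y₀ + q.2 (Sum.inl i)) ∧
          (∀ i j, P.pullback Ψ q (tubeCoord (Sum.inl i)) (tubeCoord (Sum.inl j)) = 0) ∧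
          ∀ a j, P.pullback Ψ q (tubeCoord (Sum.inr (Sum.inr a))) (tubeCoord (Sum.inl j)) = 0 := by
  obtain ⟨Ψ, Q, x₀, hΨ, hx₀, rfl⟩ := exists_isLocalParam (d := d) y₀
  have hps : ∀ i, SmoothNear (p i ∘ Ψ) x₀ := fun i => by
    filter_upwards [hΨ.isOpen.mem_nhds hx₀] with q hq
    exact ((hp.smooth i).contMDiffAt.comp q (hΨ.smooth q hq)).contDiffAt
  obtain ⟨k, hk, D, hD, hD0, hDq⟩ := (hΨ.isPoissonOn_pullback P).exists_canonical_param hΨ.isOpen hx₀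
    hps (by filter_upwards [hΨ.isOpen.mem_nhds hx₀] with q hq using hΨ.bracketOf_momenta hp hq)
    (hΨ.linearIndependent_hamField hp hx₀ hy₀)
  refine ⟨k, by simpa using hk, Ψ ∘ D, ?_⟩
  obtain ⟨Q', hQ', h0, hDQ⟩ := hΨ.comp hD (by rwa [hD0]) (hDq.mono fun q h => h.1)
  refine ⟨Q', hQ', h0, by rw [Function.comp_apply, hD0], ?_⟩
  filter_upwards [hDq, hD, hQ'.isOpen.mem_nhds h0] with q ⟨h1, h2, h3, h4, h5⟩ h6 h7
  have hΨd := hΨ.mdifferentiableAt (hDQ q h7)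
  have hDd : DifferentiableAt ℝ D q := h6.differentiableAt (by simp)
  refine ⟨fun i => ?_, h3, fun i j => ?_, fun a j => ?_⟩
  · refine Eq.trans ?_ (hΨ.paramDeriv_hamField hp (hDQ q h7) i)
    rw [paramDeriv_comp hΨd hDd, ← h2]
    rfl
  · rw [P.pullback_comp_param hΨd hDd h1, h4]
  · rw [P.pullback_comp_param hΨd hDd h1, h5]

/-! ### First-order behaviour of the tube map. -/

variable {κ : Type} [Fintype κ]

theorem paramDeriv_tubeMap_left {σ : (κ → ℝ) → M} {t v : GenTorus.Idx ℓ₁ ℓ₂ → ℝ} {x : κ → ℝ}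
    (hσ : ContMDiffAt 𝓘(ℝ, κ → ℝ) (𝓡 d) ∞ σ x) :
    paramDeriv d (tubeMap ℓ₁ ℓ₂ σ) (t, x) (v, 0) =
      ∑ i, v i • fundamentalField d i (tubeMap ℓ₁ ℓ₂ σ (t, x)) := by
  have h1 : HasFDerivAt (fun s : GenTorus.Idx ℓ₁ ℓ₂ → ℝ => (s, x))
      (ContinuousLinearMap.inl ℝ (GenTorus.Idx ℓ₁ ℓ₂ → ℝ) (κ → ℝ)) t := hasFDerivAt_prodMk_left t x
  have h2 := paramDeriv_comp (d := d) (D := fun s : GenTorus.Idx ℓ₁ ℓ₂ → ℝ => (s, x))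
    ((contMDiffAt_tubeMap (q := (t, x)) hσ).mdifferentiableAt (by simp)) h1.differentiableAt
  rw [h1.fderiv] at h2
  exact (DFunLike.congr_fun h2 v).symm.trans (paramDeriv_orbit (σ x) t v)

/-- The derivative at a point of the slice of the map defining a tube. -/
theorem paramDeriv_tubeMap_slice {Ψ : (GenTorus.Idx ℓ₁ ℓ₂ → ℝ) × (κ → ℝ) → M} {x : κ → ℝ}
    (hΨ : ContMDiffAt 𝓘(ℝ, (GenTorus.Idx ℓ₁ ℓ₂ → ℝ) × (κ → ℝ)) (𝓡 d) ∞ Ψ (0, x))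
    (h : ∀ i, paramDeriv d Ψ (0, x) (Pi.single i 1, 0) = fundamentalField d i (Ψ (0, x))) :
    paramDeriv d (tubeMap ℓ₁ ℓ₂ fun x => Ψ (0, x)) (0, x) = paramDeriv d Ψ (0, x) := by
  have h1 : HasFDerivAt (fun y : κ → ℝ => ((0 : GenTorus.Idx ℓ₁ ℓ₂ → ℝ), y))
      (ContinuousLinearMap.inr ℝ (GenTorus.Idx ℓ₁ ℓ₂ → ℝ) (κ → ℝ)) x := hasFDerivAt_prodMk_right 0 x
  have hσ : ContMDiffAt 𝓘(ℝ, κ → ℝ) (𝓡 d) ∞ (fun x => Ψ (0, x)) x :=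
    ContMDiffAt.comp (g := Ψ) x hΨ (contDiff_prodMk_right _).contMDiff.contMDiffAt
  have hz : ∀ y, tubeMap ℓ₁ ℓ₂ (fun x => Ψ (0, x)) (0, y) = Ψ (0, y) := fun y => by simp [tubeMap]
  have e1 := paramDeriv_comp (d := d) (Ψ := tubeMap ℓ₁ ℓ₂ fun x => Ψ (0, x))
    (D := fun y : κ → ℝ => ((0 : GenTorus.Idx ℓ₁ ℓ₂ → ℝ), y))
    ((contMDiffAt_tubeMap (q := (0, x)) hσ).mdifferentiableAt (by simp)) h1.differentiableAt
  have e2 := paramDeriv_comp (d := d) (Ψ := Ψ)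
    (D := fun y : κ → ℝ => ((0 : GenTorus.Idx ℓ₁ ℓ₂ → ℝ), y))
    (hΨ.mdifferentiableAt (by simp)) h1.differentiableAt
  have e3 : tubeMap ℓ₁ ℓ₂ (fun x => Ψ (0, x)) ∘ (fun y : κ → ℝ => ((0 : GenTorus.Idx ℓ₁ ℓ₂ → ℝ), y)) =
      Ψ ∘ fun y : κ → ℝ => ((0 : GenTorus.Idx ℓ₁ ℓ₂ → ℝ), y) := funext hz
  rw [e3, h1.fderiv] at e1
  rw [h1.fderiv] at e2
  refine ContinuousLinearMap.ext fun v => ?_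
  have hv : v = (v.1, 0) + (0, v.2) := by simp
  rw [hv, map_add]
  refine Eq.trans ?_ (map_add (paramDeriv d Ψ (0, x)) _ _).symm
  -- Along the orbits both derivatives give the fundamental fields; along the slice the two maps
  -- coincide.
  refine congrArg₂ (fun a b : EuclideanSpace ℝ (Fin d) => a + b) ?_ ?_
  · refine (paramDeriv_tubeMap_left hσ).trans ?_
    rw [hz, prodMk_zero_eq_sum]
    refine Eq.trans ?_ (map_sum (paramDeriv d Ψ (0, x)) _ _).symm
    refine Finset.sum_congr rfl fun i _ => ?_
    rw [map_smul, h]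
  · exact (DFunLike.congr_fun e1 v.2).symm.trans (DFunLike.congr_fun e2 v.2)

end AdaptedParam

/-! ### The Carathéodory–Jacobi–Lie theorem for Hamiltonian actions of Abelian groups -/

section Main

variable {ℓ₁ ℓ₂ d : ℕ} {M : Type*} [TopologicalSpace M] [ChartedSpace (EuclideanSpace ℝ (Fin d)) M]

/-- The coordinate bivector depends only on the first jet of the parametrization. This lets the tube
map inherit the brackets of `Ψ` at points of the slice, where the two agree only to first order. -/
theorem PoissonStructure.pullback_congr (P : PoissonStructure d M) {V : Type}
    [NormedAddCommGroup V] [NormedSpace ℝ V] {Ψ Ψ' : V → M} {q : V} (h : Ψ q = Ψ' q)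
    (h' : paramDeriv d Ψ q = paramDeriv d Ψ' q) : P.pullback Ψ q = P.pullback Ψ' q := by
  have key : ∀ (y y' : M) (A A' : V →L[ℝ] EuclideanSpace ℝ (Fin d)) (l m : V →L[ℝ] ℝ), y = y' →
      A = A' → P.bivector y (show EuclideanSpace ℝ (Fin d) →L[ℝ] ℝ from l ∘L A.inverse)
        (show EuclideanSpace ℝ (Fin d) →L[ℝ] ℝ from m ∘L A.inverse) =
      P.bivector y' (show EuclideanSpace ℝ (Fin d) →L[ℝ] ℝ from l ∘L A'.inverse)
        (show EuclideanSpace ℝ (Fin d) →L[ℝ] ℝ from m ∘L A'.inverse) := by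
    rintro y _ A _ l m rfl rfl
    rfl
  refine LinearMap.ext fun l => LinearMap.ext fun m => ?_
  exact key _ _ _ _ l m h h'

variable [MulAction (GenTorus ℓ₁ ℓ₂) M]
  [ContMDiffSMul (GenTorus.model ℓ₁ ℓ₂) (𝓡 d) ∞ (GenTorus ℓ₁ ℓ₂) M]
  {P : PoissonStructure d M} {p : GenTorus.Idx ℓ₁ ℓ₂ → M → ℝ}

/-- On a tube the momenta generate translations along the orbits. -/
theorem IsMomentumMap.pullback_tubeMap_apply (hp : IsMomentumMap P p) {κ : Type} [Fintype κ]
    {σ : (GenTorus.Idx ℓ₁ ℓ₂ ⊕ κ → ℝ) → M} {c : GenTorus.Idx ℓ₁ ℓ₂ → ℝ} {ε : ℝ}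
    (hσ : ∀ x ∈ Cube (GenTorus.Idx ℓ₁ ℓ₂ ⊕ κ) ε,
      ContMDiffAt 𝓘(ℝ, GenTorus.Idx ℓ₁ ℓ₂ ⊕ κ → ℝ) (𝓡 d) ∞ σ x)
    (hpσ : ∀ x ∈ Cube (GenTorus.Idx ℓ₁ ℓ₂ ⊕ κ) ε, ∀ i, p i (σ x) = c i + x (Sum.inl i))
    (hQ : IsLocalParam d (tubeMap ℓ₁ ℓ₂ σ)
      (Set.univ ×ˢ (Cube (GenTorus.Idx ℓ₁ ℓ₂ ⊕ κ) ε : Set _)))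
    {q : (GenTorus.Idx ℓ₁ ℓ₂ → ℝ) × (GenTorus.Idx ℓ₁ ℓ₂ ⊕ κ → ℝ)}
    (hq : q ∈ Set.univ ×ˢ (Cube (GenTorus.Idx ℓ₁ ℓ₂ ⊕ κ) ε : Set _))
    (α : ((GenTorus.Idx ℓ₁ ℓ₂ → ℝ) × (GenTorus.Idx ℓ₁ ℓ₂ ⊕ κ → ℝ)) →L[ℝ] ℝ)
    (i : GenTorus.Idx ℓ₁ ℓ₂) :
    P.pullback (tubeMap ℓ₁ ℓ₂ σ) q α (tubeCoord (Sum.inr (Sum.inl i))) =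
      α (Pi.single i 1, 0) := by
  have h1 : fderiv ℝ (p i ∘ tubeMap ℓ₁ ℓ₂ σ) q = tubeCoord (Sum.inr (Sum.inl i)) := by
    have h : p i ∘ tubeMap ℓ₁ ℓ₂ σ =ᶠ[𝓝 q] fun q => c i + tubeCoord (Sum.inr (Sum.inl i)) q := by
      filter_upwards [hQ.isOpen.mem_nhds hq] with x hx
      rw [Function.comp_apply, tubeMap, hp.equivariant, hpσ x.2 hx.2]
      rfl
    rw [h.fderiv_eq, fderiv_const_add, ContinuousLinearMap.fderiv]
  have h2 : hamField (P.pullback (tubeMap ℓ₁ ℓ₂ σ)) (p i ∘ tubeMap ℓ₁ ℓ₂ σ) q =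
      (Pi.single i 1, 0) := by
    -- Both vectors are mapped to the `i`-th fundamental field: the left one because `p_i` is a
    -- momentum, the right one because the tube map is equivariant.
    refine (hQ.invertible q hq).injective ?_
    rw [hQ.paramDeriv_hamField hp hq]
    refine Eq.trans ?_ (paramDeriv_tubeMap_left (t := q.1) (hσ q.2 hq.2)).symm
    simp [Pi.single_apply]
  rw [← h1, ← apply_hamField, h2]

end Main

/-! ### Assembly of the tube and its coordinates. -/

theorem theorem2p15
    (ℓ₁ ℓ₂ d : ℕ) (hℓ : 0 < ℓ₁ + ℓ₂)
    (M : Type*) [TopologicalSpace M] [ChartedSpace (EuclideanSpace ℝ (Fin d)) M]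
    [IsManifold (𝓡 d) ∞ M] [T2Space M] [SecondCountableTopology M] [ConnectedSpace M]
    (P : PoissonStructure d M)
    [MulAction (GenTorus ℓ₁ ℓ₂) M]
    [ContMDiffSMul (GenTorus.model ℓ₁ ℓ₂) (𝓡 d) ∞ (GenTorus ℓ₁ ℓ₂) M]
    [ProperSMul (GenTorus ℓ₁ ℓ₂) M] [FaithfulSMul (GenTorus ℓ₁ ℓ₂) M]
    (p : GenTorus.Idx ℓ₁ ℓ₂ → M → ℝ) (hp : IsMomentumMap P p)
    (y₀ : M) (hy₀ : MulAction.stabilizer (GenTorus ℓ₁ ℓ₂) y₀ = ⊥) :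
    -- `k = d - 2ℓ` is the number of transversal coordinates
    ∃ k : ℕ, d = 2 * (ℓ₁ + ℓ₂) + k ∧
    ∃ (U : TopologicalSpace.Opens M) (ε : ℝ)
      (θ : GenTorus.Idx ℓ₁ ℓ₂ → U → ℝ) (z : Fin k → U → ℝ)
      (Φ : TubeDiffeo d ℓ₁ ℓ₂ U (GenTorus.Idx ℓ₁ ℓ₂ ⊕ Fin k) ε)
      (f : Fin k → Fin k → (Fin k → ℝ) → ℝ),
      0 < ε ∧
      -- `U` is invariant
      (∀ g : GenTorus ℓ₁ ℓ₂, ∀ y ∈ U, g • y ∈ U) ∧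
      -- the diffeomorphism is given by the angles, the shifted momenta and the functions `z`
      (∀ y : U, (Φ y).1 = GenTorus.exp (fun i => θ i y) ∧
        ((Φ y).2 : GenTorus.Idx ℓ₁ ℓ₂ ⊕ Fin k → ℝ) =
          Sum.elim (fun i => p i y - p i y₀) (fun a => z a y)) ∧
      -- `y₀` lies in `U` and corresponds to `(e, 0)`
      (∃ h : y₀ ∈ U, (Φ ⟨y₀, h⟩).1 = 1 ∧
        ((Φ ⟨y₀, h⟩).2 : GenTorus.Idx ℓ₁ ℓ₂ ⊕ Fin k → ℝ) = 0) ∧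
      -- the functions `f a b` are smooth functions of `z`
      (∀ a b, ContDiffOn ℝ ∞ (f a b) (Cube (Fin k) ε)) ∧
      -- the Poisson bivector at the point with coordinates `q`
      ∀ (q : (GenTorus.Idx ℓ₁ ℓ₂ → ℝ) × Cube (GenTorus.Idx ℓ₁ ℓ₂ ⊕ Fin k) ε)
        (α β : Cotangent d (Φ.point q)),
        P.bivector (Φ.point q) α β =
          (∑ i, wedge (Φ.dTheta q i) (Φ.dX q (Sum.inl i)) α β) +
          ∑ a, ∑ b with a < b,
            f a b (fun c => (q.2 : GenTorus.Idx ℓ₁ ℓ₂ ⊕ Fin k → ℝ) (Sum.inr c)) *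
              wedge (Φ.dX q (Sum.inr a)) (Φ.dX q (Sum.inr b)) α β := by
  obtain ⟨k, hk, Ψ, Q, hΨ, h0, hΨ0, hev⟩ := hp.exists_adapted_param hy₀
  refine ⟨k, hk, ?_⟩
  let σ : (GenTorus.Idx ℓ₁ ℓ₂ ⊕ Fin k → ℝ) → M := fun x => Ψ (0, x)
  have hσ0 : σ 0 = y₀ := hΨ0
  -- The slice parameters at which all properties of the adapted parametrization hold at `θ = 0`.
  have hgood : {x : GenTorus.Idx ℓ₁ ℓ₂ ⊕ Fin k → ℝ | ((0 : GenTorus.Idx ℓ₁ ℓ₂ → ℝ), x) ∈ Q ∧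
      (∀ i, paramDeriv d Ψ (0, x) (Pi.single i 1, 0) = fundamentalField d i (Ψ (0, x))) ∧
      (∀ i, p i (Ψ (0, x)) = p i y₀ + x (Sum.inl i)) ∧
      (∀ i j, P.pullback Ψ (0, x) (tubeCoord (Sum.inl i)) (tubeCoord (Sum.inl j)) = 0) ∧
      ∀ a j, P.pullback Ψ (0, x) (tubeCoord (Sum.inr (Sum.inr a))) (tubeCoord (Sum.inl j)) = 0} ∈
      𝓝 0 := by
    have hc : ContinuousAt (fun x : GenTorus.Idx ℓ₁ ℓ₂ ⊕ Fin k → ℝ =>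
      ((0 : GenTorus.Idx ℓ₁ ℓ₂ → ℝ), x)) 0 := by fun_prop
    exact hc.eventually ((hΨ.isOpen.eventually_mem h0).and hev)
  set G := {x : GenTorus.Idx ℓ₁ ℓ₂ ⊕ Fin k → ℝ | _}
  have hσ : ∀ x ∈ G, ContMDiffAt 𝓘(ℝ, GenTorus.Idx ℓ₁ ℓ₂ ⊕ Fin k → ℝ) (𝓡 d) ∞ σ x := fun x hx =>
    ContMDiffAt.comp (g := Ψ) x (hΨ.smooth _ hx.1) (contDiff_prodMk_right _).contMDiff.contMDiffAt
  have hslice : ∀ x ∈ G, paramDeriv d (tubeMap ℓ₁ ℓ₂ σ) (0, x) = paramDeriv d Ψ (0, x) :=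
    fun x hx => paramDeriv_tubeMap_slice (hΨ.smooth _ hx.1) hx.2.1
  have hloc : ∀ ε, (Cube (GenTorus.Idx ℓ₁ ℓ₂ ⊕ Fin k) ε : Set _) ⊆ G →
      IsLocalParam d (tubeMap ℓ₁ ℓ₂ σ)
        (Set.univ ×ˢ (Cube (GenTorus.Idx ℓ₁ ℓ₂ ⊕ Fin k) ε : Set _)) := by
    intro ε hε
    refine ⟨isOpen_univ.prod (Cube _ ε).isOpen,
      fun q hq => contMDiffAt_tubeMap (hσ _ (hε hq.2)), fun q hq => ?_⟩
    refine isInvertible_paramDeriv_tubeMap (t := q.1) (hσ _ (hε hq.2)) ?_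
    have h := hΨ.invertible _ (hε hq.2).1
    rw [← hslice _ (hε hq.2)] at h
    exact h
  -- Two cubes are needed: on the first the tube map is a local diffeomorphism, which yields the
  -- neighbourhood `N` of injectivity; the second is chosen inside `N`.
  obtain ⟨ε₁, hε₁, hG₁⟩ := exists_cube_subset hgood
  obtain ⟨N, hN, hinj⟩ := eventually_injective_tube (hloc ε₁ hG₁) ⟨trivial, zero_mem_cube hε₁⟩
    (hσ 0 (mem_of_mem_nhds hgood)).continuousAt (by rwa [hσ0])
  obtain ⟨ε, hε, hGN⟩ := exists_cube_subset (inter_mem hgood hN)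
  have hQ := hloc ε fun x hx => (hGN hx).1
  have hσε : ∀ x ∈ Cube (GenTorus.Idx ℓ₁ ℓ₂ ⊕ Fin k) ε,
      ContMDiffAt 𝓘(ℝ, GenTorus.Idx ℓ₁ ℓ₂ ⊕ Fin k → ℝ) (𝓡 d) ∞ σ x := fun x hx =>
    hσ x (hGN hx).1
  have hpσ : ∀ x ∈ Cube (GenTorus.Idx ℓ₁ ℓ₂ ⊕ Fin k) ε, ∀ i,
      p i (σ x) = p i y₀ + x (Sum.inl i) := fun x hx => (hGN hx).1.2.2.1
  obtain ⟨U, Φ, hU, hΦ⟩ := exists_tubeDiffeo hσε hQ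
    fun x hx x' hx' => hinj x (hGN hx).2 x' (hGN hx').2
  have hpull : ∀ x ∈ Cube (GenTorus.Idx ℓ₁ ℓ₂ ⊕ Fin k) ε,
      P.pullback (tubeMap ℓ₁ ℓ₂ σ) (0, x) = P.pullback Ψ (0, x) := fun x hx =>
    P.pullback_congr (by simp [tubeMap, σ]) (hslice x (hGN hx).1)
  obtain ⟨f, hf, hfP⟩ := (hQ.isPoissonOn_pullback P).exists_normal_form hε
    (fun q hq α i => hp.pullback_tubeMap_apply hσε hpσ hQ hq α i)
    (fun x hx i j => by rw [hpull x hx, (hGN hx).1.2.2.2.1])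
    (fun x hx a j => by rw [hpull x hx, (hGN hx).1.2.2.2.2])
  have hy₀U : y₀ ∈ U := (hU y₀).2 ⟨1, ⟨0, zero_mem_cube hε⟩, by rw [one_smul]; exact hσ0⟩
  have hΦy₀ : Φ ⟨y₀, hy₀U⟩ = (1, ⟨0, zero_mem_cube hε⟩) := by
    have h : (⟨y₀, hy₀U⟩ : U) = Φ.symm (1, ⟨0, zero_mem_cube hε⟩) := by
      refine Subtype.ext ?_
      rw [hΦ, one_smul]
      exact hσ0.symm
    rw [h, Φ.apply_symm_apply]
  -- The angles are principal arguments, possibly discontinuous at the branch cut; only their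
  -- exponentials enter the diffeomorphism.
  refine ⟨U, ε, fun i y => GenTorus.log (Φ y).1 i,
    fun a y => ((Φ y).2 : GenTorus.Idx ℓ₁ ℓ₂ ⊕ Fin k → ℝ) (Sum.inr a), Φ, f, hε,
    fun g y hy => ?_, fun y => ⟨(GenTorus.exp_log _).symm, funext fun c => ?_⟩,
    ⟨hy₀U, by rw [hΦy₀], by rw [hΦy₀]⟩, hf, ?_⟩
  · obtain ⟨g', x, rfl⟩ := (hU y).1 hy
    exact (hU _).2 ⟨g * g', x, mul_smul g g' _⟩
  · rcases c with i | a
    · have h : (y : M) = (Φ y).1 • σ (Φ y).2 := by rw [← hΦ, Φ.symm_apply_apply]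
      rw [Sum.elim_inl, h, hp.equivariant, hpσ _ (Φ y).2.2, add_sub_cancel_left]
    · rfl
  -- The covectors live over `Φ.point q`, so `Φ.point` is replaced by the tube map as a whole map,
  -- for which the normal form in coordinates is already known.
  · have key : ∀ Θ : (GenTorus.Idx ℓ₁ ℓ₂ → ℝ) × Cube (GenTorus.Idx ℓ₁ ℓ₂ ⊕ Fin k) ε → M,
        (Θ = fun q => tubeMap ℓ₁ ℓ₂ σ (q.1, q.2)) → ∀ q (α β : Cotangent d (Θ q)),
        P.bivector (Θ q) α β =
          (∑ i, wedge
            (mfderiv (𝓘(ℝ, GenTorus.Idx ℓ₁ ℓ₂ → ℝ).prod 𝓘(ℝ, GenTorus.Idx ℓ₁ ℓ₂ ⊕ Fin k → ℝ)) (𝓡 d)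
              Θ q ((Pi.single i 1 : GenTorus.Idx ℓ₁ ℓ₂ → ℝ), (0 : GenTorus.Idx ℓ₁ ℓ₂ ⊕ Fin k → ℝ)))
            (mfderiv (𝓘(ℝ, GenTorus.Idx ℓ₁ ℓ₂ → ℝ).prod 𝓘(ℝ, GenTorus.Idx ℓ₁ ℓ₂ ⊕ Fin k → ℝ)) (𝓡 d)
              Θ q ((0 : GenTorus.Idx ℓ₁ ℓ₂ → ℝ),
                (Pi.single (Sum.inl i) 1 : GenTorus.Idx ℓ₁ ℓ₂ ⊕ Fin k → ℝ))) α β) +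
          ∑ a, ∑ b with a < b,
            f a b (fun c => (q.2 : GenTorus.Idx ℓ₁ ℓ₂ ⊕ Fin k → ℝ) (Sum.inr c)) * wedge
            (mfderiv (𝓘(ℝ, GenTorus.Idx ℓ₁ ℓ₂ → ℝ).prod 𝓘(ℝ, GenTorus.Idx ℓ₁ ℓ₂ ⊕ Fin k → ℝ)) (𝓡 d)
              Θ q ((0 : GenTorus.Idx ℓ₁ ℓ₂ → ℝ),
                (Pi.single (Sum.inr a) 1 : GenTorus.Idx ℓ₁ ℓ₂ ⊕ Fin k → ℝ)))
            (mfderiv (𝓘(ℝ, GenTorus.Idx ℓ₁ ℓ₂ → ℝ).prod 𝓘(ℝ, GenTorus.Idx ℓ₁ ℓ₂ ⊕ Fin k → ℝ)) (𝓡 d)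
              Θ q ((0 : GenTorus.Idx ℓ₁ ℓ₂ → ℝ),
                (Pi.single (Sum.inr b) 1 : GenTorus.Idx ℓ₁ ℓ₂ ⊕ Fin k → ℝ))) α β := by
      rintro _ rfl q α β
      have hq : (q.1, (q.2 : GenTorus.Idx ℓ₁ ℓ₂ ⊕ Fin k → ℝ)) ∈
        (Set.univ : Set (GenTorus.Idx ℓ₁ ℓ₂ → ℝ)) ×ˢ
          (Cube (GenTorus.Idx ℓ₁ ℓ₂ ⊕ Fin k) ε : Set _) := ⟨trivial, q.2.2⟩
      rw [mfderiv_comp_prod_subtype_val (hQ.mdifferentiableAt hq)]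
      exact (hQ.pullback_comp P hq α β).symm.trans (hfP _ hq _ _)
    exact key Φ.point (funext fun q => hΦ _)
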